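/- Let $d\ge 1$ and let $\Omega\subset\mathbb{R}^d$ be a nonempty open bounded connected polyhedral set: $\Omega$ is the interior of $\overline\Omega$, and $\partial\Omega=\overline\Omega\setminus\Omega$ is contained in a finite union of hyperplanes (equivalently, $\Omega$ is bounded, connected, and the interior of a finite union of convex polytopes). **Discretisations.** A discretisation of $\Omega$ is a triple $\mathcal D=(\mathcal M,\mathcal E,\mathcal P)$ such that: 1. $\mathcal M$ is a finite family of nonempty connected open pairwise disjoint subsets $K$ of $\Omega$ with $\overline\Omega=\bigcup_{K\in\mathcal M}\overline K$. Write $\partial K=\overline K\setminus K$, $|K|$ for the Lebesgue measure and $h_K$ for the diameter of $K$. 2. $\mathcal E$ is a finite family of pairwise disjoint subsets $\sigma$ of $\overline\Omega$. Each $\sigma$ is a nonempty relatively open subset of a hyperplane, with $(d-1)$-dimensional Lebesgue measure $|\sigma|>0$, and $\overline\sigma\setminus\sigma$ has $(d-1)$-dimensional measure $0$. For each $K\in\mathcal M$ there is a subset $\mathcal E_K\subset\mathcal E$ with $\partial K=\bigcup_{\sigma\in\mathcal E_K}\overline\sigma$. Put $\mathcal M_\sigma=\{K\in\mathcal M:\sigma\in\mathcal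 E_K\}$. For each $\sigma\in\mathcal E$, either $\mathcal M_\sigma$ has exactly one element and $\sigma\subset\partial\Omega$ (then $\sigma\in\mathcal E_{\rm ext}$), or $\mathcal M_\sigma$ has exactly two elements (then $\sigma\in\mathcal E_{\rm int}$). Let $x_\sigma$ be the barycentre of $\sigma$ and, for $\sigma\in\mathcal E_K$, let $n_{K,\sigma}$ be the unit normal to $\sigma$ outward to $K$. 3. $\mathcal P=(x_K)_{K\in\mathcal M}$ with $x_K\in K$, each $K$ is star-shaped with respect to $x_K$, and for $\sigma\in\mathcal E_K$ the distance $d_{K,\sigma}$ from $x_K$ to the hyperplane containing $\sigma$ is positive. Let $D_{K,\sigma}=\{(1-t)x_K+ty: t\in(0,1),\,y\in\sigma\}$. The size and the regularity of $\mathcal D$ are $$h_{\mathcal D}=\max_{K\in\mathcal M}h_K,\qquad \theta_{\mathcal D}=\max\Big(\max_{\sigma\in\mathcal E_{\rm int},\,K,L\in\mathcal M_\sigma}\frac{d_{K,\sigma}}{d_{L,\sigma}},\ \max_{K\in\mathcal M,\,\sigma\in\mathcal E_K}\frac{h_K}{d_{K,\sigma}}\Big).$$ **Discrete functions.** $X_{\mathcal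 D}$ is the space of families $v=((v_K)_{K\in\mathcal M},(v_\sigma)_{\sigma\in\mathcal E})$ of real numbers, and $X_{\mathcal D,0}$ is the set of those with $v_\sigma=0$ for all $\sigma\in\mathcal E_{\rm ext}$. For $v\in X_{\mathcal D}$ put $$|v|_X^2=\sum_{K\in\mathcal M}\sum_{\sigma\in\mathcal E_K}\frac{|\sigma|}{d_{K,\sigma}}(v_\sigma-v_K)^2,\qquad \Pi_{\mathcal M}v=v_K\ \text{on } K,$$ $$\nabla_Kv=\frac1{|K|}\sum_{\sigma\in\mathcal E_K}|\sigma|(v_\sigma-v_K)\,n_{K,\sigma},\qquad R_{K,\sigma}v=\frac{\sqrt d}{d_{K,\sigma}}\big(v_\sigma-v_K-\nabla_Kv\cdot(x_\sigma-x_K)\big),$$ $$\nabla_{\mathcal D}v=\nabla_Kv+R_{K,\sigma}v\;n_{K,\sigma}\quad\text{on } D_{K,\sigma}\qquad(K\in\mathcal M,\ \sigma\in\mathcal E_K).$$ **Lemma (weak discrete $H^1$ compactness).** Let $\mathcal F$ be a family of discretisations of $\Omega$ that contains discretisations of arbitrarily small size $h_{\mathcal D}$, and suppose that there is $\theta>0$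 with $\theta_{\mathcal D}\le\theta$ for all $\mathcal D\in\mathcal F$. Let $(u_{\mathcal D})_{\mathcal D\in\mathcal F}$ be such that - $u_{\mathcal D}\in X_{\mathcal D,0}$ for all $\mathcal D\in\mathcal F$; - there is $C>0$ with $|u_{\mathcal D}|_X\le C$ for all $\mathcal D\in\mathcal F$; - there is $u\in L^2(\Omega)$ with $\lim_{h_{\mathcal D}\to0}\|\Pi_{\mathcal M}u_{\mathcal D}-u\|_{L^2(\Omega)}=0$. Then $u\in H^1_0(\Omega)$, and $\nabla_{\mathcal D}u_{\mathcal D}$ converges weakly in $L^2(\Omega)^d$ to $\nabla u$ as $h_{\mathcal D}\to0$. -/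

import Mathlib

open MeasureTheory Filter Topology
open scoped ENNReal ContDiff

noncomputable section

namespace HybridFV

/-- The Euclidean space `ℝ^d`. -/
abbrev Space (d : ℕ) : Type := EuclideanSpace ℝ (Fin d)

variable {d : ℕ}

/-- The hyperplane with normal vector `ν` and equation `ν · x = c`. -/
def hyperplane (ν : Space d) (c : ℝ) : Set (Space d) := {x | inner ℝ ν x = c}

/-- The `(d-1)`-dimensional Lebesgue measure carried by the hyperplane `ν · x = c` (for a unit
vector `ν`): the image of the Lebesgue measure of the Euclidean space `ν^⊥` under `v ↦ c ν + v`.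
(The Hausdorff measure `μH[d-1]` of Mathlib is normalised differently when `d ≥ 3`.) -/
def hyperplaneMeasure (ν : Space d) (c : ℝ) : Measure (Space d) :=
  Measure.map (fun v : (Submodule.span ℝ {ν})ᗮ => c • ν + (v : Space d)) volume

/-- An open bounded connected polyhedral set: its boundary is contained in a finite union of
hyperplanes and it is the interior of its closure (so that it has no slits). Equivalently, it is
bounded and connected, and is the interior of a finite union of convex polytopes. -/
structure IsPolyhedralDomain (Ω : Set (Space d)) : Prop where
  isOpen : IsOpen Ω
  isBounded : Bornology.IsBounded Ω
  isConnected : IsConnected Ω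
  interior_closure : interior (closure Ω) = Ω
  boundary_subset : ∃ H : Finset (Space d × ℝ), (∀ h ∈ H, h.1 ≠ 0) ∧
    closure Ω \ Ω ⊆ ⋃ h ∈ H, hyperplane h.1 h.2

/-- A discretisation `(M, E, P)` of `Ω`. Control volumes are indexed by `Fin numCells`, edges by
`Fin numEdges`. -/
structure Discretisation (Ω : Set (Space d)) where
  /-- the number of control volumes -/
  numCells : ℕ
  /-- the number of edges -/
  numEdges : ℕ
  /-- the control volumes -/
  cell : Fin numCells → Set (Space d)
  cell_isOpen : ∀ K, IsOpen (cell K)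
  cell_isConnected : ∀ K, IsConnected (cell K)
  cell_subset : ∀ K, cell K ⊆ Ω
  cell_disjoint : ∀ K L, K ≠ L → Disjoint (cell K) (cell L)
  closure_eq : closure Ω = ⋃ K, closure (cell K)
  /-- the edges -/
  edge : Fin numEdges → Set (Space d)
  /-- a unit normal vector of the hyperplane that contains the edge (either of the two) -/
  edgeNormal : Fin numEdges → Space d
  /-- the hyperplane that contains the edge `σ` is `{x | edgeNormal σ · x = edgeOffset σ}` -/
  edgeOffset : Fin numEdges → ℝ
  norm_edgeNormal : ∀ σ, ‖edgeNormal σ‖ = 1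
  edge_nonempty : ∀ σ, (edge σ).Nonempty
  edge_subset : ∀ σ, edge σ ⊆ closure Ω
  edge_disjoint : ∀ σ τ, σ ≠ τ → Disjoint (edge σ) (edge τ)
  /-- every edge is a relatively open subset of its hyperplane -/
  edge_isOpen : ∀ σ, ∃ U : Set (Space d), IsOpen U ∧
    edge σ = U ∩ hyperplane (edgeNormal σ) (edgeOffset σ)
  edge_measure_pos :
    ∀ σ, 0 < hyperplaneMeasure (edgeNormal σ) (edgeOffset σ) (edge σ)
  /-- the relative boundary of an edge has zero `(d-1)`-dimensional measure -/
  edge_boundary_null :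
    ∀ σ, hyperplaneMeasure (edgeNormal σ) (edgeOffset σ) (closure (edge σ) \ edge σ) = 0
  /-- the set `E_K` of the edges of the control volume `K` -/
  cellEdges : Fin numCells → Finset (Fin numEdges)
  cell_boundary : ∀ K, closure (cell K) \ cell K = ⋃ σ ∈ cellEdges K, closure (edge σ)
  /-- an edge belongs to one control volume and lies in `∂Ω`, or it belongs to two -/
  edge_cells : ∀ σ,
    ((Finset.univ.filter fun K => σ ∈ cellEdges K).card = 1 ∧ edge σ ⊆ closure Ω \ Ω) ∨
      (Finset.univ.filter fun K => σ ∈ cellEdges K).card = 2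
  /-- the points `x_K` -/
  center : Fin numCells → Space d
  center_mem : ∀ K, center K ∈ cell K
  cell_starConvex : ∀ K, StarConvex ℝ (center K) (cell K)
  center_dist_pos : ∀ K, ∀ σ ∈ cellEdges K,
    0 < Metric.infDist (center K) (hyperplane (edgeNormal σ) (edgeOffset σ))

namespace Discretisation

variable {Ω : Set (Space d)} (D : Discretisation Ω)

/-- The set `M_σ` of the control volumes that have `σ` as an edge. -/
def edgeCells (σ : Fin D.numEdges) : Finset (Fin D.numCells) :=
  Finset.univ.filter fun K => σ ∈ D.cellEdges K

/-- `σ ∈ E_ext`. -/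
def IsExterior (σ : Fin D.numEdges) : Prop := (D.edgeCells σ).card = 1

/-- `σ ∈ E_int`. -/
def IsInterior (σ : Fin D.numEdges) : Prop := (D.edgeCells σ).card = 2

/-- The measure `|K|`. -/
def cellMeasure (K : Fin D.numCells) : ℝ := volume.real (D.cell K)

/-- The hyperplane that contains `σ`. -/
def edgeHyperplane (σ : Fin D.numEdges) : Set (Space d) :=
  hyperplane (D.edgeNormal σ) (D.edgeOffset σ)

/-- The `(d-1)`-dimensional Lebesgue measure on the hyperplane that contains `σ`. -/
def surfaceMeasure (σ : Fin D.numEdges) : Measure (Space d) :=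
  hyperplaneMeasure (D.edgeNormal σ) (D.edgeOffset σ)

/-- The `(d-1)`-dimensional measure `|σ|`. -/
def edgeMeasure (σ : Fin D.numEdges) : ℝ := (D.surfaceMeasure σ).real (D.edge σ)

/-- The barycentre `x_σ`. -/
def barycentre (σ : Fin D.numEdges) : Space d :=
  (D.edgeMeasure σ)⁻¹ • ∫ x in D.edge σ, x ∂(D.surfaceMeasure σ)

/-- The distance `d_{K,σ}` between `x_K` and the hyperplane that contains `σ`. -/
def centerDist (K : Fin D.numCells) (σ : Fin D.numEdges) : ℝ :=
  Metric.infDist (D.center K) (D.edgeHyperplane σ)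

/-- The unit normal `n_{K,σ}` to `σ` outward to `K`. As `K` is star-shaped with respect to `x_K`,
it is the unit normal that points away from `x_K` (see `normal_outward`). -/
def normal (K : Fin D.numCells) (σ : Fin D.numEdges) : Space d :=
  Real.sign (D.edgeOffset σ - inner ℝ (D.edgeNormal σ) (D.center K)) • D.edgeNormal σ

/-- The open cone `D_{K,σ}` with vertex `x_K` and basis `σ`. -/
def cone (K : Fin D.numCells) (σ : Fin D.numEdges) : Set (Space d) :=
  {x | ∃ t ∈ Set.Ioo (0 : ℝ) 1, ∃ y ∈ D.edge σ, x = (1 - t) • D.center K + t • y}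

/-- The size `h_D`. -/
def size : ℝ := ⨆ K, Metric.diam (D.cell K)

/-- The regularity `θ_D`: the maximum of the finite set of all quotients `d_{K,σ} / d_{L,σ}`
(`σ` an interior edge of `K` and `L`) and `h_K / d_{K,σ}` (`σ` an edge of `K`). -/
def regularity : ℝ :=
  sSup ({r | ∃ σ, D.IsInterior σ ∧ ∃ K ∈ D.edgeCells σ, ∃ L ∈ D.edgeCells σ,
      r = D.centerDist K σ / D.centerDist L σ} ∪
    {r | ∃ K, ∃ σ ∈ D.cellEdges K, r = Metric.diam (D.cell K) / D.centerDist K σ})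

/-- The space `X_D`: one real value for every control volume and one for every edge. -/
abbrev X : Type := (Fin D.numCells → ℝ) × (Fin D.numEdges → ℝ)

/-- The space `X_{D,0}`. -/
def X0 : Set D.X := {v | ∀ σ, D.IsExterior σ → v.2 σ = 0}

/-- The semi-norm `|v|_X`. -/
def seminormX (v : D.X) : ℝ :=
  Real.sqrt (∑ K, ∑ σ ∈ D.cellEdges K, D.edgeMeasure σ / D.centerDist K σ * (v.2 σ - v.1 K) ^ 2)

/-- The piecewise constant function `Π_M v`, equal to `v_K` on `K`. -/
def reconstruction (v : D.X) (x : Space d) : ℝ :=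
  ∑ K, (D.cell K).indicator (fun _ => v.1 K) x

/-- `∇_K v`. -/
def cellGradient (v : D.X) (K : Fin D.numCells) : Space d :=
  (D.cellMeasure K)⁻¹ •
    ∑ σ ∈ D.cellEdges K, (D.edgeMeasure σ * (v.2 σ - v.1 K)) • D.normal K σ

/-- `R_{K,σ} v`. -/
def residual (v : D.X) (K : Fin D.numCells) (σ : Fin D.numEdges) : ℝ :=
  Real.sqrt d / D.centerDist K σ *
    (v.2 σ - v.1 K - inner ℝ (D.cellGradient v K) (D.barycentre σ - D.center K))

/-- The stabilised gradient `∇_{K,σ} v`. -/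
def edgeGradient (v : D.X) (K : Fin D.numCells) (σ : Fin D.numEdges) : Space d :=
  D.cellGradient v K + D.residual v K σ • D.normal K σ

/-- The discrete gradient `∇_D v`, equal to `∇_{K,σ} v` on the cone `D_{K,σ}` (these cones are
pairwise disjoint and cover `Ω` up to a null set). -/
def discreteGradient (v : D.X) (x : Space d) : Space d :=
  ∑ K, ∑ σ ∈ D.cellEdges K, (D.cone K σ).indicator (fun _ => D.edgeGradient v K σ) x

theorem centerDist_eq (K : Fin D.numCells) (σ : Fin D.numEdges) :
    D.centerDist K σ = |D.edgeOffset σ - inner ℝ (D.edgeNormal σ) (D.center K)| := by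
  have hν := D.norm_edgeNormal σ
  set ν := D.edgeNormal σ with hνdef
  set c := D.edgeOffset σ with hc
  set a := D.center K with ha
  have hmem : a + (c - inner ℝ ν a) • ν ∈ D.edgeHyperplane σ := by
    change inner ℝ ν (a + (c - inner ℝ ν a) • ν) = c
    rw [inner_add_right, inner_smul_right, real_inner_self_eq_norm_sq, hν]
    ring
  apply le_antisymm
  · refine (Metric.infDist_le_dist_of_mem hmem).trans ?_
    rw [dist_self_add_right, norm_smul, hν, mul_one, Real.norm_eq_abs]
  · refine (Metric.le_infDist ⟨_, hmem⟩).2 ?_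
    intro y hy
    have hy' : inner ℝ ν y = c := hy
    rw [← hy', ← inner_sub_right]
    refine (abs_real_inner_le_norm _ _).trans ?_
    rw [hν, one_mul, ← dist_eq_norm, dist_comm]

theorem norm_normal {K : Fin D.numCells} {σ : Fin D.numEdges} (h : σ ∈ D.cellEdges K) :
    ‖D.normal K σ‖ = 1 := by
  have h0 : 0 < D.centerDist K σ := D.center_dist_pos K σ h
  rw [centerDist_eq] at h0
  rw [normal, norm_smul, D.norm_edgeNormal σ, mul_one]
  rcases lt_or_gt_of_ne (abs_pos.1 h0) with h1 | h1
  · rw [Real.sign_of_neg h1]; simp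
  · rw [Real.sign_of_pos h1]; simp

/-- The vector `n_{K,σ}` points from `x_K` to `σ`. -/
theorem inner_normal (K : Fin D.numCells) {σ : Fin D.numEdges} {x : Space d}
    (hx : x ∈ D.edgeHyperplane σ) :
    inner ℝ (D.normal K σ) (x - D.center K) = D.centerDist K σ := by
  have hx' : inner ℝ (D.edgeNormal σ) x = D.edgeOffset σ := hx
  rw [normal, real_inner_smul_left, inner_sub_right, hx', centerDist_eq]
  set r := D.edgeOffset σ - inner ℝ (D.edgeNormal σ) (D.center K)
  rcases lt_trichotomy r 0 with h | h | h
  · rw [Real.sign_of_neg h, abs_of_neg h]; ring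
  · rw [h]; simp
  · rw [Real.sign_of_pos h, abs_of_pos h]; ring

theorem mem_edgeHyperplane_iff {K : Fin D.numCells} {σ : Fin D.numEdges}
    (h : σ ∈ D.cellEdges K) (x : Space d) :
    x ∈ D.edgeHyperplane σ ↔
      inner ℝ (D.normal K σ) (x - D.center K) = D.centerDist K σ := by
  refine ⟨D.inner_normal K, fun hx => ?_⟩
  have h0 : 0 < D.centerDist K σ := D.center_dist_pos K σ h
  rw [centerDist_eq] at h0
  rw [normal, real_inner_smul_left, inner_sub_right, centerDist_eq] at hx
  change inner ℝ (D.edgeNormal σ) x = D.edgeOffset σ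
  rcases lt_or_gt_of_ne (abs_pos.1 h0) with h1 | h1
  · rw [Real.sign_of_neg h1, abs_of_neg h1] at hx; linarith
  · rw [Real.sign_of_pos h1, abs_of_pos h1] at hx; linarith

theorem edge_subset_boundary {K : Fin D.numCells} {σ : Fin D.numEdges}
    (h : σ ∈ D.cellEdges K) : D.edge σ ⊆ closure (D.cell K) \ D.cell K := by
  rw [D.cell_boundary K]
  exact fun x hx => Set.mem_biUnion h (subset_closure hx)

/-- The radial projection, from `x_K`, onto the hyperplane that contains `σ`. -/
def radial (K : Fin D.numCells) (σ : Fin D.numEdges) (y : Space d) : Space d :=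
  D.center K + (D.centerDist K σ / inner ℝ (D.normal K σ) (y - D.center K)) • (y - D.center K)

theorem radial_mem {K : Fin D.numCells} {σ : Fin D.numEdges} (h : σ ∈ D.cellEdges K)
    {y : Space d} (hy : inner ℝ (D.normal K σ) (y - D.center K) ≠ 0) :
    D.radial K σ y ∈ D.edgeHyperplane σ := by
  rw [D.mem_edgeHyperplane_iff h, radial, add_sub_cancel_left, inner_smul_right]
  field_simp

theorem radial_self {K : Fin D.numCells} {σ : Fin D.numEdges} (h : σ ∈ D.cellEdges K)
    {y : Space d} (hy : y ∈ D.edgeHyperplane σ) : D.radial K σ y = y := by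
  have h0 : 0 < D.centerDist K σ := D.center_dist_pos K σ h
  rw [radial, D.inner_normal K hy, div_self h0.ne', one_smul, add_sub_cancel]

theorem radial_continuousAt {K : Fin D.numCells} {σ : Fin D.numEdges}
    {y : Space d} (hy : inner ℝ (D.normal K σ) (y - D.center K) ≠ 0) :
    ContinuousAt (D.radial K σ) y := by
  unfold radial
  fun_prop (disch := exact hy)

/-- A point of the closure of `K` is not radially beyond an edge of `K`. -/
theorem not_beyond {K : Fin D.numCells} {σ : Fin D.numEdges} (h : σ ∈ D.cellEdges K)
    {w : Space d} (hw : w ∈ closure (D.cell K))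
    (h1 : D.centerDist K σ < inner ℝ (D.normal K σ) (w - D.center K)) :
    D.radial K σ w ∉ D.edge σ := by
  intro hmem
  have h0 : 0 < D.centerDist K σ := D.center_dist_pos K σ h
  obtain ⟨U, hU, hσ⟩ := D.edge_isOpen σ
  have hwU : D.radial K σ w ∈ U := by rw [hσ] at hmem; exact hmem.1
  have e1 : ∀ᶠ k in 𝓝 w, D.radial K σ k ∈ U :=
    (D.radial_continuousAt (h0.trans h1).ne').eventually (hU.mem_nhds hwU)
  have e2 : ∀ᶠ k in 𝓝 w, D.centerDist K σ < inner ℝ (D.normal K σ) (k - D.center K) := by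
    have : Continuous fun k : Space d => inner ℝ (D.normal K σ) (k - D.center K) := by fun_prop
    exact this.continuousAt.eventually (lt_mem_nhds h1)
  obtain ⟨k, hkK, hkU, hk⟩ :=
    ((mem_closure_iff_frequently.1 hw).and_eventually (e1.and e2)).exists
  have hkσ : D.radial K σ k ∈ D.edge σ := by
    rw [hσ]; exact ⟨hkU, D.radial_mem h (h0.trans hk).ne'⟩
  refine (D.edge_subset_boundary h hkσ).2 ?_
  have hpos := h0.trans hk
  have := (D.cell_starConvex K).add_smul_sub_mem hkK
    (t := D.centerDist K σ / inner ℝ (D.normal K σ) (k - D.center K))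
    (by positivity) ((div_le_one hpos).2 hk.le)
  exact this

/-- The vector `n_{K,σ}` is outward to `K`: near `σ`, the set `K` lies exactly on the side of `σ`
from which `n_{K,σ}` points away. -/
theorem normal_outward {K : Fin D.numCells} {σ : Fin D.numEdges} (h : σ ∈ D.cellEdges K)
    {x : Space d} (hx : x ∈ D.edge σ) :
    ∀ᶠ t in 𝓝[>] (0 : ℝ),
      x - t • D.normal K σ ∈ D.cell K ∧ x + t • D.normal K σ ∉ closure (D.cell K) := by
  have h0 : 0 < D.centerDist K σ := D.center_dist_pos K σ h
  obtain ⟨U, hU, hσ⟩ := D.edge_isOpen σ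
  have hxH : x ∈ D.edgeHyperplane σ := by rw [hσ] at hx; exact hx.2
  have hxU : x ∈ U := by rw [hσ] at hx; exact hx.1
  have hxn := D.inner_normal K hxH
  have hnn : inner ℝ (D.normal K σ) (D.normal K σ) = (1 : ℝ) := by
    rw [real_inner_self_eq_norm_sq, D.norm_normal h]; norm_num
  have hev : ∀ᶠ y in 𝓝 x, D.radial K σ y ∈ U := by
    refine (D.radial_continuousAt (by rw [hxn]; exact h0.ne')).eventually ?_
    rw [D.radial_self h hxH]
    exact hU.mem_nhds hxU
  have c1 : Tendsto (fun t : ℝ => x - t • D.normal K σ) (𝓝[>] 0) (𝓝 x) := by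
    have : Continuous fun t : ℝ => x - t • D.normal K σ := by fun_prop
    have := this.tendsto 0
    rw [zero_smul, sub_zero] at this
    exact this.mono_left nhdsWithin_le_nhds
  have c2 : Tendsto (fun t : ℝ => x + t • D.normal K σ) (𝓝[>] 0) (𝓝 x) := by
    have : Continuous fun t : ℝ => x + t • D.normal K σ := by fun_prop
    have := this.tendsto 0
    rw [zero_smul, add_zero] at this
    exact this.mono_left nhdsWithin_le_nhds
  have hsmall : ∀ᶠ t in 𝓝[>] (0 : ℝ), t < D.centerDist K σ :=
    nhdsWithin_le_nhds (gt_mem_nhds h0)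
  filter_upwards [c1.eventually hev, c2.eventually hev, hsmall, self_mem_nhdsWithin]
    with t ht1 ht2 ht3 ht0
  have ht0' : 0 < t := ht0
  constructor
  · by_contra hz
    set z := x - t • D.normal K σ with hzdef
    have hzn : inner ℝ (D.normal K σ) (z - D.center K) = D.centerDist K σ - t := by
      rw [hzdef, sub_right_comm, inner_sub_right, hxn, inner_smul_right, hnn, mul_one]
    obtain ⟨p, hpseg, hpfr⟩ :
        ∃ p ∈ segment ℝ (D.center K) z, p ∈ closure (D.cell K) \ D.cell K := by
      by_contra hno
      push Not at hno
      have hcover : segment ℝ (D.center K) z ⊆ D.cell K ∪ (closure (D.cell K))ᶜ := by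
        intro q hq
        by_cases hqK : q ∈ D.cell K
        · exact Or.inl hqK
        · exact Or.inr fun hqc => hno q hq ⟨hqc, hqK⟩
      obtain ⟨q, -, hq1, hq2⟩ := (convex_segment (D.center K) z).isPreconnected
        (D.cell K) (closure (D.cell K))ᶜ (D.cell_isOpen K) isClosed_closure.isOpen_compl hcover
        ⟨D.center K, left_mem_segment ℝ _ _, D.center_mem K⟩
        ⟨z, right_mem_segment ℝ _ _,
          (hcover (right_mem_segment ℝ _ _)).resolve_left hz⟩
      exact hq2 (subset_closure hq1)
    rw [D.cell_boundary K] at hpfr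
    obtain ⟨τ, hτ, hpτ⟩ := Set.mem_iUnion₂.1 hpfr
    rw [segment_eq_image'] at hpseg
    obtain ⟨s, ⟨hs0, hs1⟩, rfl⟩ := hpseg
    have hp0 : 0 < D.centerDist K τ := D.center_dist_pos K τ hτ
    obtain ⟨V, hV, hτV⟩ := D.edge_isOpen τ
    have hclH : closure (D.edge τ) ⊆ D.edgeHyperplane τ := by
      refine closure_minimal (by rw [hτV]; exact Set.inter_subset_right) ?_
      exact isClosed_eq (by fun_prop) continuous_const
    have hspos : 0 < s := by
      rcases hs0.lt_or_eq with h' | h'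
      · exact h'
      · have := D.inner_normal K (hclH hpτ)
        rw [← h'] at this
        simp at this
        exact absurd this hp0.ne
    have hdt : 0 < D.centerDist K σ - t := by linarith
    set p := D.center K + s • (z - D.center K) with hpdef
    have hpn : inner ℝ (D.normal K σ) (p - D.center K) = s * (D.centerDist K σ - t) := by
      rw [hpdef, add_sub_cancel_left, inner_smul_right, hzn]
    have hpn0 : 0 < inner ℝ (D.normal K σ) (p - D.center K) := by rw [hpn]; positivity
    have hpn1 : inner ℝ (D.normal K σ) (p - D.center K) < D.centerDist K σ := by
      rw [hpn]; nlinarith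
    have hradp : D.radial K σ p = D.radial K σ z := by
      rw [radial, radial, hpn, hzn, hpdef, add_sub_cancel_left, smul_smul]
      congr 2
      field_simp
    have e1 : ∀ᶠ y in 𝓝 p, D.radial K σ y ∈ U := by
      refine (D.radial_continuousAt hpn0.ne').eventually ?_
      rw [hradp]
      exact hU.mem_nhds ht1
    have hc : Continuous fun k : Space d => inner ℝ (D.normal K σ) (k - D.center K) := by
      fun_prop
    obtain ⟨y, hyτ, hyU, hy0, hy1⟩ :=
      ((mem_closure_iff_frequently.1 hpτ).and_eventually (e1.and
        ((hc.continuousAt.eventually (lt_mem_nhds hpn0)).and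
          (hc.continuousAt.eventually (gt_mem_nhds hpn1))))).exists
    have hyσ : D.radial K σ y ∈ D.edge σ := by
      rw [hσ]; exact ⟨hyU, D.radial_mem h hy0.ne'⟩
    have hyH : y ∈ D.edgeHyperplane τ := hclH (subset_closure hyτ)
    set r := D.centerDist K σ / inner ℝ (D.normal K σ) (y - D.center K) with hr
    have hr1 : 1 < r := (one_lt_div hy0).2 hy1
    have hrn : inner ℝ (D.normal K τ) (D.radial K σ y - D.center K)
        = r * D.centerDist K τ := by
      rw [radial, add_sub_cancel_left, inner_smul_right, D.inner_normal K hyH]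
    refine D.not_beyond hτ (D.edge_subset_boundary h hyσ).1 (by rw [hrn]; nlinarith) ?_
    have : D.radial K τ (D.radial K σ y) = y := by
      rw [radial, hrn, radial, add_sub_cancel_left, ← hr, smul_smul]
      have : D.centerDist K τ / (r * D.centerDist K τ) * r = 1 := by
        have : r ≠ 0 := by positivity
        field_simp
      rw [this, one_smul, add_sub_cancel]
    rw [this]
    exact hyτ
  · intro hcl
    have hyn : inner ℝ (D.normal K σ) (x + t • D.normal K σ - D.center K)
        = D.centerDist K σ + t := by
      rw [add_sub_right_comm, inner_add_right, hxn, inner_smul_right, hnn, mul_one]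
    refine D.not_beyond h hcl (by rw [hyn]; linarith) ?_
    rw [hσ]
    exact ⟨ht2, D.radial_mem h (by rw [hyn]; positivity)⟩

end Discretisation

/-- `φ ∈ C_c^∞(Ω)`. -/
def IsTestFunction (Ω : Set (Space d)) (φ : Space d → ℝ) : Prop :=
  ContDiff ℝ ∞ φ ∧ HasCompactSupport φ ∧ tsupport φ ⊆ Ω

/-- `f ∈ L²(Ω)`, for a function with values in `ℝ` or in `ℝ^d`. -/
def MemL2 {F : Type*} [NormedAddCommGroup F] (Ω : Set (Space d)) (f : Space d → F) : Prop :=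
  MemLp f 2 (volume.restrict Ω)

/-- The norm of `L²(Ω)`, with values in `[0,∞]`. -/
def normL2 {F : Type*} [NormedAddCommGroup F] (Ω : Set (Space d)) (f : Space d → F) : ℝ≥0∞ :=
  eLpNorm f 2 (volume.restrict Ω)

/-- `u ∈ H¹(Ω)`, with weak gradient `∇u = G`. -/
def HasWeakGradient (Ω : Set (Space d)) (u : Space d → ℝ) (G : Space d → Space d) : Prop :=
  MemL2 Ω u ∧ MemL2 Ω G ∧ ∀ φ, IsTestFunction Ω φ →
    ∫ x in Ω, u x • gradient φ x = - ∫ x in Ω, φ x • G x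

/-- `u ∈ H¹_0(Ω)`, the closure of `C_c^∞(Ω)` in `H¹(Ω)`. -/
def MemH10 (Ω : Set (Space d)) (u : Space d → ℝ) : Prop :=
  ∃ G, HasWeakGradient Ω u G ∧ ∃ φ : ℕ → Space d → ℝ, (∀ n, IsTestFunction Ω (φ n)) ∧
    Tendsto (fun n => normL2 Ω fun x => φ n x - u x) atTop (𝓝 0) ∧
    Tendsto (fun n => normL2 Ω fun x => gradient (φ n) x - G x) atTop (𝓝 0)

/-- The family `F` of elements of `L²(Ω)^d` converges weakly in `L²(Ω)^d` to `G` along `l`. -/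
def WeaklyTendstoL2 {ι : Type*} (Ω : Set (Space d)) (F : ι → Space d → Space d) (l : Filter ι)
    (G : Space d → Space d) : Prop :=
  (∀ i, MemL2 Ω (F i)) ∧ MemL2 Ω G ∧ ∀ g : Space d → Space d, MemL2 Ω g →
    Tendsto (fun i => ∫ x in Ω, inner ℝ (F i x) (g x)) l (𝓝 (∫ x in Ω, inner ℝ (G x) (g x)))

/-- The filter on the index set of a family of discretisations that expresses `h_D → 0`: a
property holds eventually iff, for some `δ > 0`, it holds for all members with `h_D < δ`. -/
def sizeToZero {ι : Type*} {Ω : Set (Space d)} (D : ι → Discretisation Ω) : Filter ι :=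
  comap (fun i => (D i).size) (𝓝 0)

end HybridFV

end

noncomputable section

namespace HybridFV

/-! ### Slicing by parallel hyperplanes -/

section Slicing

variable {E : Type*} [NormedAddCommGroup E] [InnerProductSpace ℝ E] [MeasurableSpace E]
  [BorelSpace E] [FiniteDimensional ℝ E]

/-- Decomposition of the Lebesgue measure along a unit vector and its orthogonal complement. -/
theorem measurePreserving_smul_add {ν : E} (hν : ‖ν‖ = 1) :
    MeasurePreserving (fun p : ℝ × (Submodule.span ℝ {ν})ᗮ => p.1 • ν + (p.2 : E)) := by
  have h1 := (LinearIsometryEquiv.toSpanUnitSingleton (𝕜 := ℝ) ν hν).measurePreserving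
  have h2 := h1.prod (MeasurePreserving.id (volume : Measure (Submodule.span ℝ {ν})ᗮ))
  have h3 := WithLp.volume_preserving_toLp (Submodule.span ℝ {ν}) (Submodule.span ℝ {ν})ᗮ
  have h4 := ((Submodule.span ℝ {ν}).orthogonalDecomposition.symm).measurePreserving
  have h5 := h4.comp (h3.comp h2)
  rw [← Measure.volume_eq_prod] at h5
  convert h5 using 1
  ext p
  simp

theorem measurableEmbedding_smul_add {ν : E} (hν : ‖ν‖ = 1) :
    MeasurableEmbedding (fun p : ℝ × (Submodule.span ℝ {ν})ᗮ => p.1 • ν + (p.2 : E)) := by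
  apply Continuous.measurableEmbedding (by fun_prop)
  rintro ⟨s, v⟩ ⟨t, w⟩ h
  have hv : ∀ v : (Submodule.span ℝ {ν})ᗮ, inner ℝ ν (v : E) = 0 := fun v =>
    Submodule.mem_orthogonal_singleton_iff_inner_right.1 v.2
  have hst := congrArg (fun x => inner ℝ ν x) h
  simp only [inner_add_right, hv, inner_smul_right, real_inner_self_eq_norm_sq, hν] at hst
  have hst' : s = t := by linarith
  subst hst'
  simpa using h

omit [MeasurableSpace E] [BorelSpace E] in
theorem finrank_orthogonal_span_unit {ν : E} (hν : ‖ν‖ = 1) :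
    Module.finrank ℝ (Submodule.span ℝ {ν})ᗮ = Module.finrank ℝ E - 1 := by
  have h := (Submodule.span ℝ {ν}).finrank_add_finrank_orthogonal
  have hν0 : ν ≠ 0 := by rintro rfl; simp at hν
  rw [finrank_span_singleton hν0] at h
  omega

end Slicing

section HyperplaneMeasure

variable {d : ℕ}

theorem measurableEmbedding_offset_add (ν : Space d) (c : ℝ) :
    MeasurableEmbedding (fun v : (Submodule.span ℝ {ν})ᗮ => c • ν + (v : Space d)) :=
  Continuous.measurableEmbedding (by fun_prop) fun v w h => by simpa using h

/-- Integration over `ℝ^d` along the homothetic images, with centre `a`, of a hyperplane. -/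
theorem integral_eq_integral_homothety {G : Type*} [NormedAddCommGroup G] [NormedSpace ℝ G]
    {ν a : Space d} {c : ℝ} (hν : ‖ν‖ = 1) (hc : inner ℝ ν a ≠ c) {F : Space d → G}
    (hF : Integrable F) :
    ∫ x, F x = |c - inner ℝ ν a| • ∫ t : ℝ, |t| ^ (d - 1) •
      ∫ y, F ((1 - t) • a + t • y) ∂(hyperplaneMeasure ν c) := by
  set α : ℝ := inner ℝ ν a with hα
  set V := (Submodule.span ℝ {ν})ᗮ with hV
  have hrank : Module.finrank ℝ V = d - 1 := by
    rw [hV, finrank_orthogonal_span_unit hν]; simp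
  have hp : a - α • ν ∈ V := by
    rw [hV, Submodule.mem_orthogonal_singleton_iff_inner_right, inner_sub_right, inner_smul_right,
      real_inner_self_eq_norm_sq, hν]
    simp [hα]
  have hm := measurePreserving_smul_add hν
  have he := measurableEmbedding_smul_add hν
  have hFi : Integrable (fun p : ℝ × V => F (p.1 • ν + (p.2 : Space d))) := 
    (hm.integrable_comp_emb he).2 hF
  have h1 : ∫ x, F x = ∫ s : ℝ, ∫ v : V, F (s • ν + (v : Space d)) := by
    rw [← hm.integral_comp he]
    exact integral_prod _ hFi
  set H : ℝ → G := fun s => ∫ v : V, F (s • ν + (v : Space d)) with hH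
  have h2 : ∀ t : ℝ, t ≠ 0 → |t| ^ (d - 1) •
      ∫ y, F ((1 - t) • a + t • y) ∂(hyperplaneMeasure ν c) = H (α + (c - α) * t) := by
    intro t ht
    rw [hyperplaneMeasure, (measurableEmbedding_offset_add ν c).integral_map]
    have e1 : ∀ v : V, (1 - t) • a + t • (c • ν + (v : Space d)) =
        (α + (c - α) * t) • ν + ((t • v + (1 - t) • ⟨a - α • ν, hp⟩ : V) : Space d) := by
      intro v
      simp only [Submodule.coe_add, Submodule.coe_smul]
      module
    simp_rw [e1]
    rw [Measure.integral_comp_smul volume (fun v : V => F ((α + (c - α) * t) • ν +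
      ((v + (1 - t) • ⟨a - α • ν, hp⟩ : V) : Space d))) t]
    rw [integral_add_right_eq_self (fun v : V => F ((α + (c - α) * t) • ν + (v : Space d))),
      hrank, smul_smul]
    have : |t| ^ (d - 1) * |(t ^ (d - 1))⁻¹| = 1 := by
      rw [abs_inv, abs_pow]
      exact mul_inv_cancel₀ (by positivity)
    rw [this, one_smul]
  have h3 : (∫ t : ℝ, |t| ^ (d - 1) •
      ∫ y, F ((1 - t) • a + t • y) ∂(hyperplaneMeasure ν c)) = ∫ t : ℝ, H (α + (c - α) * t) := by
    apply integral_congr_ae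
    filter_upwards [Measure.ae_ne volume (0 : ℝ)] with t ht using h2 t ht
  rw [h1, h3, Measure.integral_comp_mul_left (fun t => H (α + t)) (c - α),
    integral_add_left_eq_self H, smul_smul, abs_inv, mul_inv_cancel₀, one_smul]
  exact abs_ne_zero.2 (sub_ne_zero.2 hc.symm)

/-- The open cone with vertex `a` and basis `A`. -/
def openCone (a : Space d) (A : Set (Space d)) : Set (Space d) :=
  {x | ∃ t ∈ Set.Ioo (0 : ℝ) 1, ∃ y ∈ A, x = (1 - t) • a + t • y}

theorem openCone_eq {ν a : Space d} {c : ℝ} (hc : inner ℝ ν a ≠ c) {A : Set (Space d)}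
    (hA : A ⊆ hyperplane ν c) :
    openCone a A = {x | (inner ℝ ν (x - a) / (c - inner ℝ ν a)) ∈ Set.Ioo (0 : ℝ) 1 ∧
      a + (inner ℝ ν (x - a) / (c - inner ℝ ν a))⁻¹ • (x - a) ∈ A} := by
  have hc' : c - inner ℝ ν a ≠ 0 := sub_ne_zero.2 hc.symm
  ext x
  constructor
  · rintro ⟨t, ht, y, hy, rfl⟩
    have hyc : inner ℝ ν y = c := hA hy
    have e : inner ℝ ν ((1 - t) • a + t • y - a) / (c - inner ℝ ν a) = t := by
      rw [show (1 - t) • a + t • y - a = t • (y - a) by module, inner_smul_right, inner_sub_right,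
        hyc, mul_div_assoc, div_self hc', mul_one]
    simp only [Set.mem_ofPred_eq, e]
    refine ⟨ht, ?_⟩
    rw [show (1 - t) • a + t • y - a = t • (y - a) by module, smul_smul,
      inv_mul_cancel₀ ht.1.ne', one_smul, add_sub_cancel]
    exact hy
  · rintro ⟨ht, hy⟩
    refine ⟨_, ht, _, hy, ?_⟩
    rw [smul_add, smul_smul, mul_inv_cancel₀ ht.1.ne']
    module

theorem mem_openCone_iff {ν a : Space d} {c : ℝ} (hc : inner ℝ ν a ≠ c) {A : Set (Space d)}
    (hA : A ⊆ hyperplane ν c) {t : ℝ} {y : Space d} (hy : y ∈ hyperplane ν c) :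
    (1 - t) • a + t • y ∈ openCone a A ↔ t ∈ Set.Ioo (0 : ℝ) 1 ∧ y ∈ A := by
  have hc' : c - inner ℝ ν a ≠ 0 := sub_ne_zero.2 hc.symm
  have hyc : inner ℝ ν y = c := hy
  have e : inner ℝ ν ((1 - t) • a + t • y - a) / (c - inner ℝ ν a) = t := by
    rw [show (1 - t) • a + t • y - a = t • (y - a) by module, inner_smul_right, inner_sub_right,
      hyc, mul_div_assoc, div_self hc', mul_one]
  rw [openCone_eq hc hA]
  simp only [Set.mem_ofPred_eq, e]
  refine and_congr_right fun ht => ?_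
  rw [show (1 - t) • a + t • y - a = t • (y - a) by module, smul_smul,
    inv_mul_cancel₀ ht.1.ne', one_smul, add_sub_cancel]

theorem measurableSet_hyperplane (ν : Space d) (c : ℝ) : MeasurableSet (hyperplane ν c) :=
  (isClosed_eq (by fun_prop) continuous_const).measurableSet

theorem measurableSet_openCone {ν a : Space d} {c : ℝ} (hc : inner ℝ ν a ≠ c) {A : Set (Space d)}
    (hA : A ⊆ hyperplane ν c) (hAm : MeasurableSet A) : MeasurableSet (openCone a A) := by
  rw [openCone_eq hc hA]
  have h1 : Measurable fun x : Space d => inner ℝ ν (x - a) / (c - inner ℝ ν a) := by fun_prop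
  have h2 : Measurable fun x : Space d =>
      a + (inner ℝ ν (x - a) / (c - inner ℝ ν a))⁻¹ • (x - a) := by fun_prop
  exact (h1 measurableSet_Ioo).inter (h2 hAm)

theorem isBounded_openCone {a : Space d} {A : Set (Space d)} (hA : Bornology.IsBounded A) :
    Bornology.IsBounded (openCone a A) := by
  obtain ⟨R, hR⟩ := hA.subset_ball a
  refine (Metric.isBounded_ball (x := a) (r := R)).subset ?_
  rintro _ ⟨t, ht, y, hy, rfl⟩
  have := hR hy
  rw [Metric.mem_ball, dist_eq_norm] at this ⊢
  rw [show (1 - t) • a + t • y - a = t • (y - a) by module, norm_smul, Real.norm_eq_abs,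
    abs_of_pos ht.1]
  nlinarith [norm_nonneg (y - a), ht.1, ht.2]

theorem ae_mem_hyperplane {ν : Space d} (hν : ‖ν‖ = 1) (c : ℝ) :
    ∀ᵐ y ∂(hyperplaneMeasure ν c), y ∈ hyperplane ν c := by
  rw [hyperplaneMeasure, (measurableEmbedding_offset_add ν c).ae_map_iff]
  filter_upwards with v
  have : inner ℝ ν (v : Space d) = 0 :=
    Submodule.mem_orthogonal_singleton_iff_inner_right.1 v.2
  simp [hyperplane, inner_add_right, inner_smul_right, this, hν]

theorem hyperplaneMeasure_lt_top (ν : Space d) (c : ℝ) {A : Set (Space d)}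
    (hA : Bornology.IsBounded A) : hyperplaneMeasure ν c A < ⊤ := by
  rw [hyperplaneMeasure, (measurableEmbedding_offset_add ν c).map_apply]
  have hanti : AntilipschitzWith 1 fun v : (Submodule.span ℝ {ν})ᗮ => c • ν + (v : Space d) :=
    AntilipschitzWith.of_le_mul_dist fun v w => by simp [Subtype.dist_eq]
  exact (hanti.isBounded_preimage hA).measure_lt_top

theorem volume_hyperplane {ν : Space d} (hν : ν ≠ 0) (c : ℝ) : volume (hyperplane ν c) = 0 := by
  have hn : ‖ν‖ ≠ 0 := norm_ne_zero_iff.2 hν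
  set ν' := ‖ν‖⁻¹ • ν with hν'
  have h1 : ‖ν'‖ = 1 := by rw [hν', norm_smul]; simp [hn]
  have hm := measurePreserving_smul_add h1
  have he := measurableEmbedding_smul_add h1
  rw [← hm.measure_preimage_emb he, Measure.volume_eq_prod]
  refine measure_mono_null (t := {c / ‖ν‖} ×ˢ Set.univ) ?_ ?_
  · rintro ⟨s, v⟩ hsv
    have hv : inner ℝ ν (v : Space d) = 0 := by
      have h0 : inner ℝ ν' (v : Space d) = 0 :=
        Submodule.mem_orthogonal_singleton_iff_inner_right.1 v.2
      have h2 : inner ℝ ν' (v : Space d) = ‖ν‖⁻¹ * inner ℝ ν (v : Space d) :=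
        real_inner_smul_left _ _ _
      exact (mul_eq_zero.1 (h2.symm.trans h0)).resolve_left (inv_ne_zero hn)
    have hsv' : inner ℝ ν (s • ν' + (v : Space d)) = c := hsv
    rw [inner_add_right, hv, hν', inner_smul_right, inner_smul_right,
      real_inner_self_eq_norm_sq] at hsv'
    simp only [Set.mem_prod, Set.mem_singleton_iff, Set.mem_univ, and_true]
    field_simp at hsv' ⊢
    linarith
  · rw [Measure.prod_prod]; simp

/-- Integration over a cone whose basis is contained in a hyperplane. -/
theorem setIntegral_openCone {G : Type*} [NormedAddCommGroup G] [NormedSpace ℝ G]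
    {ν a : Space d} {c : ℝ} (hν : ‖ν‖ = 1) (hc : inner ℝ ν a ≠ c) {A : Set (Space d)}
    (hA : A ⊆ hyperplane ν c) (hAm : MeasurableSet A) {F : Space d → G}
    (hF : IntegrableOn F (openCone a A)) :
    ∫ x in openCone a A, F x = |c - inner ℝ ν a| • ∫ t in (0 : ℝ)..1, t ^ (d - 1) •
      ∫ y in A, F ((1 - t) • a + t • y) ∂(hyperplaneMeasure ν c) := by
  have hm := measurableSet_openCone hc hA hAm
  rw [← integral_indicator hm, integral_eq_integral_homothety hν hc (hF.integrable_indicator hm)]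
  congr 1
  rw [intervalIntegral.integral_of_le zero_le_one, integral_Ioc_eq_integral_Ioo,
    ← integral_indicator measurableSet_Ioo]
  congr 1
  ext t
  by_cases ht : t ∈ Set.Ioo (0 : ℝ) 1
  · rw [Set.indicator_of_mem ht, abs_of_pos ht.1]
    congr 1
    rw [← integral_indicator hAm]
    apply integral_congr_ae
    filter_upwards [ae_mem_hyperplane hν c] with y hy
    by_cases hyA : y ∈ A
    · rw [Set.indicator_of_mem hyA, Set.indicator_of_mem ((mem_openCone_iff hc hA hy).2 ⟨ht, hyA⟩)]
    · rw [Set.indicator_of_notMem hyA,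
        Set.indicator_of_notMem fun h => hyA ((mem_openCone_iff hc hA hy).1 h).2]
  · rw [Set.indicator_of_notMem ht]
    have : ∫ y, (openCone a A).indicator F ((1 - t) • a + t • y) ∂(hyperplaneMeasure ν c) =
        ∫ y, (0 : G) ∂(hyperplaneMeasure ν c) := by
      apply integral_congr_ae
      filter_upwards [ae_mem_hyperplane hν c] with y hy
      exact Set.indicator_of_notMem (fun h => ht ((mem_openCone_iff hc hA hy).1 h).1) _
    rw [this, integral_zero, smul_zero]

theorem volume_real_openCone (hd : 0 < d) {ν a : Space d} {c : ℝ} (hν : ‖ν‖ = 1)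
    (hc : inner ℝ ν a ≠ c) {A : Set (Space d)} (hA : A ⊆ hyperplane ν c) (hAm : MeasurableSet A)
    (hAb : Bornology.IsBounded A) :
    volume.real (openCone a A) = |c - inner ℝ ν a| * (hyperplaneMeasure ν c).real A / d := by
  have hfin : volume (openCone a A) ≠ ⊤ := (isBounded_openCone hAb).measure_lt_top.ne
  have h := setIntegral_openCone (F := fun _ => (1 : ℝ)) hν hc hA hAm
    (integrableOn_const hfin)
  simp only [integral_const, smul_eq_mul, mul_one, intervalIntegral.integral_mul_const,
    integral_pow, Measure.real, Measure.restrict_apply_univ] at h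
  rw [Measure.real, h, Measure.real]
  obtain ⟨k, rfl⟩ : ∃ k, d = k + 1 := ⟨d - 1, by omega⟩
  simp
  ring

theorem setIntegral_sub_openCone (hd : 0 < d) {ν a : Space d} {c : ℝ} (hν : ‖ν‖ = 1)
    (hc : inner ℝ ν a ≠ c) {A : Set (Space d)} (hA : A ⊆ hyperplane ν c) (hAm : MeasurableSet A)
    (hAb : Bornology.IsBounded A) :
    ∫ x in openCone a A, (x - a) =
      (|c - inner ℝ ν a| / (d + 1)) • ∫ y in A, (y - a) ∂(hyperplaneMeasure ν c) := by
  have hint : IntegrableOn (fun x : Space d => x - a) (openCone a A) :=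
    ((by fun_prop : Continuous fun x : Space d => x - a).continuousOn.integrableOn_compact
      (isBounded_openCone hAb).isCompact_closure).mono_set subset_closure
  have h := setIntegral_openCone hν hc hA hAm hint
  rw [h]
  have e : ∀ (t : ℝ) (y : Space d), (1 - t) • a + t • y - a = t • (y - a) := fun t y => by module
  simp only [e, integral_smul, smul_smul]
  rw [intervalIntegral.integral_smul_const, smul_smul]
  congr 1
  obtain ⟨k, rfl⟩ : ∃ k, d = k + 1 := ⟨d - 1, by omega⟩
  simp only [add_tsub_cancel_right, ← pow_succ, integral_pow]
  push_cast
  simp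
  ring

end HyperplaneMeasure

/-! ### Continuous selections of Lipschitz functions -/

theorem lipschitzWith_of_continuous_selection {E ι : Type*} [NormedAddCommGroup E]
    [NormedSpace ℝ E] {g : E → ℝ} (hg : Continuous g) (P : Finset ι) {p : ι → E → ℝ} {L : NNReal}
    (hp : ∀ i ∈ P, LipschitzWith L (p i)) (hsel : ∀ x, ∃ i ∈ P, g x = p i x) :
    LipschitzWith L g := by
  apply LipschitzWith.of_le_add_mul
  intro y x
  set f : ℝ → ℝ := fun s => g (x + s • (y - x)) with hf
  have hfc : Continuous f := by fun_prop
  have key : ∀ s ∈ Set.Icc (0 : ℝ) 1, f s ≤ f 0 + L * dist y x * s := by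
    apply image_le_of_liminf_slope_right_le_deriv_boundary (B' := fun _ => L * dist y x)
      hfc.continuousOn (by simp) (by fun_prop)
    · intro s _
      simpa using (((hasDerivAt_id s).const_mul (L * dist y x : ℝ)).const_add
        (f 0)).hasDerivWithinAt
    · intro s _ r hr
      obtain ⟨i, hi, hfreq⟩ : ∃ i ∈ P, ∃ᶠ z in 𝓝[>] s, f z = p i (x + z • (y - x)) := by
        by_contra hno
        push Not at hno
        have : ∀ᶠ z in 𝓝[>] s, ∀ i ∈ P, f z ≠ p i (x + z • (y - x)) :=
          (eventually_all_finset P).2 hno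
        obtain ⟨z, hz⟩ := this.exists
        obtain ⟨i, hi, hiz⟩ := hsel (x + z • (y - x))
        exact hz i hi hiz
      have hpc : Continuous fun z : ℝ => p i (x + z • (y - x)) :=
        (hp i hi).continuous.comp (by fun_prop)
      have hs : f s = p i (x + s • (y - x)) :=
        (isClosed_eq hfc hpc).mem_of_frequently_of_tendsto hfreq
          (tendsto_id.mono_right nhdsWithin_le_nhds)
      refine (hfreq.and_eventually self_mem_nhdsWithin).mono ?_
      rintro z ⟨hz, hzs⟩
      have hzs' : 0 < z - s := sub_pos.2 hzs
      refine lt_of_le_of_lt ?_ hr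
      rw [slope_def_field, div_le_iff₀ hzs', hz, hs]
      have h1 := (hp i hi).dist_le_mul (x + z • (y - x)) (x + s • (y - x))
      have h2 : dist (x + z • (y - x)) (x + s • (y - x)) = (z - s) * dist y x := by
        rw [dist_eq_norm, show x + z • (y - x) - (x + s • (y - x)) = (z - s) • (y - x) by module,
          norm_smul, Real.norm_eq_abs, abs_of_pos hzs', dist_eq_norm]
      rw [h2, Real.dist_eq] at h1
      calc _ ≤ _ := le_abs_self _
        _ ≤ _ := h1
        _ = _ := by ring
  have := key 1 (by simp)
  simpa [hf] using this

/-! ### The gauge of a radially open star-shaped set -/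

section Gauge

variable {E : Type*} [NormedAddCommGroup E] [NormedSpace ℝ E]

/-- The gauge of `S` with respect to the point `a`. -/
def gaugeAt (S : Set E) (a x : E) : ℝ := sInf {r : ℝ | 0 < r ∧ a + r⁻¹ • (x - a) ∈ S}

variable {S : Set E} {a : E}

theorem gaugeAt_nonneg (S : Set E) (a x : E) : 0 ≤ gaugeAt S a x :=
  Real.sInf_nonneg fun _ h => h.1.le

theorem gaugeAt_set_nonempty (ho : IsOpen S) (ha : a ∈ S) (x : E) :
    {r : ℝ | 0 < r ∧ a + r⁻¹ • (x - a) ∈ S}.Nonempty := by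
  have h1 : Tendsto (fun r : ℝ => a + r⁻¹ • (x - a)) atTop (𝓝 a) := by
    have := (tendsto_inv_atTop_zero (𝕜 := ℝ)).smul_const (x - a)
    simpa using this.const_add a
  obtain ⟨r, hr1, hr2⟩ := ((h1.eventually (ho.mem_nhds ha)).and (eventually_gt_atTop 0)).exists
  exact ⟨r, hr2, hr1⟩

theorem gaugeAt_lt_iff (ho : IsOpen S) (ha : a ∈ S) (hs : StarConvex ℝ a S) {x : E} {r : ℝ}
    (hr : 0 < r) : gaugeAt S a x < r ↔ a + r⁻¹ • (x - a) ∈ S := by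
  constructor
  · intro h
    obtain ⟨r', ⟨hr', hm⟩, hlt⟩ := exists_lt_of_csInf_lt (gaugeAt_set_nonempty ho ha x) h
    have := hs.add_smul_sub_mem hm (t := r⁻¹ * r') (by positivity) (by
      rw [inv_mul_le_iff₀ hr, mul_one]; exact hlt.le)
    rwa [add_sub_cancel_left, smul_smul, mul_assoc, mul_inv_cancel₀ hr'.ne', mul_one] at this
  · intro h
    have hc : ContinuousAt (fun r : ℝ => a + r⁻¹ • (x - a)) r := by
      fun_prop (disch := exact hr.ne')
    have h1 : ∀ᶠ s in 𝓝[<] r, a + s⁻¹ • (x - a) ∈ S :=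
      nhdsWithin_le_nhds (hc.eventually (ho.mem_nhds h))
    have h2 : ∀ᶠ s in 𝓝[<] r, 0 < s := nhdsWithin_le_nhds (lt_mem_nhds hr)
    obtain ⟨s, hs1, hs2, hs3⟩ := (h1.and (h2.and self_mem_nhdsWithin)).exists
    exact lt_of_le_of_lt (csInf_le ⟨0, fun _ h => h.1.le⟩ ⟨hs2, hs1⟩) hs3

theorem gaugeAt_lt_one_iff (ho : IsOpen S) (ha : a ∈ S) (hs : StarConvex ℝ a S) {x : E} :
    gaugeAt S a x < 1 ↔ x ∈ S := by
  rw [gaugeAt_lt_iff ho ha hs one_pos]; simp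

theorem gaugeAt_self (ha : a ∈ S) : gaugeAt S a a = 0 := by
  refine le_antisymm (le_of_forall_pos_le_add fun ε hε => ?_) (gaugeAt_nonneg _ _ _)
  exact csInf_le ⟨0, fun _ h => h.1.le⟩ ⟨by simpa using hε, by simpa using ha⟩

theorem gaugeAt_pos (ho : IsOpen S) (ha : a ∈ S) (hs : StarConvex ℝ a S)
    (hb : Bornology.IsBounded S) {x : E} (hx : x ≠ a) : 0 < gaugeAt S a x := by
  obtain ⟨R, hR⟩ := hb.subset_ball a
  have hR0 : 0 < R := Metric.pos_of_mem_ball (hR ha)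
  have hxa : 0 < ‖x - a‖ := norm_pos_iff.2 (sub_ne_zero.2 hx)
  refine lt_of_lt_of_le (div_pos hxa hR0) (not_lt.1 fun h => ?_)
  have := hR ((gaugeAt_lt_iff ho ha hs (div_pos hxa hR0)).1 h)
  rw [Metric.mem_ball, dist_self_add_left, norm_smul, Real.norm_eq_abs, abs_of_pos (by positivity),
    inv_div, div_mul_cancel₀ _ hxa.ne'] at this
  exact lt_irrefl _ this

theorem gaugeAt_eq (ho : IsOpen S) (ha : a ∈ S) (hs : StarConvex ℝ a S)
    (hcl : ∀ p ∈ closure S, ∀ t ∈ Set.Ico (0 : ℝ) 1, a + t • (p - a) ∈ S)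
    {y : E} (hy : y ∈ closure S \ S) {t : ℝ} (ht : 0 < t) : gaugeAt S a (a + t • (y - a)) = t := by
  apply le_antisymm
  · refine le_of_forall_gt_imp_ge_of_dense fun r hr => ?_
    have hr0 := ht.trans hr
    refine ((gaugeAt_lt_iff ho ha hs hr0).2 ?_).le
    rw [add_sub_cancel_left, smul_smul]
    exact hcl y hy.1 _ ⟨by positivity, by rw [inv_mul_lt_iff₀ hr0, mul_one]; exact hr⟩
  · refine not_lt.1 fun h => hy.2 ?_
    have := (gaugeAt_lt_iff ho ha hs ht).1 h
    rwa [add_sub_cancel_left, smul_smul, inv_mul_cancel₀ ht.ne', one_smul, add_sub_cancel] at this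

theorem gaugeAt_proj_mem (ho : IsOpen S) (ha : a ∈ S) (hs : StarConvex ℝ a S)
    (hb : Bornology.IsBounded S) {x : E} (hx : x ≠ a) :
    a + (gaugeAt S a x)⁻¹ • (x - a) ∈ closure S \ S := by
  have h0 := gaugeAt_pos ho ha hs hb hx
  refine ⟨?_, fun h => lt_irrefl _ ((gaugeAt_lt_iff ho ha hs h0).2 h)⟩
  have hc : ContinuousAt (fun r : ℝ => a + r⁻¹ • (x - a)) (gaugeAt S a x) := by
    fun_prop (disch := exact h0.ne')
  refine mem_closure_of_tendsto (hc.tendsto.mono_left nhdsWithin_le_nhds :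
    Tendsto _ (𝓝[>] (gaugeAt S a x)) _) ?_
  filter_upwards [self_mem_nhdsWithin] with r hr
  exact (gaugeAt_lt_iff ho ha hs (h0.trans hr)).1 hr

theorem continuous_gaugeAt (ho : IsOpen S) (ha : a ∈ S) (hs : StarConvex ℝ a S)
    (hb : Bornology.IsBounded S)
    (hcl : ∀ p ∈ closure S, ∀ t ∈ Set.Ico (0 : ℝ) 1, a + t • (p - a) ∈ S) :
    Continuous (gaugeAt S a) := by
  refine OrderTopology.continuous_iff.2 fun r => ⟨?_, ?_⟩
  · rcases lt_trichotomy r 0 with hr | hr | hr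
    · convert isOpen_univ
      exact Set.eq_univ_of_forall fun x => hr.trans_le (gaugeAt_nonneg S a x)
    · convert (isOpen_compl_singleton (x := a)) using 1
      ext x
      rcases eq_or_ne x a with rfl | hx
      · simp [gaugeAt_self ha, hr]
      · simp [hx, hr, gaugeAt_pos ho ha hs hb hx]
    · have hc : Continuous fun x : E => a + r⁻¹ • (x - a) := by fun_prop
      convert (isClosed_closure (s := S)).isOpen_compl.preimage hc using 1
      ext x
      simp only [Set.mem_preimage, Set.mem_Ioi, Set.mem_compl_iff]
      constructor
      · intro h hmem
        refine not_le.2 h (le_of_forall_gt_imp_ge_of_dense fun r' hr' => ?_)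
        have hr0 := hr.trans hr'
        refine ((gaugeAt_lt_iff ho ha hs hr0).2 ?_).le
        have := hcl _ hmem (r'⁻¹ * r) ⟨by positivity, by
          rw [inv_mul_lt_iff₀ hr0, mul_one]; exact hr'⟩
        rwa [add_sub_cancel_left, smul_smul, mul_assoc, mul_inv_cancel₀ hr.ne', mul_one] at this
      · intro h
        refine lt_of_le_of_ne (not_lt.1 fun hlt => h (subset_closure
          ((gaugeAt_lt_iff ho ha hs hr).1 hlt))) fun heq => h ?_
        have hx : x ≠ a := by
          rintro rfl
          rw [gaugeAt_self ha] at heq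
          exact hr.ne' heq
        have := (gaugeAt_proj_mem ho ha hs hb hx).1
        rwa [← heq] at this
  · rcases le_or_gt r 0 with hr | hr
    · convert isOpen_empty
      exact Set.eq_empty_of_forall_notMem fun x hx =>
        not_lt.2 (hr.trans (gaugeAt_nonneg S a x)) hx
    · have hc : Continuous fun x : E => a + r⁻¹ • (x - a) := by fun_prop
      convert ho.preimage hc using 1
      ext x
      exact gaugeAt_lt_iff ho ha hs hr

end Gauge

/-! ### Geometry of the control volumes -/

namespace Discretisation

variable {d : ℕ} {Ω : Set (Space d)} (D : Discretisation Ω)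

theorem edge_subset_edgeHyperplane (σ : Fin D.numEdges) : D.edge σ ⊆ D.edgeHyperplane σ := by
  obtain ⟨U, -, h⟩ := D.edge_isOpen σ
  rw [h]; exact Set.inter_subset_right

theorem closure_edge_subset (σ : Fin D.numEdges) : closure (D.edge σ) ⊆ D.edgeHyperplane σ :=
  closure_minimal (D.edge_subset_edgeHyperplane σ) (isClosed_eq (by fun_prop) continuous_const)

theorem centerDist_pos {K : Fin D.numCells} {σ : Fin D.numEdges} (h : σ ∈ D.cellEdges K) :
    0 < D.centerDist K σ := D.center_dist_pos K σ h

theorem inner_edgeNormal_center_ne {K : Fin D.numCells} {σ : Fin D.numEdges}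
    (h : σ ∈ D.cellEdges K) : inner ℝ (D.edgeNormal σ) (D.center K) ≠ D.edgeOffset σ := by
  have h0 := D.centerDist_pos h
  rw [centerDist_eq, abs_pos, sub_ne_zero] at h0
  exact h0.symm

theorem isBounded_cell (hΩ : Bornology.IsBounded Ω) (K : Fin D.numCells) :
    Bornology.IsBounded (D.cell K) := hΩ.subset (D.cell_subset K)

theorem isBounded_edge (hΩ : Bornology.IsBounded Ω) (σ : Fin D.numEdges) :
    Bornology.IsBounded (D.edge σ) := hΩ.closure.subset (D.edge_subset σ)

theorem measurableSet_edge (σ : Fin D.numEdges) : MeasurableSet (D.edge σ) := by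
  obtain ⟨U, hU, h⟩ := D.edge_isOpen σ
  rw [h]
  exact hU.measurableSet.inter (measurableSet_hyperplane _ _)

theorem mem_cell_of_mem_closure (K : Fin D.numCells) :
    ∀ p ∈ closure (D.cell K), ∀ t ∈ Set.Ico (0 : ℝ) 1,
      D.center K + t • (p - D.center K) ∈ D.cell K := by
  intro p hp t ht
  by_contra hno
  have hfr : ∀ s ∈ Set.Icc t 1, ∃ σ ∈ D.cellEdges K,
      s * inner ℝ (D.normal K σ) (p - D.center K) = D.centerDist K σ := by
    intro s hs
    have hs0 : 0 ≤ s := ht.1.trans hs.1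
    have hc : D.center K + s • (p - D.center K) ∈ closure (D.cell K) :=
      map_mem_closure (f := fun p => D.center K + s • (p - D.center K)) (by fun_prop) hp
        fun z hz => (D.cell_starConvex K).add_smul_sub_mem hz hs0 hs.2
    have hn : D.center K + s • (p - D.center K) ∉ D.cell K := by
      intro hmem
      rcases hs0.eq_or_lt with h0 | h0
      · have : t = 0 := le_antisymm (hs.1.trans h0.symm.le) ht.1
        exact hno (by simpa [this] using D.center_mem K)
      · have := (D.cell_starConvex K).add_smul_sub_mem hmem (t := t / s)
          (div_nonneg ht.1 hs0) ((div_le_one h0).2 hs.1)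
        rw [add_sub_cancel_left, smul_smul, div_mul_cancel₀ _ h0.ne'] at this
        exact hno this
    have hb : D.center K + s • (p - D.center K) ∈ closure (D.cell K) \ D.cell K := ⟨hc, hn⟩
    rw [D.cell_boundary K] at hb
    obtain ⟨σ, hσ, hm⟩ := Set.mem_iUnion₂.1 hb
    have := D.inner_normal K (D.closure_edge_subset σ hm)
    rw [add_sub_cancel_left, inner_smul_right] at this
    exact ⟨σ, hσ, this⟩
  refine (Set.Icc_infinite ht.2).mono (t := (D.cellEdges K).image fun σ => D.centerDist K σ /
      inner ℝ (D.normal K σ) (p - D.center K)) ?_ (Finset.finite_toSet _)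
  intro s hs
  obtain ⟨σ, hσ, h⟩ := hfr s hs
  have h0 := D.centerDist_pos hσ
  have hne : inner ℝ (D.normal K σ) (p - D.center K) ≠ 0 := by
    intro h'
    rw [h', mul_zero] at h
    exact h0.ne h
  rw [Finset.coe_image]
  exact ⟨σ, hσ, by simp only; rw [← h, mul_div_cancel_right₀ _ hne]⟩

/-- The gauge of the control volume `K` with respect to `x_K`. -/
def cellGauge (K : Fin D.numCells) : Space d → ℝ := gaugeAt (D.cell K) (D.center K)

variable {D}

theorem cellGauge_of_mem_edge {K : Fin D.numCells} {σ : Fin D.numEdges} (h : σ ∈ D.cellEdges K)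
    {y : Space d} (hy : y ∈ closure (D.edge σ)) {t : ℝ} (ht : 0 < t) :
    D.cellGauge K (D.center K + t • (y - D.center K)) = t := by
  refine gaugeAt_eq (D.cell_isOpen K) (D.center_mem K) (D.cell_starConvex K)
    (D.mem_cell_of_mem_closure K) ?_ ht
  rw [D.cell_boundary K]
  exact Set.mem_biUnion h hy

theorem exists_edge_of_ne_center (hΩ : Bornology.IsBounded Ω) {K : Fin D.numCells} {x : Space d}
    (hx : x ≠ D.center K) : 0 < D.cellGauge K x ∧ ∃ σ ∈ D.cellEdges K,
      D.center K + (D.cellGauge K x)⁻¹ • (x - D.center K) ∈ closure (D.edge σ) := by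
  have h1 := gaugeAt_pos (D.cell_isOpen K) (D.center_mem K) (D.cell_starConvex K)
    (D.isBounded_cell hΩ K) hx
  have h2 := gaugeAt_proj_mem (D.cell_isOpen K) (D.center_mem K) (D.cell_starConvex K)
    (D.isBounded_cell hΩ K) hx
  rw [D.cell_boundary K] at h2
  obtain ⟨σ, hσ, hm⟩ := Set.mem_iUnion₂.1 h2
  exact ⟨h1, σ, hσ, hm⟩

theorem cellGauge_lt_one_iff {K : Fin D.numCells} {x : Space d} :
    D.cellGauge K x < 1 ↔ x ∈ D.cell K :=
  gaugeAt_lt_one_iff (D.cell_isOpen K) (D.center_mem K) (D.cell_starConvex K)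

theorem cone_eq_openCone (K : Fin D.numCells) (σ : Fin D.numEdges) :
    D.cone K σ = openCone (D.center K) (D.edge σ) := rfl

theorem cellGauge_eq_on_cone {K : Fin D.numCells} {σ : Fin D.numEdges} (h : σ ∈ D.cellEdges K)
    {x : Space d} (hx : x ∈ D.cone K σ) :
    D.cellGauge K x = inner ℝ (D.normal K σ) (x - D.center K) / D.centerDist K σ := by
  obtain ⟨t, ht, y, hy, rfl⟩ := hx
  rw [show (1 - t) • D.center K + t • y = D.center K + t • (y - D.center K) by module,
    cellGauge_of_mem_edge h (subset_closure hy) ht.1, add_sub_cancel_left, inner_smul_right,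
    D.inner_normal K (D.edge_subset_edgeHyperplane σ hy), mul_div_cancel_right₀]
  exact (D.centerDist_pos h).ne'

theorem cone_subset_cell {K : Fin D.numCells} {σ : Fin D.numEdges} (h : σ ∈ D.cellEdges K) :
    D.cone K σ ⊆ D.cell K := by
  rintro x ⟨t, ht, y, hy, rfl⟩
  rw [← cellGauge_lt_one_iff,
    show (1 - t) • D.center K + t • y = D.center K + t • (y - D.center K) by module,
    cellGauge_of_mem_edge h (subset_closure hy) ht.1]
  exact ht.2

theorem cone_disjoint {K : Fin D.numCells} {σ τ : Fin D.numEdges} (hσ : σ ∈ D.cellEdges K)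
    (hτ : τ ∈ D.cellEdges K) (hne : σ ≠ τ) : Disjoint (D.cone K σ) (D.cone K τ) := by
  rw [Set.disjoint_left]
  rintro x ⟨t, ht, y, hy, rfl⟩ ⟨s, hs, z, hz, hst⟩
  have e : ∀ (t : ℝ) (y : Space d), (1 - t) • D.center K + t • y =
    D.center K + t • (y - D.center K) := fun t y => by module
  have h1 := cellGauge_of_mem_edge hσ (subset_closure hy) ht.1
  have h2 := cellGauge_of_mem_edge hτ (subset_closure hz) hs.1
  rw [e, e] at hst
  rw [hst, h2] at h1
  subst h1
  have h3 := smul_right_injective _ hs.1.ne' (add_left_cancel hst)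
  have h4 : y = z := sub_left_injective h3
  subst h4
  exact Set.disjoint_left.1 (D.edge_disjoint σ τ hne) hy hz

theorem isOpen_cone {K : Fin D.numCells} {σ : Fin D.numEdges} (h : σ ∈ D.cellEdges K) :
    IsOpen (D.cone K σ) := by
  obtain ⟨U, hU, hσ⟩ := D.edge_isOpen σ
  have h0 := D.centerDist_pos h
  have e : D.cone K σ = {x | inner ℝ (D.normal K σ) (x - D.center K) ∈
      Set.Ioo 0 (D.centerDist K σ)} ∩ D.radial K σ ⁻¹' U := by
    ext x
    constructor
    · rintro ⟨t, ht, y, hy, rfl⟩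
      have hyH := D.edge_subset_edgeHyperplane σ hy
      have e1 : inner ℝ (D.normal K σ) ((1 - t) • D.center K + t • y - D.center K) =
          t * D.centerDist K σ := by
        rw [show (1 - t) • D.center K + t • y - D.center K = t • (y - D.center K) by module,
          inner_smul_right, D.inner_normal K hyH]
      constructor
      · rw [Set.mem_ofPred_eq, e1]
        exact ⟨mul_pos ht.1 h0, by nlinarith [ht.2]⟩
      · have : D.radial K σ ((1 - t) • D.center K + t • y) = y := by
          rw [radial, e1,
            show (1 - t) • D.center K + t • y - D.center K = t • (y - D.center K) by module,
            smul_smul]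
          have : D.centerDist K σ / (t * D.centerDist K σ) * t = 1 := by
            have := ht.1.ne'
            field_simp
          rw [this, one_smul, add_sub_cancel]
        rw [Set.mem_preimage, this]
        rw [hσ] at hy
        exact hy.1
    · rintro ⟨h1, h2⟩
      refine ⟨inner ℝ (D.normal K σ) (x - D.center K) / D.centerDist K σ,
        ⟨div_pos h1.1 h0, (div_lt_one h0).2 h1.2⟩, D.radial K σ x, ?_, ?_⟩
      · rw [hσ]; exact ⟨h2, D.radial_mem h h1.1.ne'⟩
      · rw [radial, smul_add, smul_smul, div_mul_div_cancel₀ h0.ne', div_self h1.1.ne']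
        module
  rw [e]
  have hc : Continuous fun x : Space d => inner ℝ (D.normal K σ) (x - D.center K) := by fun_prop
  refine ContinuousOn.isOpen_inter_preimage ?_ (isOpen_Ioo.preimage hc) hU
  intro x hx
  exact (D.radial_continuousAt hx.1.ne').continuousWithinAt

theorem ae_mem_cone (hd : 0 < d) (hΩ : Bornology.IsBounded Ω) (K : Fin D.numCells) :
    ∀ᵐ x, x ∈ D.cell K → ∃ σ ∈ D.cellEdges K, x ∈ D.cone K σ := by
  have hnull : ∀ σ ∈ D.cellEdges K,
      volume (openCone (D.center K) (closure (D.edge σ) \ D.edge σ)) = 0 := by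
    intro σ hσ
    have hsub : closure (D.edge σ) \ D.edge σ ⊆
        hyperplane (D.edgeNormal σ) (D.edgeOffset σ) :=
      Set.sdiff_subset.trans (D.closure_edge_subset σ)
    have hb : Bornology.IsBounded (closure (D.edge σ) \ D.edge σ) :=
      (D.isBounded_edge hΩ σ).closure.subset Set.sdiff_subset
    have h := volume_real_openCone hd (D.norm_edgeNormal σ) (D.inner_edgeNormal_center_ne hσ)
      hsub (isClosed_closure.measurableSet.diff (D.measurableSet_edge σ)) hb
    rw [Measure.real, Measure.real, D.edge_boundary_null σ] at h
    simp only [ENNReal.toReal_zero, mul_zero, zero_div] at h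
    exact ((ENNReal.toReal_eq_zero_iff _).1 h).resolve_right
      (isBounded_openCone hb).measure_lt_top.ne
  have : Nontrivial (Space d) := by
    have : Nonempty (Fin d) := ⟨⟨0, hd⟩⟩
    infer_instance
  have hall : ∀ᵐ x, ∀ σ ∈ D.cellEdges K,
      x ∉ openCone (D.center K) (closure (D.edge σ) \ D.edge σ) :=
    (eventually_all_finset _).2 fun σ hσ => measure_eq_zero_iff_ae_notMem.1 (hnull σ hσ)
  filter_upwards [hall, Measure.ae_ne volume (D.center K)] with x hx hxa hxK
  obtain ⟨h0, σ, hσ, hm⟩ := exists_edge_of_ne_center hΩ hxa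
  have e : x = (1 - D.cellGauge K x) • D.center K + D.cellGauge K x •
      (D.center K + (D.cellGauge K x)⁻¹ • (x - D.center K)) := by
    rw [smul_add, smul_smul, mul_inv_cancel₀ h0.ne']
    module
  refine ⟨σ, hσ, _, ⟨h0, cellGauge_lt_one_iff.2 hxK⟩, _, ?_, e⟩
  by_contra hno
  exact hx σ hσ ⟨_, ⟨h0, cellGauge_lt_one_iff.2 hxK⟩, _, ⟨hm, hno⟩, e⟩

theorem volume_boundary_cell (K : Fin D.numCells) :
    volume (closure (D.cell K) \ D.cell K) = 0 := by
  rw [D.cell_boundary K]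
  refine (measure_biUnion_null_iff (Finset.countable_toSet _)).2 fun σ _ => ?_
  refine measure_mono_null (D.closure_edge_subset σ) (volume_hyperplane ?_ _)
  intro h
  have := D.norm_edgeNormal σ
  simp [h] at this

theorem exists_lipschitzWith_cellGauge (hΩ : Bornology.IsBounded Ω) (K : Fin D.numCells) :
    ∃ L, LipschitzWith L (D.cellGauge K) := by
  set p : Option (Fin D.numEdges) → Space d → ℝ := fun o x => o.elim 0 fun σ =>
    inner ℝ (D.normal K σ) (x - D.center K) / D.centerDist K σ with hp
  have hlip : ∀ o, ∃ L, LipschitzWith L (p o) := by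
    rintro (_ | σ)
    · exact ⟨0, LipschitzWith.const 0⟩
    · refine ⟨‖((D.centerDist K σ)⁻¹ • innerSL ℝ (D.normal K σ))‖₊, ?_⟩
      have h := ((D.centerDist K σ)⁻¹ • innerSL ℝ (D.normal K σ)).lipschitz
      intro x y
      have h' := h (x - D.center K) (y - D.center K)
      rw [edist_sub_right] at h'
      convert h' using 2 <;> simp [hp] <;> ring
  choose L hL using hlip
  refine ⟨Finset.univ.sup L, lipschitzWith_of_continuous_selection ?_ Finset.univ
    (fun o _ => (hL o).weaken (Finset.le_sup (Finset.mem_univ o))) fun x => ?_⟩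
  · exact continuous_gaugeAt (D.cell_isOpen K) (D.center_mem K) (D.cell_starConvex K)
      (D.isBounded_cell hΩ K) (D.mem_cell_of_mem_closure K)
  · rcases eq_or_ne x (D.center K) with rfl | hx
    · exact ⟨none, Finset.mem_univ _, gaugeAt_self (D.center_mem K)⟩
    · obtain ⟨h0, σ, hσ, hm⟩ := exists_edge_of_ne_center hΩ hx
      refine ⟨some σ, Finset.mem_univ _, ?_⟩
      have := D.inner_normal K (D.closure_edge_subset σ hm)
      rw [add_sub_cancel_left, inner_smul_right] at this
      simp only [hp, Option.elim]
      rw [eq_div_iff (D.centerDist_pos hσ).ne', ← this, mul_inv_cancel_left₀ h0.ne']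

end Discretisation

theorem hasLineDerivAt_of_affine {E : Type*} [AddCommGroup E] [Module ℝ E] {f : E → ℝ} {x v : E}
    {c : ℝ} (h : ∀ t : ℝ, f (x + t • v) = f x + t * c) : HasLineDerivAt ℝ f c x v := by
  unfold HasLineDerivAt
  simp only [h]
  simpa using ((hasDerivAt_id (0 : ℝ)).mul_const c).const_add (f x)

namespace Discretisation

variable {d : ℕ} {Ω : Set (Space d)} {D : Discretisation Ω}

/-! ### Measures of edges and cones -/

theorem surfaceMeasure_edge_ne_top (hΩ : Bornology.IsBounded Ω) (σ : Fin D.numEdges) :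
    D.surfaceMeasure σ (D.edge σ) ≠ ⊤ :=
  (hyperplaneMeasure_lt_top _ _ (D.isBounded_edge hΩ σ)).ne

theorem edgeMeasure_pos (hΩ : Bornology.IsBounded Ω) (σ : Fin D.numEdges) :
    0 < D.edgeMeasure σ :=
  ENNReal.toReal_pos (D.edge_measure_pos σ).ne' (surfaceMeasure_edge_ne_top hΩ σ)

theorem abs_edgeOffset_sub (K : Fin D.numCells) (σ : Fin D.numEdges) :
    |D.edgeOffset σ - inner ℝ (D.edgeNormal σ) (D.center K)| = D.centerDist K σ :=
  (D.centerDist_eq K σ).symm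

theorem isBounded_cone (hΩ : Bornology.IsBounded Ω) (K : Fin D.numCells) (σ : Fin D.numEdges) :
    Bornology.IsBounded (D.cone K σ) :=
  isBounded_openCone (D.isBounded_edge hΩ σ)

theorem volume_real_cone (hd : 0 < d) (hΩ : Bornology.IsBounded Ω) {K : Fin D.numCells}
    {σ : Fin D.numEdges} (h : σ ∈ D.cellEdges K) :
    volume.real (D.cone K σ) = D.centerDist K σ * D.edgeMeasure σ / d := by
  rw [cone_eq_openCone, volume_real_openCone hd (D.norm_edgeNormal σ)
    (D.inner_edgeNormal_center_ne h) (D.edge_subset_edgeHyperplane σ) (D.measurableSet_edge σ)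
    (D.isBounded_edge hΩ σ), abs_edgeOffset_sub]
  rfl

theorem integrableOn_edge (hΩ : Bornology.IsBounded Ω) (σ : Fin D.numEdges) {F : Type*}
    [NormedAddCommGroup F] {f : Space d → F} (hf : Continuous f) :
    IntegrableOn f (D.edge σ) (D.surfaceMeasure σ) := by
  obtain ⟨C, hC⟩ := ((D.isBounded_edge hΩ σ).isCompact_closure.image hf).isBounded.exists_norm_le
  refine Measure.integrableOn_of_bounded (M := C) (surfaceMeasure_edge_ne_top hΩ σ)
    hf.aestronglyMeasurable ?_
  filter_upwards [ae_restrict_mem (D.measurableSet_edge σ)] with x hx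
  exact hC _ ⟨x, subset_closure hx, rfl⟩

theorem setIntegral_sub_edge (hΩ : Bornology.IsBounded Ω) (σ : Fin D.numEdges) (a : Space d) :
    ∫ y in D.edge σ, (y - a) ∂(D.surfaceMeasure σ) = D.edgeMeasure σ • (D.barycentre σ - a) := by
  have hm := (edgeMeasure_pos hΩ σ).ne'
  rw [integral_sub (f := fun y => y) (integrableOn_edge hΩ σ continuous_id)
    (integrableOn_edge hΩ σ continuous_const), setIntegral_const, barycentre, smul_sub, smul_smul,
    mul_inv_cancel₀ hm, one_smul]
  rfl

theorem setIntegral_sub_cone (hd : 0 < d) (hΩ : Bornology.IsBounded Ω) {K : Fin D.numCells}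
    {σ : Fin D.numEdges} (h : σ ∈ D.cellEdges K) :
    ∫ x in D.cone K σ, (x - D.center K) =
      (D.centerDist K σ * D.edgeMeasure σ / (d + 1)) • (D.barycentre σ - D.center K) := by
  rw [cone_eq_openCone, setIntegral_sub_openCone hd (D.norm_edgeNormal σ)
    (D.inner_edgeNormal_center_ne h) (D.edge_subset_edgeHyperplane σ) (D.measurableSet_edge σ)
    (D.isBounded_edge hΩ σ), abs_edgeOffset_sub]
  have := setIntegral_sub_edge hΩ σ (D.center K)
  rw [surfaceMeasure] at this
  rw [this, smul_smul]
  congr 1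
  ring

theorem inner_normal_barycentre (hΩ : Bornology.IsBounded Ω) (K : Fin D.numCells)
    (σ : Fin D.numEdges) :
    inner ℝ (D.normal K σ) (D.barycentre σ - D.center K) = D.centerDist K σ := by
  have hm := (edgeMeasure_pos hΩ σ).ne'
  have h := congrArg (fun x => inner ℝ (D.normal K σ) x)
    (setIntegral_sub_edge hΩ σ (D.center K))
  simp only [inner_smul_right] at h
  rw [← integral_inner (integrableOn_edge hΩ σ (by fun_prop))] at h
  have h2 : ∫ y in D.edge σ, inner ℝ (D.normal K σ) (y - D.center K) ∂(D.surfaceMeasure σ) =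
      ∫ y in D.edge σ, D.centerDist K σ ∂(D.surfaceMeasure σ) :=
    setIntegral_congr_fun (D.measurableSet_edge σ) fun y hy =>
      D.inner_normal K (D.edge_subset_edgeHyperplane σ hy)
  rw [h2, setIntegral_const] at h
  exact (mul_left_cancel₀ hm h).symm

theorem norm_barycentre_sub_le (hΩ : Bornology.IsBounded Ω) {K : Fin D.numCells}
    {σ : Fin D.numEdges} (h : σ ∈ D.cellEdges K) :
    ‖D.barycentre σ - D.center K‖ ≤ Metric.diam (D.cell K) := by
  have hm := edgeMeasure_pos hΩ σ
  have h1 : ‖∫ y in D.edge σ, (y - D.center K) ∂(D.surfaceMeasure σ)‖ ≤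
      Metric.diam (D.cell K) * (D.surfaceMeasure σ).real (D.edge σ) := by
    refine norm_setIntegral_le_of_norm_le_const
      (surfaceMeasure_edge_ne_top hΩ σ).lt_top fun y hy => ?_
    rw [← dist_eq_norm, ← Metric.diam_closure]
    exact Metric.dist_le_diam_of_mem (D.isBounded_cell hΩ K).closure
      (D.edge_subset_boundary h hy).1 (subset_closure (D.center_mem K))
  rw [setIntegral_sub_edge hΩ, norm_smul, Real.norm_eq_abs, abs_of_pos hm, mul_comm] at h1
  exact le_of_mul_le_mul_right h1 hm

theorem setIntegral_cell (hd : 0 < d) (hΩ : Bornology.IsBounded Ω) (K : Fin D.numCells)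
    {F : Type*} [NormedAddCommGroup F] [NormedSpace ℝ F] {f : Space d → F}
    (hf : IntegrableOn f (D.cell K)) :
    ∫ x in D.cell K, f x = ∑ σ ∈ D.cellEdges K, ∫ x in D.cone K σ, f x := by
  have e : (D.cell K : Set (Space d)) =ᵐ[volume] ⋃ σ ∈ D.cellEdges K, D.cone K σ := by
    refine eventuallyEq_set.2 ?_
    filter_upwards [ae_mem_cone hd hΩ K] with x hx
    constructor
    · intro hxK
      obtain ⟨σ, hσ, h⟩ := hx hxK
      exact Set.mem_biUnion hσ h
    · intro h
      obtain ⟨σ, hσ, h⟩ := Set.mem_iUnion₂.1 h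
      exact cone_subset_cell hσ h
  rw [setIntegral_congr_set e, integral_biUnion_finset]
  · exact fun σ hσ => (isOpen_cone hσ).measurableSet
  · exact fun σ hσ τ hτ hne => cone_disjoint hσ hτ hne
  · exact fun σ hσ => hf.mono_set (cone_subset_cell hσ)

theorem sum_volume_cone (hd : 0 < d) (hΩ : Bornology.IsBounded Ω) (K : Fin D.numCells) :
    ∑ σ ∈ D.cellEdges K, volume.real (D.cone K σ) = D.cellMeasure K := by
  have h := setIntegral_cell hd hΩ K (f := fun _ => (1 : ℝ))
    (integrableOn_const (D.isBounded_cell hΩ K).measure_lt_top.ne)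
  simp only [setIntegral_const, smul_eq_mul, mul_one] at h
  exact h.symm

theorem sum_centerDist_mul_edgeMeasure (hd : 0 < d) (hΩ : Bornology.IsBounded Ω)
    (K : Fin D.numCells) :
    ∑ σ ∈ D.cellEdges K, D.centerDist K σ * D.edgeMeasure σ = d * D.cellMeasure K := by
  rw [← sum_volume_cone hd hΩ, Finset.mul_sum]
  refine Finset.sum_congr rfl fun σ hσ => ?_
  rw [volume_real_cone hd hΩ hσ]
  have : (d : ℝ) ≠ 0 := by positivity
  field_simp

theorem cellMeasure_pos (hΩ : Bornology.IsBounded Ω) (K : Fin D.numCells) :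
    0 < D.cellMeasure K :=
  ENNReal.toReal_pos ((D.cell_isOpen K).measure_pos _ ⟨_, D.center_mem K⟩).ne'
    (D.isBounded_cell hΩ K).measure_lt_top.ne

/-! ### Integration by parts against the tent function of a control volume -/

variable (D) in
/-- The tent function of `K`, equal to `1` at `x_K` and to `0` outside `K`. -/
def tent (K : Fin D.numCells) (x : Space d) : ℝ := max (1 - D.cellGauge K x) 0

theorem tent_eq_zero {K : Fin D.numCells} {x : Space d} (hx : x ∉ D.cell K) : D.tent K x = 0 := by
  rw [← cellGauge_lt_one_iff, not_lt] at hx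
  exact max_eq_right (by linarith)

theorem tent_eq {K : Fin D.numCells} {σ : Fin D.numEdges} (h : σ ∈ D.cellEdges K) {x : Space d}
    (hx : x ∈ D.cone K σ) :
    D.tent K x = 1 - inner ℝ (D.normal K σ) (x - D.center K) / D.centerDist K σ := by
  have h1 := cellGauge_lt_one_iff.2 (cone_subset_cell h hx)
  rw [tent, max_eq_left (by linarith), cellGauge_eq_on_cone h hx]

theorem exists_lipschitzWith_tent (hΩ : Bornology.IsBounded Ω) (K : Fin D.numCells) :
    ∃ L, LipschitzWith L (D.tent K) := by
  obtain ⟨L, hL⟩ := exists_lipschitzWith_cellGauge hΩ K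
  refine ⟨0 + L, ?_⟩
  exact ((LipschitzWith.const 1).sub hL).max_const 0

theorem hasCompactSupport_tent (hΩ : Bornology.IsBounded Ω) (K : Fin D.numCells) :
    HasCompactSupport (D.tent K) :=
  HasCompactSupport.of_support_subset_isCompact (D.isBounded_cell hΩ K).isCompact_closure
    fun x hx => subset_closure (by by_contra h; exact hx (tent_eq_zero h))

theorem ae_lineDeriv_tent (hd : 0 < d) (hΩ : Bornology.IsBounded Ω) (K : Fin D.numCells)
    (v : Space d) : ∀ᵐ x, lineDeriv ℝ (D.tent K) x (-v) = ∑ σ ∈ D.cellEdges K,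
      (D.cone K σ).indicator (fun _ => inner ℝ (D.normal K σ) v / D.centerDist K σ) x := by
  filter_upwards [ae_mem_cone hd hΩ K, measure_eq_zero_iff_ae_notMem.1 (D.volume_boundary_cell K)]
    with x hx hxb
  by_cases hxK : x ∈ D.cell K
  · obtain ⟨σ, hσ, hxσ⟩ := hx hxK
    rw [Finset.sum_eq_single_of_mem σ hσ fun τ hτ hne => Set.indicator_of_notMem
      (fun h => Set.disjoint_left.1 (cone_disjoint hτ hσ hne) h hxσ) _, Set.indicator_of_mem hxσ]
    have he : D.tent K =ᶠ[𝓝 x] fun x =>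
        1 - inner ℝ (D.normal K σ) (x - D.center K) / D.centerDist K σ := by
      filter_upwards [(isOpen_cone hσ).mem_nhds hxσ] with y hy using tent_eq hσ hy
    rw [he.lineDeriv_eq]
    refine (hasLineDerivAt_of_affine fun t => ?_).lineDeriv
    rw [show x + t • -v - D.center K = x - D.center K - t • v by module, inner_sub_right,
      inner_smul_right]
    ring
  · have hxc : x ∉ closure (D.cell K) := fun h => hxb ⟨h, hxK⟩
    have he : D.tent K =ᶠ[𝓝 x] fun _ => 0 := by
      filter_upwards [isClosed_closure.isOpen_compl.mem_nhds hxc] with y hy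
      exact tent_eq_zero fun h => hy (subset_closure h)
    rw [he.lineDeriv_eq, Finset.sum_eq_zero fun σ hσ => Set.indicator_of_notMem
      (fun h => hxK (cone_subset_cell hσ h)) _]
    simp [lineDeriv]

theorem integrableOn_cone (hΩ : Bornology.IsBounded Ω) (K : Fin D.numCells) (σ : Fin D.numEdges)
    {F : Type*} [NormedAddCommGroup F] {f : Space d → F} (hf : Continuous f) :
    IntegrableOn f (D.cone K σ) :=
  (hf.continuousOn.integrableOn_compact
    (isBounded_cone hΩ K σ).isCompact_closure).mono_set subset_closure

theorem integral_lineDeriv_mul_tent (hd : 0 < d) (hΩ : Bornology.IsBounded Ω)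
    (K : Fin D.numCells) (v : Space d) {f : Space d → ℝ} {C : NNReal} (hf : LipschitzWith C f) :
    ∫ x, lineDeriv ℝ f x v * D.tent K x = ∑ σ ∈ D.cellEdges K,
      inner ℝ (D.normal K σ) v / D.centerDist K σ * ∫ x in D.cone K σ, f x := by
  obtain ⟨L, hL⟩ := exists_lipschitzWith_tent hΩ K
  rw [hf.integral_lineDeriv_mul_eq hL (hasCompactSupport_tent hΩ K) v]
  have e : ∀ᵐ x, lineDeriv ℝ (D.tent K) x (-v) * f x = ∑ σ ∈ D.cellEdges K,
      (D.cone K σ).indicator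
        (fun x => inner ℝ (D.normal K σ) v / D.centerDist K σ * f x) x := by
    filter_upwards [ae_lineDeriv_tent hd hΩ K v] with x hx
    rw [hx, Finset.sum_mul]
    refine Finset.sum_congr rfl fun σ _ => ?_
    by_cases h : x ∈ D.cone K σ <;> simp [h]
  rw [integral_congr_ae e, integral_finsetSum]
  · refine Finset.sum_congr rfl fun σ hσ => ?_
    rw [integral_indicator (isOpen_cone hσ).measurableSet, integral_const_mul]
  · intro σ hσ
    rw [integrable_indicator_iff (isOpen_cone hσ).measurableSet]
    exact integrableOn_cone hΩ K σ (continuous_const.mul hf.continuous)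

theorem sum_edgeMeasure_smul_normal (hd : 0 < d) (hΩ : Bornology.IsBounded Ω)
    (K : Fin D.numCells) : ∑ σ ∈ D.cellEdges K, D.edgeMeasure σ • D.normal K σ = 0 := by
  refine ext_inner_right ℝ fun v => ?_
  have h := integral_lineDeriv_mul_tent hd hΩ K v (LipschitzWith.const (1 : ℝ))
  simp only [lineDeriv, deriv_const, zero_mul, integral_zero, setIntegral_const, smul_eq_mul,
    mul_one] at h
  have hd' : (d : ℝ) ≠ 0 := by positivity
  rw [sum_inner, inner_zero_left]
  simp only [real_inner_smul_left]
  have h2 : ∑ σ ∈ D.cellEdges K, inner ℝ (D.normal K σ) v / D.centerDist K σ *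
      volume.real (D.cone K σ) =
      (d : ℝ)⁻¹ * ∑ σ ∈ D.cellEdges K, D.edgeMeasure σ * inner ℝ (D.normal K σ) v := by
    rw [Finset.mul_sum]
    refine Finset.sum_congr rfl fun σ hσ => ?_
    have := (D.centerDist_pos hσ).ne'
    rw [volume_real_cone hd hΩ hσ]
    field_simp
  rw [h2] at h
  simpa [hd'] using h.symm

theorem integral_tent (hd : 0 < d) (hΩ : Bornology.IsBounded Ω) (K : Fin D.numCells) :
    ∫ x, D.tent K x = D.cellMeasure K / (d + 1) := by
  obtain ⟨L, hL⟩ := exists_lipschitzWith_tent hΩ K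
  have hint := hL.continuous.integrable_of_hasCompactSupport (μ := volume)
    (hasCompactSupport_tent hΩ K)
  have hd' : (d : ℝ) ≠ 0 := by positivity
  rw [← setIntegral_eq_integral_of_forall_compl_eq_zero fun x hx => tent_eq_zero hx,
    setIntegral_cell hd hΩ K hint.integrableOn]
  have e : ∀ σ ∈ D.cellEdges K, ∫ x in D.cone K σ, D.tent K x =
      D.centerDist K σ * D.edgeMeasure σ / (d * (d + 1)) := by
    intro σ hσ
    have hδ := (D.centerDist_pos hσ).ne'
    rw [setIntegral_congr_fun (isOpen_cone hσ).measurableSet fun x hx => tent_eq hσ hx,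
      integral_sub (integrableOn_cone hΩ K σ continuous_const)
        (integrableOn_cone hΩ K σ (by fun_prop)), integral_div,
      integral_inner (integrableOn_cone hΩ K σ (by fun_prop)), setIntegral_sub_cone hd hΩ hσ,
      inner_smul_right, inner_normal_barycentre hΩ, setIntegral_const, volume_real_cone hd hΩ hσ,
      smul_eq_mul]
    field_simp
    ring
  rw [Finset.sum_congr rfl e, ← Finset.sum_div, sum_centerDist_mul_edgeMeasure hd hΩ]
  field_simp

/-- The discrete Stokes formula, exact on affine functions. -/
theorem sum_edgeMeasure_mul_inner (hd : 0 < d) (hΩ : Bornology.IsBounded Ω) (K : Fin D.numCells)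
    (v b : Space d) :
    ∑ σ ∈ D.cellEdges K, D.edgeMeasure σ * inner ℝ (D.normal K σ) v *
      inner ℝ b (D.barycentre σ - D.center K) = D.cellMeasure K * inner ℝ b v := by
  have hlip : LipschitzWith ‖innerSL ℝ b‖₊ fun x : Space d => inner ℝ b (x - D.center K) := by
    intro x y
    have h := (innerSL ℝ b).lipschitz (x - D.center K) (y - D.center K)
    rw [edist_sub_right] at h
    exact h
  have h := integral_lineDeriv_mul_tent hd hΩ K v hlip
  have e : ∀ x, lineDeriv ℝ (fun x : Space d => inner ℝ b (x - D.center K)) x v =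
      inner ℝ b v := by
    intro x
    refine (hasLineDerivAt_of_affine fun t => ?_).lineDeriv
    rw [show x + t • v - D.center K = x - D.center K + t • v by module, inner_add_right,
      inner_smul_right]
  simp only [e] at h
  rw [integral_const_mul, integral_tent hd hΩ] at h
  have e2 : ∀ σ ∈ D.cellEdges K, inner ℝ (D.normal K σ) v / D.centerDist K σ *
      ∫ x in D.cone K σ, inner ℝ b (x - D.center K) =
      (D.edgeMeasure σ * inner ℝ (D.normal K σ) v *
        inner ℝ b (D.barycentre σ - D.center K)) / (d + 1) := by
    intro σ hσ
    have hδ := (D.centerDist_pos hσ).ne'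
    rw [integral_inner (integrableOn_cone hΩ K σ (by fun_prop)), setIntegral_sub_cone hd hΩ hσ,
      inner_smul_right]
    field_simp
  rw [Finset.sum_congr rfl e2, ← Finset.sum_div] at h
  have : (d : ℝ) + 1 ≠ 0 := by positivity
  field_simp at h
  linarith

theorem normal_add_normal_eq_zero {K L : Fin D.numCells} {σ : Fin D.numEdges}
    (hK : σ ∈ D.cellEdges K) (hL : σ ∈ D.cellEdges L) (hne : K ≠ L) :
    D.normal K σ + D.normal L σ = 0 := by
  have hpm : ∀ M : Fin D.numCells, σ ∈ D.cellEdges M →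
      D.normal M σ = D.edgeNormal σ ∨ D.normal M σ = -D.edgeNormal σ := by
    intro M hM
    have h0 := D.centerDist_pos hM
    rw [centerDist_eq] at h0
    rw [normal]
    rcases lt_or_gt_of_ne (abs_pos.1 h0) with h1 | h1
    · rw [Real.sign_of_neg h1]; simp
    · rw [Real.sign_of_pos h1]; simp
  have hneq : D.normal K σ ≠ D.normal L σ := by
    intro heq
    obtain ⟨x, hx⟩ := D.edge_nonempty σ
    obtain ⟨t, ht1, ht2⟩ := ((D.normal_outward hK hx).and (D.normal_outward hL hx)).exists
    have h2 := ht2.1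
    rw [← heq] at h2
    exact Set.disjoint_left.1 (D.cell_disjoint K L hne) ht1.1 h2
  rcases hpm K hK with h1 | h1 <;> rcases hpm L hL with h2 | h2 <;> rw [h1, h2] at hneq ⊢ <;>
    simp at hneq ⊢

/-- Conservativity: a sum over the edges of single-valued fluxes that vanish on the boundary. -/
theorem sum_conservative (f : Fin D.numEdges → ℝ) (hf : ∀ σ, D.IsExterior σ → f σ = 0) :
    ∑ K, ∑ σ ∈ D.cellEdges K, f σ • D.normal K σ = 0 := by
  have e : ∑ K, ∑ σ ∈ D.cellEdges K, f σ • D.normal K σ =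
      ∑ σ, ∑ K ∈ D.edgeCells σ, f σ • D.normal K σ := by
    apply Finset.sum_comm'
    intro K σ
    simp [edgeCells]
  rw [e]
  refine Finset.sum_eq_zero fun σ _ => ?_
  rcases D.edge_cells σ with ⟨h1, -⟩ | h2
  · simp [hf σ h1]
  · obtain ⟨K, L, hne, hKL⟩ := Finset.card_eq_two.1 h2
    have hK : σ ∈ D.cellEdges K := by
      have : K ∈ ({K, L} : Finset _) := by simp
      rw [← hKL] at this
      simpa using this
    have hL : σ ∈ D.cellEdges L := by
      have : L ∈ ({K, L} : Finset _) := by simp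
      rw [← hKL] at this
      simpa using this
    rw [edgeCells, hKL, Finset.sum_pair hne, ← smul_add, normal_add_normal_eq_zero hK hL hne,
      smul_zero]

end Discretisation

namespace Discretisation

variable {d : ℕ} {Ω : Set (Space d)} {D : Discretisation Ω}

/-! ### Size and regularity -/

theorem diam_le_size (K : Fin D.numCells) : Metric.diam (D.cell K) ≤ D.size :=
  le_ciSup (f := fun K => Metric.diam (D.cell K)) (Set.finite_range _).bddAbove K

theorem size_nonneg : 0 ≤ D.size := Real.iSup_nonneg fun _ => Metric.diam_nonneg

theorem diam_le_mul_centerDist {θ : ℝ} (hθ : D.regularity ≤ θ) {K : Fin D.numCells}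
    {σ : Fin D.numEdges} (h : σ ∈ D.cellEdges K) :
    Metric.diam (D.cell K) ≤ θ * D.centerDist K σ := by
  rw [← div_le_iff₀ (D.centerDist_pos h)]
  refine le_trans (le_csSup (Set.Finite.bddAbove ?_) (Or.inr ⟨K, σ, h, rfl⟩)) hθ
  refine Set.Finite.union ?_ ?_
  · refine (Set.finite_range fun p : Fin D.numEdges × Fin D.numCells × Fin D.numCells =>
      D.centerDist p.2.1 p.1 / D.centerDist p.2.2 p.1).subset ?_
    rintro r ⟨σ, -, K, -, L, -, rfl⟩
    exact ⟨(σ, K, L), rfl⟩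
  · refine (Set.finite_range fun p : Fin D.numCells × Fin D.numEdges =>
      Metric.diam (D.cell p.1) / D.centerDist p.1 p.2).subset ?_
    rintro r ⟨K, σ, -, rfl⟩
    exact ⟨(K, σ), rfl⟩

theorem dist_center_le_size (hΩ : Bornology.IsBounded Ω) {K : Fin D.numCells} {x : Space d}
    (hx : x ∈ D.cell K) : ‖x - D.center K‖ ≤ D.size := by
  rw [← dist_eq_norm]
  exact (Metric.dist_le_diam_of_mem (D.isBounded_cell hΩ K) hx (D.center_mem K)).trans
    (diam_le_size K)

theorem sum_cellMeasure_le (hΩ : Bornology.IsBounded Ω) :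
    ∑ K, D.cellMeasure K ≤ volume.real Ω := by
  simp only [cellMeasure]
  rw [← measureReal_biUnion_finset (fun K _ L _ hne => D.cell_disjoint K L hne)
    (fun K _ => (D.cell_isOpen K).measurableSet)
    (fun K _ => (D.isBounded_cell hΩ K).measure_lt_top.ne)]
  exact measureReal_mono (Set.iUnion₂_subset fun K _ => D.cell_subset K) hΩ.measure_lt_top.ne

/-! ### Bounds on the discrete gradient -/

variable (D) in
/-- The contribution of the control volume `K` to the square of the semi-norm `|v|_X`. -/
def localEnergy (v : D.X) (K : Fin D.numCells) : ℝ :=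
  ∑ σ ∈ D.cellEdges K, D.edgeMeasure σ / D.centerDist K σ * (v.2 σ - v.1 K) ^ 2

theorem localEnergy_nonneg (v : D.X) (K : Fin D.numCells) : 0 ≤ D.localEnergy v K :=
  Finset.sum_nonneg fun _ hσ => mul_nonneg
    (div_nonneg measureReal_nonneg (D.centerDist_pos hσ).le) (sq_nonneg _)

theorem sum_localEnergy (v : D.X) : ∑ K, D.localEnergy v K = D.seminormX v ^ 2 :=
  (Real.sq_sqrt (Finset.sum_nonneg fun K _ => localEnergy_nonneg v K)).symm

theorem sq_sum_edgeMeasure_mul_abs_le (hd : 0 < d) (hΩ : Bornology.IsBounded Ω) (v : D.X)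
    (K : Fin D.numCells) :
    (∑ σ ∈ D.cellEdges K, D.edgeMeasure σ * |v.2 σ - v.1 K|) ^ 2 ≤
      d * D.cellMeasure K * D.localEnergy v K := by
  rw [← sum_centerDist_mul_edgeMeasure hd hΩ, localEnergy]
  refine Finset.sum_sq_le_sum_mul_sum_of_sq_le_mul _ ?_ ?_ ?_
  · exact fun σ hσ => mul_nonneg (D.centerDist_pos hσ).le measureReal_nonneg
  · exact fun σ hσ => mul_nonneg
      (div_nonneg measureReal_nonneg (D.centerDist_pos hσ).le) (sq_nonneg _)
  · intro σ hσ
    have := (D.centerDist_pos hσ).ne'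
    refine le_of_eq ?_
    rw [mul_pow, sq_abs]
    field_simp

theorem norm_cellGradient_sq_le (hd : 0 < d) (hΩ : Bornology.IsBounded Ω) (v : D.X)
    (K : Fin D.numCells) : D.cellMeasure K * ‖D.cellGradient v K‖ ^ 2 ≤ d * D.localEnergy v K := by
  have hK := cellMeasure_pos (D := D) hΩ K
  have h1 : ‖∑ σ ∈ D.cellEdges K, (D.edgeMeasure σ * (v.2 σ - v.1 K)) • D.normal K σ‖ ≤
      ∑ σ ∈ D.cellEdges K, D.edgeMeasure σ * |v.2 σ - v.1 K| := by
    refine (norm_sum_le _ _).trans (Finset.sum_le_sum fun σ hσ => ?_)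
    rw [norm_smul, D.norm_normal hσ, mul_one, norm_mul, Real.norm_eq_abs, Real.norm_eq_abs,
      abs_of_pos (edgeMeasure_pos hΩ σ)]
  have h2 : ‖D.cellGradient v K‖ ≤ (D.cellMeasure K)⁻¹ *
      ∑ σ ∈ D.cellEdges K, D.edgeMeasure σ * |v.2 σ - v.1 K| := by
    rw [cellGradient, norm_smul, Real.norm_eq_abs, abs_of_pos (inv_pos.2 hK)]
    gcongr
  calc D.cellMeasure K * ‖D.cellGradient v K‖ ^ 2
      ≤ D.cellMeasure K * ((D.cellMeasure K)⁻¹ *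
        ∑ σ ∈ D.cellEdges K, D.edgeMeasure σ * |v.2 σ - v.1 K|) ^ 2 := by gcongr
    _ = (D.cellMeasure K)⁻¹ *
        (∑ σ ∈ D.cellEdges K, D.edgeMeasure σ * |v.2 σ - v.1 K|) ^ 2 := by field_simp
    _ ≤ (D.cellMeasure K)⁻¹ * (d * D.cellMeasure K * D.localEnergy v K) := by
        gcongr; exact sq_sum_edgeMeasure_mul_abs_le hd hΩ v K
    _ = d * D.localEnergy v K := by field_simp

theorem norm_edgeGradient_sq_le (hd : 0 < d) (hΩ : Bornology.IsBounded Ω) {θ : ℝ}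
    (hθ : D.regularity ≤ θ) (v : D.X) {K : Fin D.numCells} {σ : Fin D.numEdges}
    (h : σ ∈ D.cellEdges K) :
    volume.real (D.cone K σ) * ‖D.edgeGradient v K σ‖ ^ 2 ≤
      (2 + 4 * d * θ ^ 2) * (volume.real (D.cone K σ) * ‖D.cellGradient v K‖ ^ 2) +
        4 * (D.edgeMeasure σ / D.centerDist K σ * (v.2 σ - v.1 K) ^ 2) := by
  have hδ := D.centerDist_pos h
  have hm := edgeMeasure_pos (D := D) hΩ σ
  have hdR : (0 : ℝ) < d := by exact_mod_cast hd
  set δ := D.centerDist K σ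
  set q := v.2 σ - v.1 K
  set g := ‖D.cellGradient v K‖
  set s := inner ℝ (D.cellGradient v K) (D.barycentre σ - D.center K) with hs
  have hsle : s ^ 2 ≤ (g * (θ * δ)) ^ 2 := by
    refine sq_le_sq' ?_ ?_
    · have h1 := neg_abs_le s
      have h2 := abs_real_inner_le_norm (D.cellGradient v K) (D.barycentre σ - D.center K)
      have h3 := (norm_barycentre_sub_le hΩ h).trans (diam_le_mul_centerDist hθ h)
      have h4 : g * ‖D.barycentre σ - D.center K‖ ≤ g * (θ * δ) := by gcongr
      linarith
    · have h2 := real_inner_le_norm (D.cellGradient v K) (D.barycentre σ - D.center K)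
      have h3 := (norm_barycentre_sub_le hΩ h).trans (diam_le_mul_centerDist hθ h)
      have h4 : g * ‖D.barycentre σ - D.center K‖ ≤ g * (θ * δ) := by gcongr
      linarith
  have hR : D.residual v K σ ^ 2 = d / δ ^ 2 * (q - s) ^ 2 := by
    rw [residual, mul_pow, div_pow, Real.sq_sqrt hdR.le]
  have h1 : ‖D.edgeGradient v K σ‖ ^ 2 ≤ 2 * g ^ 2 + 2 * D.residual v K σ ^ 2 := by
    have := norm_add_le (D.cellGradient v K) (D.residual v K σ • D.normal K σ)
    rw [norm_smul, D.norm_normal h, mul_one, Real.norm_eq_abs] at this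
    have h2 : ‖D.edgeGradient v K σ‖ ^ 2 ≤ (g + |D.residual v K σ|) ^ 2 := by
      rw [edgeGradient]; gcongr
    nlinarith [sq_nonneg (g - |D.residual v K σ|), sq_abs (D.residual v K σ)]
  have h2 : (q - s) ^ 2 ≤ 2 * q ^ 2 + 2 * (g * (θ * δ)) ^ 2 := by nlinarith [sq_nonneg (q + s)]
  rw [volume_real_cone hd hΩ h]
  calc δ * D.edgeMeasure σ / d * ‖D.edgeGradient v K σ‖ ^ 2
      ≤ δ * D.edgeMeasure σ / d * (2 * g ^ 2 +
        2 * (d / δ ^ 2 * (2 * q ^ 2 + 2 * (g * (θ * δ)) ^ 2))) := by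
        gcongr
        refine h1.trans ?_
        rw [hR]
        gcongr
    _ = _ := by field_simp; ring

theorem sum_norm_edgeGradient_sq_le (hd : 0 < d) (hΩ : Bornology.IsBounded Ω) {θ : ℝ}
    (hθ : D.regularity ≤ θ) (v : D.X) :
    ∑ K, ∑ σ ∈ D.cellEdges K, volume.real (D.cone K σ) * ‖D.edgeGradient v K σ‖ ^ 2 ≤
      ((2 + 4 * d * θ ^ 2) * d + 4) * D.seminormX v ^ 2 := by
  rw [← sum_localEnergy, Finset.mul_sum]
  refine Finset.sum_le_sum fun K _ => ?_
  refine (Finset.sum_le_sum fun σ hσ => norm_edgeGradient_sq_le hd hΩ hθ v hσ).trans ?_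
  rw [Finset.sum_add_distrib, ← Finset.mul_sum, ← Finset.mul_sum, ← Finset.sum_mul,
    sum_volume_cone hd hΩ]
  have h1 := norm_cellGradient_sq_le hd hΩ v K
  have h2 : (2 + 4 * d * θ ^ 2) * (D.cellMeasure K * ‖D.cellGradient v K‖ ^ 2) ≤
      (2 + 4 * d * θ ^ 2) * (d * D.localEnergy v K) := by gcongr
  change _ + 4 * D.localEnergy v K ≤ _
  linarith

theorem cellMeasure_smul_cellGradient (hΩ : Bornology.IsBounded Ω) (v : D.X)
    (K : Fin D.numCells) : D.cellMeasure K • D.cellGradient v K =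
      ∑ σ ∈ D.cellEdges K, (D.edgeMeasure σ * (v.2 σ - v.1 K)) • D.normal K σ := by
  rw [cellGradient, smul_smul, mul_inv_cancel₀ (cellMeasure_pos hΩ K).ne', one_smul]

/-- The stabilisation has zero mean on each control volume. -/
theorem sum_volume_cone_smul_edgeGradient (hd : 0 < d) (hΩ : Bornology.IsBounded Ω) (v : D.X)
    (K : Fin D.numCells) :
    ∑ σ ∈ D.cellEdges K, volume.real (D.cone K σ) • D.edgeGradient v K σ =
      D.cellMeasure K • D.cellGradient v K := by
  have hdR : (0 : ℝ) < d := by exact_mod_cast hd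
  simp only [edgeGradient, smul_add, Finset.sum_add_distrib]
  rw [← Finset.sum_smul, sum_volume_cone hd hΩ, add_eq_left]
  have e : ∀ σ ∈ D.cellEdges K, volume.real (D.cone K σ) • D.residual v K σ • D.normal K σ =
      (Real.sqrt d / d) • ((D.edgeMeasure σ * (v.2 σ - v.1 K)) • D.normal K σ -
        (D.edgeMeasure σ * inner ℝ (D.cellGradient v K) (D.barycentre σ - D.center K)) •
          D.normal K σ) := by
    intro σ hσ
    have := (D.centerDist_pos hσ).ne'
    rw [← sub_smul, smul_smul, smul_smul, volume_real_cone hd hΩ hσ, residual]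
    congr 1
    field_simp
  rw [Finset.sum_congr rfl e, ← Finset.smul_sum, Finset.sum_sub_distrib,
    ← cellMeasure_smul_cellGradient hΩ, smul_eq_zero]
  right
  refine ext_inner_right ℝ fun w => ?_
  rw [inner_sub_left, inner_zero_left, real_inner_smul_left, sum_inner,
    ← sum_edgeMeasure_mul_inner hd hΩ, sub_eq_zero]
  refine Finset.sum_congr rfl fun σ _ => ?_
  rw [real_inner_smul_left]
  ring

/-! ### Piecewise constant functions -/

theorem sum_indicator_cell {F : Type*} [AddCommMonoid F] (c : Fin D.numCells → F)
    {K : Fin D.numCells} {x : Space d} (hx : x ∈ D.cell K) :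
    ∑ L, (D.cell L).indicator (fun _ => c L) x = c K := by
  rw [Finset.sum_eq_single_of_mem K (Finset.mem_univ K) fun L _ hne => Set.indicator_of_notMem
    (fun h => Set.disjoint_left.1 (D.cell_disjoint L K hne) h hx) _, Set.indicator_of_mem hx]

theorem sum_indicator_cone {F : Type*} [AddCommMonoid F]
    (c : Fin D.numCells → Fin D.numEdges → F) {K : Fin D.numCells} {σ : Fin D.numEdges}
    (hσ : σ ∈ D.cellEdges K) {x : Space d} (hx : x ∈ D.cone K σ) :
    ∑ L, ∑ τ ∈ D.cellEdges L, (D.cone L τ).indicator (fun _ => c L τ) x = c K σ := by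
  rw [Finset.sum_eq_single_of_mem K (Finset.mem_univ K), Finset.sum_eq_single_of_mem σ hσ,
    Set.indicator_of_mem hx]
  · exact fun τ hτ hne => Set.indicator_of_notMem
      (fun h => Set.disjoint_left.1 (cone_disjoint hτ hσ hne) h hx) _
  · exact fun L _ hne => Finset.sum_eq_zero fun τ hτ => Set.indicator_of_notMem
      (fun h => Set.disjoint_left.1 (D.cell_disjoint L K hne) (cone_subset_cell hτ h)
        (cone_subset_cell hσ hx)) _

theorem comp_reconstruction (v : D.X) {F : Type*} [AddCommMonoid F] (f : ℝ → F) (hf : f 0 = 0)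
    (x : Space d) : f (D.reconstruction v x) =
      ∑ K, (D.cell K).indicator (fun _ => f (v.1 K)) x := by
  by_cases h : ∃ K, x ∈ D.cell K
  · obtain ⟨K, hK⟩ := h
    rw [reconstruction, sum_indicator_cell _ hK, sum_indicator_cell _ hK]
  · push Not at h
    rw [reconstruction, Finset.sum_eq_zero fun K _ => Set.indicator_of_notMem (h K) _, hf,
      Finset.sum_eq_zero fun K _ => Set.indicator_of_notMem (h K) _]

theorem norm_discreteGradient_sq (v : D.X) (x : Space d) : ‖D.discreteGradient v x‖ ^ 2 =
    ∑ K, ∑ σ ∈ D.cellEdges K, (D.cone K σ).indicator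
      (fun _ => ‖D.edgeGradient v K σ‖ ^ 2) x := by
  by_cases h : ∃ K, ∃ σ ∈ D.cellEdges K, x ∈ D.cone K σ
  · obtain ⟨K, σ, hσ, hx⟩ := h
    rw [discreteGradient, sum_indicator_cone _ hσ hx,
      sum_indicator_cone (fun K σ => ‖D.edgeGradient v K σ‖ ^ 2) hσ hx]
  · push Not at h
    rw [discreteGradient, Finset.sum_eq_zero fun K _ => Finset.sum_eq_zero fun σ hσ =>
      Set.indicator_of_notMem (h K σ hσ) _, Finset.sum_eq_zero fun K _ =>
      Finset.sum_eq_zero fun σ hσ => Set.indicator_of_notMem (h K σ hσ) _]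
    simp

theorem setIntegral_indicator_subset {F : Type*} [NormedAddCommGroup F] [NormedSpace ℝ F]
    {s t : Set (Space d)} (hs : MeasurableSet s) (hst : s ⊆ t) (f : Space d → F) :
    ∫ x in t, s.indicator f x = ∫ x in s, f x := by
  rw [setIntegral_indicator hs, Set.inter_eq_right.2 hst]

theorem cone_subset {K : Fin D.numCells} {σ : Fin D.numEdges} (h : σ ∈ D.cellEdges K) :
    D.cone K σ ⊆ Ω := (cone_subset_cell h).trans (D.cell_subset K)

theorem memL2_indicator_const {F : Type*} [NormedAddCommGroup F] (hΩ : Bornology.IsBounded Ω)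
    {s : Set (Space d)} (hs : MeasurableSet s) (c : F) : MemL2 Ω (s.indicator fun _ => c) := by
  have : IsFiniteMeasure (volume.restrict Ω) := ⟨by simpa using hΩ.measure_lt_top⟩
  exact (memLp_const c).indicator hs

theorem memL2_discreteGradient (hΩ : Bornology.IsBounded Ω) (v : D.X) :
    MemL2 Ω (D.discreteGradient v) :=
  memLp_finsetSum _ fun _ _ => memLp_finsetSum _ fun _ hσ =>
    memL2_indicator_const hΩ (isOpen_cone hσ).measurableSet _

theorem memL2_reconstruction (hΩ : Bornology.IsBounded Ω) (v : D.X) :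
    MemL2 Ω (D.reconstruction v) :=
  memLp_finsetSum _ fun K _ => memL2_indicator_const hΩ (D.cell_isOpen K).measurableSet _

theorem setIntegral_sum_cone {F : Type*} [NormedAddCommGroup F] [NormedSpace ℝ F]
    (f : Fin D.numCells → Fin D.numEdges → Space d → F)
    (hf : ∀ K, ∀ σ ∈ D.cellEdges K, IntegrableOn (f K σ) (D.cone K σ)) :
    ∫ x in Ω, ∑ K, ∑ σ ∈ D.cellEdges K, (D.cone K σ).indicator (f K σ) x =
      ∑ K, ∑ σ ∈ D.cellEdges K, ∫ x in D.cone K σ, f K σ x := by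
  have hint : ∀ K, ∀ σ ∈ D.cellEdges K,
      Integrable ((D.cone K σ).indicator (f K σ)) (volume.restrict Ω) := fun K σ hσ =>
    ((hf K σ hσ).integrable_indicator (isOpen_cone hσ).measurableSet).restrict
  rw [integral_finsetSum _ fun K _ => integrable_finsetSum _ fun σ hσ => hint K σ hσ]
  refine Finset.sum_congr rfl fun K _ => ?_
  rw [integral_finsetSum _ fun σ hσ => hint K σ hσ]
  exact Finset.sum_congr rfl fun σ hσ =>
    setIntegral_indicator_subset (isOpen_cone hσ).measurableSet (cone_subset hσ) _

theorem setIntegral_sum_cell {F : Type*} [NormedAddCommGroup F] [NormedSpace ℝ F]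
    (f : Fin D.numCells → Space d → F) (hf : ∀ K, IntegrableOn (f K) (D.cell K)) :
    ∫ x in Ω, ∑ K, (D.cell K).indicator (f K) x = ∑ K, ∫ x in D.cell K, f K x := by
  rw [integral_finsetSum _ fun K _ =>
    ((hf K).integrable_indicator (D.cell_isOpen K).measurableSet).restrict]
  exact Finset.sum_congr rfl fun K _ =>
    setIntegral_indicator_subset (D.cell_isOpen K).measurableSet (D.cell_subset K) _

theorem integral_norm_discreteGradient_sq_le (hd : 0 < d) (hΩ : Bornology.IsBounded Ω) {θ : ℝ}
    (hθ : D.regularity ≤ θ) (v : D.X) :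
    ∫ x in Ω, ‖D.discreteGradient v x‖ ^ 2 ≤
      ((2 + 4 * d * θ ^ 2) * d + 4) * D.seminormX v ^ 2 := by
  simp only [norm_discreteGradient_sq]
  rw [setIntegral_sum_cone (fun L τ _ => ‖D.edgeGradient v L τ‖ ^ 2)
    fun K σ _ => integrableOn_cone hΩ K σ continuous_const]
  simp only [setIntegral_const, smul_eq_mul]
  exact sum_norm_edgeGradient_sq_le hd hΩ hθ v

theorem integral_abs_reconstruction (hΩ : Bornology.IsBounded Ω) (v : D.X) :
    ∫ x in Ω, |D.reconstruction v x| = ∑ K, |v.1 K| * D.cellMeasure K := by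
  simp only [comp_reconstruction v (fun r => |r|) abs_zero]
  rw [setIntegral_sum_cell (fun K _ => |v.1 K|)
    fun K => integrableOn_const (D.isBounded_cell hΩ K).measure_lt_top.ne]
  refine Finset.sum_congr rfl fun K _ => ?_
  rw [setIntegral_const, smul_eq_mul, mul_comm]
  rfl

/-! ### Consistency of the discrete gradient -/

theorem integral_inner_discreteGradient (hΩ : Bornology.IsBounded Ω) (v : D.X) {φ : Space d → ℝ}
    (hφ : Continuous φ) (e : Space d) :
    ∫ x in Ω, inner ℝ (D.discreteGradient v x) (φ x • e) =
      ∑ K, ∑ σ ∈ D.cellEdges K, inner ℝ (D.edgeGradient v K σ) e * ∫ x in D.cone K σ, φ x := by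
  have h : ∀ x, inner ℝ (D.discreteGradient v x) (φ x • e) = ∑ K, ∑ σ ∈ D.cellEdges K,
      (D.cone K σ).indicator (fun x => inner ℝ (D.edgeGradient v K σ) e * φ x) x := by
    intro x
    rw [discreteGradient, sum_inner]
    refine Finset.sum_congr rfl fun K _ => ?_
    rw [sum_inner]
    refine Finset.sum_congr rfl fun σ _ => ?_
    by_cases hx : x ∈ D.cone K σ
    · simp only [Set.indicator_of_mem hx, inner_smul_right]; ring
    · simp only [Set.indicator_of_notMem hx, inner_zero_left]
  simp only [h]
  rw [setIntegral_sum_cone (fun K σ x => inner ℝ (D.edgeGradient v K σ) e * φ x)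
    fun K σ _ => integrableOn_cone hΩ K σ (continuous_const.mul hφ)]
  simp only [integral_const_mul]

theorem integral_reconstruction_mul (hΩ : Bornology.IsBounded Ω) (v : D.X) {ψ : Space d → ℝ}
    (hψ : Continuous ψ) :
    ∫ x in Ω, D.reconstruction v x * ψ x = ∑ K, v.1 K * ∫ x in D.cell K, ψ x := by
  have h : ∀ x, D.reconstruction v x * ψ x =
      ∑ K, (D.cell K).indicator (fun x => v.1 K * ψ x) x := by
    intro x
    rw [reconstruction, Finset.sum_mul]
    refine Finset.sum_congr rfl fun K _ => ?_
    by_cases hx : x ∈ D.cell K <;> simp [hx]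
  simp only [h]
  rw [setIntegral_sum_cell]
  · simp only [integral_const_mul]
  · intro K
    exact ((continuous_const.mul hψ).continuousOn.integrableOn_compact
      (D.isBounded_cell hΩ K).isCompact_closure).mono_set subset_closure

theorem abs_setIntegral_sub_le {s : Set (Space d)} (hs : Bornology.IsBounded s)
    {ψ : Space d → ℝ} (hψ : Continuous ψ) {c ε : ℝ} (h : ∀ x ∈ s, |ψ x - c| ≤ ε) :
    |(∫ x in s, ψ x) - volume.real s * c| ≤ ε * volume.real s := by
  have hi : IntegrableOn ψ s :=
    (hψ.continuousOn.integrableOn_compact hs.isCompact_closure).mono_set subset_closure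
  have h1 : (∫ x in s, ψ x) - volume.real s * c = ∫ x in s, (ψ x - c) := by
    rw [integral_sub hi (integrableOn_const hs.measure_lt_top.ne), setIntegral_const, smul_eq_mul]
  rw [h1]
  exact norm_setIntegral_le_of_norm_le_const (f := fun x => ψ x - c) hs.measure_lt_top h

section Consistency

variable {φ : Space d → ℝ} {γ : Space d → Space d} {L₁ L₂ : ℝ}

theorem abs_integral_inner_discreteGradient_sub_le (hd : 0 < d) (hΩ : Bornology.IsBounded Ω)
    {θ : ℝ} (hθ : D.regularity ≤ θ) (v : D.X) (hφ : Continuous φ) (hL₁ : 0 ≤ L₁)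
    (h₁ : ∀ x y, |φ x - φ y| ≤ L₁ * ‖x - y‖) (e : Space d) :
    |(∫ x in Ω, inner ℝ (D.discreteGradient v x) (φ x • e)) - ∑ K, ∑ σ ∈ D.cellEdges K,
      D.edgeMeasure σ * (v.2 σ - v.1 K) * inner ℝ (D.normal K σ) e * φ (D.center K)| ≤
      D.size * (‖e‖ * L₁ * (volume.real Ω +
        ((2 + 4 * d * θ ^ 2) * d + 4) * D.seminormX v ^ 2)) := by
  rw [integral_inner_discreteGradient hΩ v hφ e]
  have e1 : ∀ K, ∑ σ ∈ D.cellEdges K,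
      D.edgeMeasure σ * (v.2 σ - v.1 K) * inner ℝ (D.normal K σ) e * φ (D.center K) =
      ∑ σ ∈ D.cellEdges K, inner ℝ (D.edgeGradient v K σ) e *
        (volume.real (D.cone K σ) * φ (D.center K)) := by
    intro K
    have h := congrArg (fun x => inner ℝ x e) ((sum_volume_cone_smul_edgeGradient hd hΩ v K).trans
      (cellMeasure_smul_cellGradient hΩ v K))
    simp only [sum_inner, real_inner_smul_left] at h
    rw [← Finset.sum_mul, ← h, Finset.sum_mul]
    exact Finset.sum_congr rfl fun σ _ => by ring
  simp only [e1]
  rw [← Finset.sum_sub_distrib]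
  simp only [← Finset.sum_sub_distrib, ← mul_sub]
  have hbound : ∀ K, ∀ σ ∈ D.cellEdges K, |inner ℝ (D.edgeGradient v K σ) e *
      ((∫ x in D.cone K σ, φ x) - volume.real (D.cone K σ) * φ (D.center K))| ≤
      D.size * (‖e‖ * L₁) * (volume.real (D.cone K σ) +
        volume.real (D.cone K σ) * ‖D.edgeGradient v K σ‖ ^ 2) := by
    intro K σ hσ
    have h1 := abs_setIntegral_sub_le (isBounded_cone hΩ K σ) hφ
      (c := φ (D.center K)) (ε := L₁ * D.size) fun x hx => (h₁ _ _).trans (by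
        gcongr; exact dist_center_le_size hΩ (cone_subset_cell hσ hx))
    have h2 := abs_real_inner_le_norm (D.edgeGradient v K σ) e
    have hs := D.size_nonneg
    have hm : 0 ≤ volume.real (D.cone K σ) := measureReal_nonneg
    rw [abs_mul]
    calc _ ≤ (‖D.edgeGradient v K σ‖ * ‖e‖) * (L₁ * D.size * volume.real (D.cone K σ)) := by
          gcongr
      _ = D.size * (‖e‖ * L₁) * (volume.real (D.cone K σ) * ‖D.edgeGradient v K σ‖) := by ring
      _ ≤ _ := by
          rw [← mul_one_add]
          gcongr
          nlinarith [sq_nonneg (‖D.edgeGradient v K σ‖ - 1)]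
  calc _ ≤ ∑ K, ∑ σ ∈ D.cellEdges K, D.size * (‖e‖ * L₁) * (volume.real (D.cone K σ) +
        volume.real (D.cone K σ) * ‖D.edgeGradient v K σ‖ ^ 2) := by
        refine (Finset.abs_sum_le_sum_abs _ _).trans (Finset.sum_le_sum fun K _ => ?_)
        exact (Finset.abs_sum_le_sum_abs _ _).trans (Finset.sum_le_sum (hbound K))
    _ = D.size * (‖e‖ * L₁) * (∑ K, D.cellMeasure K + ∑ K, ∑ σ ∈ D.cellEdges K,
          volume.real (D.cone K σ) * ‖D.edgeGradient v K σ‖ ^ 2) := by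
        simp only [← Finset.mul_sum, Finset.sum_add_distrib, sum_volume_cone hd hΩ]
    _ ≤ _ := by
        have hs := D.size_nonneg
        rw [mul_assoc D.size]
        refine mul_le_mul_of_nonneg_left (mul_le_mul_of_nonneg_left (add_le_add ?_ ?_)
          (mul_nonneg (norm_nonneg e) hL₁)) hs
        · exact sum_cellMeasure_le hΩ
        · exact sum_norm_edgeGradient_sq_le hd hΩ hθ v

theorem abs_sum_flux_le (hd : 0 < d) (hΩ : Bornology.IsBounded Ω) (v : D.X) (hv : v ∈ D.X0)
    (hL₁ : 0 ≤ L₁) (h₁ : ∀ x y, |φ x - φ y| ≤ L₁ * ‖x - y‖) (e : Space d) :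
    |(∑ K, ∑ σ ∈ D.cellEdges K,
      D.edgeMeasure σ * (v.2 σ - v.1 K) * inner ℝ (D.normal K σ) e * φ (D.center K)) +
      ∑ K, v.1 K * ∑ σ ∈ D.cellEdges K,
        D.edgeMeasure σ * inner ℝ (D.normal K σ) e * φ (D.barycentre σ)| ≤
      D.size * (‖e‖ * L₁ * (d * volume.real Ω + D.seminormX v ^ 2)) := by
  have h0 := congrArg (fun x => inner ℝ x e) (sum_conservative (D := D)
    (fun σ => D.edgeMeasure σ * v.2 σ * φ (D.barycentre σ)) fun σ hσ => by rw [hv σ hσ]; ring)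
  simp only [sum_inner, real_inner_smul_left, inner_zero_left] at h0
  have e1 : (∑ K, ∑ σ ∈ D.cellEdges K,
      D.edgeMeasure σ * (v.2 σ - v.1 K) * inner ℝ (D.normal K σ) e * φ (D.center K)) +
      ∑ K, v.1 K * ∑ σ ∈ D.cellEdges K,
        D.edgeMeasure σ * inner ℝ (D.normal K σ) e * φ (D.barycentre σ) =
      ∑ K, ∑ σ ∈ D.cellEdges K, D.edgeMeasure σ * (v.2 σ - v.1 K) * inner ℝ (D.normal K σ) e *
        (φ (D.center K) - φ (D.barycentre σ)) := by
    rw [← sub_eq_zero, ← h0]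
    simp only [Finset.mul_sum, ← Finset.sum_add_distrib, ← Finset.sum_sub_distrib]
    refine Finset.sum_congr rfl fun K _ => Finset.sum_congr rfl fun σ _ => ?_
    ring
  rw [e1]
  have hbound : ∀ K, ∀ σ ∈ D.cellEdges K, |D.edgeMeasure σ * (v.2 σ - v.1 K) *
      inner ℝ (D.normal K σ) e * (φ (D.center K) - φ (D.barycentre σ))| ≤
      D.size * (‖e‖ * L₁) * (D.centerDist K σ * D.edgeMeasure σ +
        D.edgeMeasure σ / D.centerDist K σ * (v.2 σ - v.1 K) ^ 2) := by
    intro K σ hσ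
    have hδ := D.centerDist_pos hσ
    have hm := edgeMeasure_pos (D := D) hΩ σ
    have hs := D.size_nonneg
    have h1 : |φ (D.center K) - φ (D.barycentre σ)| ≤ L₁ * D.size := by
      refine (h₁ _ _).trans ?_
      rw [norm_sub_rev]
      gcongr
      exact (norm_barycentre_sub_le hΩ hσ).trans (diam_le_size K)
    have h2 := abs_real_inner_le_norm (D.normal K σ) e
    rw [D.norm_normal hσ, one_mul] at h2
    rw [abs_mul, abs_mul, abs_mul, abs_of_pos hm]
    calc _ ≤ D.edgeMeasure σ * |v.2 σ - v.1 K| * ‖e‖ * (L₁ * D.size) := by gcongr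
      _ = D.size * (‖e‖ * L₁) * (D.edgeMeasure σ * |v.2 σ - v.1 K|) := by ring
      _ ≤ _ := by
        gcongr
        rw [mul_comm (D.centerDist K σ), div_mul_eq_mul_div, mul_div_assoc, ← mul_add]
        gcongr
        set δ := D.centerDist K σ
        set q := v.2 σ - v.1 K
        have h3 : δ + q ^ 2 / δ - |q| = ((δ - |q|) ^ 2 + δ * |q|) / δ := by
          field_simp
          rw [← sq_abs q]
          ring
        have h4 : 0 ≤ ((δ - |q|) ^ 2 + δ * |q|) / δ := by positivity
        linarith
  calc _ ≤ ∑ K, ∑ σ ∈ D.cellEdges K, D.size * (‖e‖ * L₁) *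
        (D.centerDist K σ * D.edgeMeasure σ +
          D.edgeMeasure σ / D.centerDist K σ * (v.2 σ - v.1 K) ^ 2) := by
        refine (Finset.abs_sum_le_sum_abs _ _).trans (Finset.sum_le_sum fun K _ => ?_)
        exact (Finset.abs_sum_le_sum_abs _ _).trans (Finset.sum_le_sum (hbound K))
    _ = D.size * (‖e‖ * L₁) * (d * ∑ K, D.cellMeasure K + ∑ K, D.localEnergy v K) := by
        simp only [← Finset.mul_sum, Finset.sum_add_distrib,
          sum_centerDist_mul_edgeMeasure hd hΩ, localEnergy]
    _ ≤ _ := by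
        rw [sum_localEnergy, mul_assoc D.size]
        have hs := D.size_nonneg
        refine mul_le_mul_of_nonneg_left (mul_le_mul_of_nonneg_left (add_le_add
          (mul_le_mul_of_nonneg_left ?_ (Nat.cast_nonneg d)) le_rfl)
          (mul_nonneg (norm_nonneg e) hL₁)) hs
        exact sum_cellMeasure_le hΩ

theorem abs_sum_edge_sub_le (hd : 0 < d) (hΩ : Bornology.IsBounded Ω) {θ : ℝ}
    (hθ : D.regularity ≤ θ) (hL₂ : 0 ≤ L₂)
    (h₂ : ∀ x y, |φ y - φ x - inner ℝ (γ x) (y - x)| ≤ L₂ * ‖y - x‖ ^ 2) (e : Space d)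
    (K : Fin D.numCells) :
    |(∑ σ ∈ D.cellEdges K, D.edgeMeasure σ * inner ℝ (D.normal K σ) e * φ (D.barycentre σ)) -
      D.cellMeasure K * inner ℝ (γ (D.center K)) e| ≤
      D.size * (‖e‖ * L₂ * θ * d) * D.cellMeasure K := by
  have h0 := congrArg (fun x => inner ℝ x e * φ (D.center K))
    (sum_edgeMeasure_smul_normal (D := D) hd hΩ K)
  simp only [sum_inner, real_inner_smul_left, inner_zero_left, zero_mul, Finset.sum_mul] at h0
  have e1 : (∑ σ ∈ D.cellEdges K,
      D.edgeMeasure σ * inner ℝ (D.normal K σ) e * φ (D.barycentre σ)) -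
      D.cellMeasure K * inner ℝ (γ (D.center K)) e =
      ∑ σ ∈ D.cellEdges K, D.edgeMeasure σ * inner ℝ (D.normal K σ) e *
        (φ (D.barycentre σ) - φ (D.center K) -
          inner ℝ (γ (D.center K)) (D.barycentre σ - D.center K)) := by
    rw [← sum_edgeMeasure_mul_inner hd hΩ K e (γ (D.center K)), ← sub_eq_zero]
    rw [← h0]
    simp only [← Finset.sum_sub_distrib]
    refine Finset.sum_congr rfl fun σ _ => ?_
    ring
  rw [e1]
  have hbound : ∀ σ ∈ D.cellEdges K, |D.edgeMeasure σ * inner ℝ (D.normal K σ) e *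
        (φ (D.barycentre σ) - φ (D.center K) -
          inner ℝ (γ (D.center K)) (D.barycentre σ - D.center K))| ≤
      D.size * (‖e‖ * L₂ * θ) * (D.centerDist K σ * D.edgeMeasure σ) := by
    intro σ hσ
    have hm := edgeMeasure_pos (D := D) hΩ σ
    have h2 := abs_real_inner_le_norm (D.normal K σ) e
    rw [D.norm_normal hσ, one_mul] at h2
    have h3 := norm_barycentre_sub_le hΩ hσ
    have h4 : ‖D.barycentre σ - D.center K‖ ^ 2 ≤ D.size * (θ * D.centerDist K σ) := by
      rw [sq]
      exact mul_le_mul (h3.trans (diam_le_size K)) (h3.trans (diam_le_mul_centerDist hθ hσ))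
        (norm_nonneg _) D.size_nonneg
    rw [abs_mul, abs_mul, abs_of_pos hm]
    calc _ ≤ D.edgeMeasure σ * ‖e‖ * (L₂ * (D.size * (θ * D.centerDist K σ))) := by
          gcongr
          exact (h₂ _ _).trans (by gcongr)
      _ = _ := by ring
  refine (Finset.abs_sum_le_sum_abs _ _).trans ((Finset.sum_le_sum hbound).trans ?_)
  rw [← Finset.mul_sum, sum_centerDist_mul_edgeMeasure hd hΩ]
  exact le_of_eq (by ring)

/-- The discrete gradient is asymptotically dual to the reconstruction operator. -/
theorem abs_integral_duality_le (hd : 0 < d) (hΩ : Bornology.IsBounded Ω) {θ : ℝ}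
    (hθ : D.regularity ≤ θ) (v : D.X) (hv : v ∈ D.X0) (hφ : Continuous φ) (hγ : Continuous γ)
    (hL₁ : 0 ≤ L₁) (h₁ : ∀ x y, |φ x - φ y| ≤ L₁ * ‖x - y‖) (hL₂ : 0 ≤ L₂)
    (h₂ : ∀ x y, |φ y - φ x - inner ℝ (γ x) (y - x)| ≤ L₂ * ‖y - x‖ ^ 2)
    (h₃ : ∀ x y, ‖γ x - γ y‖ ≤ L₂ * ‖x - y‖) (e : Space d) :
    |(∫ x in Ω, inner ℝ (D.discreteGradient v x) (φ x • e)) +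
      ∫ x in Ω, D.reconstruction v x * inner ℝ (γ x) e| ≤
      D.size * (‖e‖ * L₁ * (volume.real Ω + ((2 + 4 * d * θ ^ 2) * d + 4) * D.seminormX v ^ 2) +
        ‖e‖ * L₁ * (d * volume.real Ω + D.seminormX v ^ 2) +
        ‖e‖ * L₂ * (θ * d + 1) * ∫ x in Ω, |D.reconstruction v x|) := by
  have hγe : Continuous fun x => inner ℝ (γ x) e := by fun_prop
  have t1 := abs_integral_inner_discreteGradient_sub_le hd hΩ hθ v hφ hL₁ h₁ e
  have t2 := abs_sum_flux_le hd hΩ v hv hL₁ h₁ e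
  rw [integral_reconstruction_mul hΩ v hγe, integral_abs_reconstruction hΩ]
  have t3 : |(∑ K, v.1 K * ∫ x in D.cell K, inner ℝ (γ x) e) - ∑ K, v.1 K *
      ∑ σ ∈ D.cellEdges K, D.edgeMeasure σ * inner ℝ (D.normal K σ) e * φ (D.barycentre σ)| ≤
      D.size * (‖e‖ * L₂ * (θ * d + 1) * ∑ K, |v.1 K| * D.cellMeasure K) := by
    rw [← Finset.sum_sub_distrib, ← mul_assoc, Finset.mul_sum]
    refine (Finset.abs_sum_le_sum_abs _ _).trans (Finset.sum_le_sum fun K _ => ?_)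
    have a1 := abs_sum_edge_sub_le hd hΩ hθ hL₂ h₂ e K
    have a2 := abs_setIntegral_sub_le (D.isBounded_cell hΩ K) hγe
      (c := inner ℝ (γ (D.center K)) e) (ε := D.size * (‖e‖ * L₂)) fun x hx => by
        rw [← inner_sub_left]
        refine (abs_real_inner_le_norm _ _).trans ?_
        calc _ ≤ (L₂ * D.size) * ‖e‖ := by
              gcongr
              exact (h₃ _ _).trans (by gcongr; exact dist_center_le_size hΩ hx)
          _ = _ := by ring
    rw [← mul_sub, abs_mul]
    have a3 := abs_sub_le (∫ x in D.cell K, inner ℝ (γ x) e)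
      (D.cellMeasure K * inner ℝ (γ (D.center K)) e)
      (∑ σ ∈ D.cellEdges K, D.edgeMeasure σ * inner ℝ (D.normal K σ) e * φ (D.barycentre σ))
    rw [abs_sub_comm (D.cellMeasure K * _)] at a3
    calc _ ≤ |v.1 K| * (D.size * (‖e‖ * L₂) * D.cellMeasure K +
          D.size * (‖e‖ * L₂ * θ * d) * D.cellMeasure K) := by
          gcongr
          exact a3.trans (add_le_add a2 a1)
      _ = _ := by ring
  rw [abs_le] at t1 t2 t3 ⊢
  constructor <;> linarith [t1.1, t1.2, t2.1, t2.2, t3.1, t3.2]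

end Consistency

end Discretisation

/-! ### Volume of neighbourhoods of subspaces of codimension one and two -/

section Slab

variable {E : Type*} [NormedAddCommGroup E] [InnerProductSpace ℝ E] [MeasurableSpace E]
  [BorelSpace E] [FiniteDimensional ℝ E]

omit [MeasurableSpace E] [BorelSpace E] [FiniteDimensional ℝ E] in
theorem inner_coe_orthogonal {ν : E} (v : (Submodule.span ℝ {ν})ᗮ) : inner ℝ ν (v : E) = 0 :=
  Submodule.mem_orthogonal_singleton_iff_inner_right.1 v.2

omit [MeasurableSpace E] [BorelSpace E] [FiniteDimensional ℝ E] in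
theorem norm_coe_orthogonal_le {ν : E} (s : ℝ) (v : (Submodule.span ℝ {ν})ᗮ) :
    ‖(v : E)‖ ≤ ‖s • ν + (v : E)‖ := by
  have h : ‖s • ν + (v : E)‖ ^ 2 = ‖s • ν‖ ^ 2 + ‖(v : E)‖ ^ 2 := by
    rw [norm_add_sq_real, real_inner_smul_left, inner_coe_orthogonal]
    ring
  exact le_of_sq_le_sq (by rw [h]; nlinarith [sq_nonneg ‖s • ν‖]) (norm_nonneg _)

omit [MeasurableSpace E] [BorelSpace E] [FiniteDimensional ℝ E] in
theorem inner_smul_add_orthogonal {ν : E} (hν : ‖ν‖ = 1) (s : ℝ) (v : (Submodule.span ℝ {ν})ᗮ) :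
    inner ℝ ν (s • ν + (v : E)) = s := by
  rw [inner_add_right, inner_coe_orthogonal, inner_smul_right, real_inner_self_eq_norm_sq, hν]
  ring

theorem exists_volume_slab_le {p : E} (hp : p ≠ 0) (R : ℝ) :
    ∃ C : ℝ, 0 ≤ C ∧ ∀ c ε : ℝ, 0 < ε →
      volume {x : E | ‖x‖ ≤ R ∧ |inner ℝ p x - c| < ε} ≤ ENNReal.ofReal (C * ε) := by
  have hp0 : 0 < ‖p‖ := norm_pos_iff.2 hp
  set ν := ‖p‖⁻¹ • p with hν
  have hν1 : ‖ν‖ = 1 := by rw [hν, norm_smul]; simp [hp0.ne']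
  have hpν : p = ‖p‖ • ν := by rw [hν, smul_smul, mul_inv_cancel₀ hp0.ne', one_smul]
  set B : Set (Submodule.span ℝ {ν})ᗮ := Metric.closedBall 0 R
  have hB : volume B ≠ ⊤ := Metric.isBounded_closedBall.measure_lt_top.ne
  refine ⟨2 / ‖p‖ * (volume B).toReal, by positivity, fun c ε hε => ?_⟩
  have hm := measurePreserving_smul_add hν1
  have he := measurableEmbedding_smul_add hν1
  rw [← hm.measure_preimage_emb he, Measure.volume_eq_prod]
  calc _ ≤ (volume.prod volume) (Set.Ioo ((c - ε) / ‖p‖) ((c + ε) / ‖p‖) ×ˢ B) := by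
        refine measure_mono ?_
        rintro ⟨s, v⟩ ⟨h1, h2⟩
        constructor
        · have e : inner ℝ p (s • ν + (v : E)) = ‖p‖ * s := by
            conv_lhs => rw [hpν]
            rw [real_inner_smul_left, inner_smul_add_orthogonal hν1]
          simp only [e] at h2
          rw [abs_lt] at h2
          rw [Set.mem_Ioo, div_lt_iff₀ hp0, lt_div_iff₀ hp0]
          constructor <;> linarith
        · rw [mem_closedBall_zero_iff]
          exact (norm_coe_orthogonal_le s v).trans h1
    _ = ENNReal.ofReal (2 / ‖p‖ * (volume B).toReal * ε) := by
        rw [Measure.prod_prod, Real.volume_Ioo, ← ENNReal.ofReal_toReal hB,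
          ← ENNReal.ofReal_mul (by rw [← sub_div]; apply div_nonneg <;> linarith),
          ENNReal.toReal_ofReal ENNReal.toReal_nonneg]
        congr 1
        field_simp
        ring

theorem exists_volume_inter_slab_le {ν p : E} (hν : ‖ν‖ = 1) (hp : p - inner ℝ ν p • ν ≠ 0)
    (R : ℝ) : ∃ C : ℝ, 0 ≤ C ∧ ∀ c c' ε : ℝ, 0 < ε →
      volume {x : E | ‖x‖ ≤ R ∧ |inner ℝ ν x - c| < ε ∧ |inner ℝ p x - c'| < ε} ≤
        ENNReal.ofReal (C * ε ^ 2) := by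
  have hmem : p - inner ℝ ν p • ν ∈ (Submodule.span ℝ {ν})ᗮ := by
    rw [Submodule.mem_orthogonal_singleton_iff_inner_right, inner_sub_right, inner_smul_right,
      real_inner_self_eq_norm_sq, hν]
    ring
  obtain ⟨C, hC, hslab⟩ := exists_volume_slab_le
    (p := (⟨_, hmem⟩ : (Submodule.span ℝ {ν})ᗮ)) (by simpa [Subtype.ext_iff] using hp) R
  refine ⟨2 * C, by positivity, fun c c' ε hε => ?_⟩
  have hm := measurePreserving_smul_add hν
  have he := measurableEmbedding_smul_add hν
  have hmeas : MeasurableSet {x : E | ‖x‖ ≤ R ∧ |inner ℝ ν x - c| < ε ∧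
      |inner ℝ p x - c'| < ε} :=
    (isClosed_le continuous_norm continuous_const).measurableSet.inter
      ((isOpen_lt (f := fun x : E => |inner ℝ ν x - c|) (by fun_prop)
        continuous_const).measurableSet.inter
        (isOpen_lt (f := fun x : E => |inner ℝ p x - c'|) (by fun_prop)
          continuous_const).measurableSet)
  rw [← hm.measure_preimage_emb he, Measure.volume_eq_prod,
    Measure.prod_apply (he.measurable hmeas)]
  calc _ ≤ ∫⁻ s : ℝ, (Set.Ioo (c - ε) (c + ε)).indicator
        (fun _ => ENNReal.ofReal (C * ε)) s := by
        refine lintegral_mono fun s => ?_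
        by_cases hs : s ∈ Set.Ioo (c - ε) (c + ε)
        · rw [Set.indicator_of_mem hs]
          refine le_trans (measure_mono ?_) (hslab (c' - s * inner ℝ p ν) ε hε)
          rintro v ⟨h1, -, h3⟩
          refine ⟨(norm_coe_orthogonal_le s v).trans h1, ?_⟩
          convert h3 using 2
          rw [Submodule.coe_inner, inner_sub_left, real_inner_smul_left, inner_coe_orthogonal,
            inner_add_right, inner_smul_right]
          ring
        · rw [Set.indicator_of_notMem hs, nonpos_iff_eq_zero]
          refine (congrArg volume ?_).trans measure_empty
          refine Set.eq_empty_of_forall_notMem ?_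
          rintro v ⟨-, h2, -⟩
          simp only [inner_smul_add_orthogonal hν] at h2
          rw [abs_lt] at h2
          exact hs ⟨by linarith, by linarith⟩
    _ = ENNReal.ofReal (2 * C * ε ^ 2) := by
        rw [lintegral_indicator_const measurableSet_Ioo, Real.volume_Ioo,
          ← ENNReal.ofReal_mul (by positivity)]
        congr 1
        ring

end Slab

theorem exists_volume_inter_hyperplanes_le {d : ℕ} {ν ν' : Space d} {c c' : ℝ} (hν : ‖ν‖ = 1)
    (hν' : ‖ν'‖ = 1) (hne : hyperplane ν c ≠ hyperplane ν' c') (R : ℝ) :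
    ∃ C : ℝ, 0 ≤ C ∧ ∀ ε : ℝ, 0 < ε →
      volume {x : Space d | ‖x‖ ≤ R ∧ |inner ℝ ν x - c| < ε ∧ |inner ℝ ν' x - c'| < ε} ≤
        ENNReal.ofReal (C * ε ^ 2) := by
  by_cases hp : ν' - inner ℝ ν ν' • ν = 0
  · set τ : ℝ := inner ℝ ν ν'
    have hτ : ν' = τ • ν := sub_eq_zero.1 hp
    have hτ1 : |τ| = 1 := by
      rw [hτ, norm_smul, hν, mul_one, Real.norm_eq_abs] at hν'
      exact hν'
    have hτ0 : τ ≠ 0 := by rintro h; simp [h] at hτ1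
    have hη : 0 < |τ * c - c'| := by
      rw [abs_pos]
      intro h
      refine hne ?_
      ext x
      rw [sub_eq_zero] at h
      simp only [hyperplane, Set.mem_ofPred_eq, hτ, real_inner_smul_left, ← h,
        mul_right_inj' hτ0]
    set η := |τ * c - c'|
    have hB : volume (Metric.closedBall (0 : Space d) R) ≠ ⊤ :=
      Metric.isBounded_closedBall.measure_lt_top.ne
    refine ⟨(volume (Metric.closedBall (0 : Space d) R)).toReal * (2 / η) ^ 2, by positivity,
      fun ε hε => ?_⟩
    rcases le_or_gt (2 * ε) η with h | h
    · refine le_of_eq_of_le ((congrArg volume ?_).trans measure_empty) (zero_le)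
      refine Set.eq_empty_of_forall_notMem ?_
      rintro x ⟨-, h1, h2⟩
      rw [hτ, real_inner_smul_left] at h2
      have h3 : η ≤ |τ * inner ℝ ν x - c'| + |τ * (inner ℝ ν x - c)| := by
        have := abs_sub (τ * inner ℝ ν x - c') (τ * (inner ℝ ν x - c))
        rwa [show (τ * inner ℝ ν x - c') - τ * (inner ℝ ν x - c) = τ * c - c' by ring] at this
      rw [abs_mul τ, hτ1, one_mul] at h3
      linarith
    · refine (measure_mono (t := Metric.closedBall (0 : Space d) R) ?_).trans ?_
      · rintro x ⟨h1, -⟩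
        simpa using h1
      · rw [← ENNReal.ofReal_toReal hB, ENNReal.toReal_ofReal ENNReal.toReal_nonneg, mul_assoc]
        refine ENNReal.ofReal_le_ofReal (le_mul_of_one_le_right ENNReal.toReal_nonneg ?_)
        rw [← mul_pow]
        refine one_le_pow₀ ?_
        rw [div_mul_eq_mul_div, le_div_iff₀ hη]
        linarith
  · obtain ⟨C, hC, h⟩ := exists_volume_inter_slab_le hν hp R
    exact ⟨C, hC, fun ε hε => h c c' ε hε⟩

/-! ### The boundary of a polyhedral domain -/

section Boundary

variable {d : ℕ} {Ω : Set (Space d)}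

theorem IsPolyhedralDomain.exists_unit_normals (hΩ : IsPolyhedralDomain Ω) :
    ∃ H : Finset (Space d × ℝ), (∀ h ∈ H, ‖h.1‖ = 1) ∧
      closure Ω \ Ω ⊆ ⋃ h ∈ H, hyperplane h.1 h.2 := by
  classical
  obtain ⟨H, hH, hsub⟩ := hΩ.boundary_subset
  refine ⟨H.image fun h => (‖h.1‖⁻¹ • h.1, ‖h.1‖⁻¹ * h.2), ?_, ?_⟩
  · intro h hh
    obtain ⟨k, hk, rfl⟩ := Finset.mem_image.1 hh
    have : ‖k.1‖ ≠ 0 := norm_ne_zero_iff.2 (hH k hk)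
    simp [norm_smul, this]
  · intro x hx
    obtain ⟨k, hk, hxk⟩ := Set.mem_iUnion₂.1 (hsub hx)
    refine Set.mem_iUnion₂.2 ⟨_, Finset.mem_image_of_mem _ hk, ?_⟩
    have hxk' : inner ℝ k.1 x = k.2 := hxk
    change inner ℝ (‖k.1‖⁻¹ • k.1) x = ‖k.1‖⁻¹ * k.2
    rw [real_inner_smul_left, hxk']

theorem exists_mem_segment_boundary (ho : IsOpen Ω) {x y : Space d} (hx : x ∈ Ω) (hy : y ∉ Ω) :
    ∃ z ∈ segment ℝ x y, z ∈ closure Ω \ Ω := by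
  by_contra hno
  push Not at hno
  have hcover : segment ℝ x y ⊆ Ω ∪ (closure Ω)ᶜ := by
    intro q hq
    by_cases hqΩ : q ∈ Ω
    · exact Or.inl hqΩ
    · exact Or.inr fun hqc => hno q hq ⟨hqc, hqΩ⟩
  obtain ⟨q, -, hq1, hq2⟩ := (convex_segment x y).isPreconnected Ω (closure Ω)ᶜ ho
    isClosed_closure.isOpen_compl hcover ⟨x, left_mem_segment ℝ _ _, hx⟩
    ⟨y, right_mem_segment ℝ _ _, (hcover (right_mem_segment ℝ _ _)).resolve_left hy⟩
  exact hq2 (subset_closure hq1)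

theorem abs_inner_sub_lt {ν x w : Space d} {c r : ℝ} (hν : ‖ν‖ = 1) (hw : w ∈ hyperplane ν c)
    (hxw : ‖x - w‖ < r) : |inner ℝ ν x - c| < r := by
  have hw' : inner ℝ ν w = c := hw
  rw [← hw', ← inner_sub_right]
  refine lt_of_le_of_lt ?_ hxw
  simpa [hν] using abs_real_inner_le_norm ν (x - w)

/-- A point of a polyhedral domain near the boundary leaves the domain under a small translation
in a direction normal to the boundary, or is close to two distinct hyperplanes. -/
theorem near_boundary (ho : IsOpen Ω) (hi : interior (closure Ω) = Ω)
    {H : Finset (Space d × ℝ)} (hH : ∀ h ∈ H, ‖h.1‖ = 1)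
    (hsub : closure Ω \ Ω ⊆ ⋃ h ∈ H, hyperplane h.1 h.2) {ε : ℝ} {x y : Space d}
    (hx : x ∈ Ω) (hy : y ∉ Ω) (hxy : ‖x - y‖ < ε) :
    (∃ h ∈ H, x + (2 * ε) • h.1 ∉ Ω ∨ x + (2 * ε) • (-h.1) ∉ Ω) ∨
      ∃ h ∈ H, ∃ h' ∈ H, hyperplane h.1 h.2 ≠ hyperplane h'.1 h'.2 ∧
        |inner ℝ h.1 x - h.2| < 4 * ε ∧ |inner ℝ h'.1 x - h'.2| < 4 * ε := by
  have hε : 0 < ε := (norm_nonneg _).trans_lt hxy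
  obtain ⟨z, hzseg, hz⟩ := exists_mem_segment_boundary ho hx hy
  have hxz : ‖x - z‖ < ε := by
    rw [segment_eq_image'] at hzseg
    obtain ⟨s, ⟨hs0, hs1⟩, rfl⟩ := hzseg
    rw [show x - (x + s • (y - x)) = s • (x - y) by module, norm_smul, Real.norm_eq_abs,
      abs_of_nonneg hs0]
    nlinarith [norm_nonneg (x - y)]
  obtain ⟨h, hh, hzh⟩ := Set.mem_iUnion₂.1 (hsub hz)
  by_contra hcon
  push Not at hcon
  obtain ⟨hc1, hc2⟩ := hcon
  have hν := hH h hh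
  have hxh : |inner ℝ h.1 x - h.2| < ε := abs_inner_sub_lt hν hzh hxz
  have hnn : inner ℝ h.1 h.1 = (1 : ℝ) := by rw [real_inner_self_eq_norm_sq, hν]; norm_num
  have hball : ∀ w ∈ Metric.ball x (4 * ε), w ∈ closure Ω \ Ω → inner ℝ h.1 w = h.2 := by
    intro w hw hwb
    obtain ⟨k, hk, hwk⟩ := Set.mem_iUnion₂.1 (hsub hwb)
    rw [Metric.mem_ball, dist_comm, dist_eq_norm] at hw
    by_contra hne
    refine absurd (abs_inner_sub_lt (hH k hk) hwk hw) (not_lt.2 (hc2 h hh k hk ?_ ?_))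
    · intro heq
      exact hne (show w ∈ hyperplane h.1 h.2 by rw [heq]; exact hwk)
    · linarith
  have hhalf : ∀ n : Space d, (n = h.1 ∨ n = -h.1) →
      Metric.ball x (4 * ε) ∩ {w | 0 < inner ℝ n (w - z)} ⊆ Ω := by
    intro n hn
    have hzh' : inner ℝ h.1 z = h.2 := hzh
    have hnorm : ‖n‖ = 1 := by rcases hn with rfl | rfl <;> simp [hν]
    have hin : |inner ℝ n (x - z)| < ε := by
      refine lt_of_le_of_lt (abs_real_inner_le_norm _ _) ?_
      rwa [hnorm, one_mul]
    have hpt : x + (2 * ε) • n ∈ Ω := by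
      rcases hn with rfl | rfl
      · exact (hc1 h hh).1
      · exact (hc1 h hh).2
    have hconv : Convex ℝ (Metric.ball x (4 * ε) ∩ {w | 0 < inner ℝ n (w - z)}) := by
      refine (convex_ball x _).inter ?_
      intro a ha b hb s t hs ht hst
      simp only [Set.mem_ofPred_eq] at ha hb ⊢
      rw [show s • a + t • b - z = s • (a - z) + t • (b - z) by
        rw [smul_sub, smul_sub]
        have : z = s • z + t • z := by rw [← add_smul, hst, one_smul]
        nth_rewrite 1 [this]
        abel, inner_add_right, inner_smul_right, inner_smul_right]
      rcases hs.eq_or_lt with h0 | h0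
      · have : t = 1 := by linarith
        subst this; rw [← h0]; linarith
      · have := mul_pos h0 ha
        have := mul_nonneg ht hb.le
        linarith
    refine hconv.isPreconnected.subset_left_of_subset_union ho
      (v := (closure Ω)ᶜ) isClosed_closure.isOpen_compl ?_ ?_ ?_
    · exact Set.disjoint_left.2 fun a ha ha' => ha' (subset_closure ha)
    · rintro w ⟨hw1, hw2⟩
      by_cases hwΩ : w ∈ Ω
      · exact Or.inl hwΩ
      · refine Or.inr fun hwc => ?_
        have h0 := hball w hw1 ⟨hwc, hwΩ⟩
        have h1 : inner ℝ n (w - z) = 0 := by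
          rcases hn with rfl | rfl <;> simp [inner_sub_right, h0, hzh']
        exact hw2.ne' h1
    · refine ⟨x + (2 * ε) • n, ⟨?_, ?_⟩, hpt⟩
      · rw [Metric.mem_ball, dist_self_add_left, norm_smul, hnorm, mul_one, Real.norm_eq_abs,
          abs_of_pos (by positivity)]
        linarith
      · rw [Set.mem_ofPred_eq, add_sub_right_comm, inner_add_right, inner_smul_right,
          real_inner_self_eq_norm_sq, hnorm]
        rw [abs_lt] at hin
        linarith
  have hcl : Metric.ball x (4 * ε) ⊆ closure Ω := by
    intro w hw
    rcases lt_trichotomy (inner ℝ h.1 (w - z)) 0 with h0 | h0 | h0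
    · refine subset_closure (hhalf (-h.1) (Or.inr rfl) ⟨hw, ?_⟩)
      rw [Set.mem_ofPred_eq, inner_neg_left]
      linarith
    · have hc : Continuous fun t : ℝ => w + t • h.1 := by fun_prop
      have ht : Tendsto (fun t : ℝ => w + t • h.1) (𝓝[>] 0) (𝓝 w) := by
        have := hc.tendsto 0
        rw [zero_smul, add_zero] at this
        exact this.mono_left nhdsWithin_le_nhds
      refine mem_closure_of_tendsto ht ?_
      filter_upwards [ht.eventually (Metric.isOpen_ball.mem_nhds hw), self_mem_nhdsWithin]
        with t ht1 ht2
      refine hhalf h.1 (Or.inl rfl) ⟨ht1, ?_⟩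
      rw [Set.mem_ofPred_eq, add_sub_right_comm, inner_add_right, h0, inner_smul_right, hnn]
      have : 0 < t := ht2
      linarith
    · exact subset_closure (hhalf h.1 (Or.inl rfl) ⟨hw, h0⟩)
  have hzΩ : z ∈ interior (closure Ω) := by
    refine interior_maximal hcl Metric.isOpen_ball ?_
    rw [Metric.mem_ball, dist_comm, dist_eq_norm]
    linarith
  rw [hi] at hzΩ
  exact hz.2 hzΩ

end Boundary

/-! ### Square integrable functions -/

section L2

variable {α F : Type*} [MeasurableSpace α] {μ : Measure α} [NormedAddCommGroup F]
  [InnerProductSpace ℝ F]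

theorem inner_toLp {f g : α → F} (hf : MemLp f 2 μ) (hg : MemLp g 2 μ) :
    inner ℝ (hf.toLp f) (hg.toLp g) = ∫ x, inner ℝ (f x) (g x) ∂μ := by
  rw [L2.inner_def]
  apply integral_congr_ae
  filter_upwards [hf.coeFn_toLp, hg.coeFn_toLp] with x h1 h2
  rw [h1, h2]

theorem norm_toLp_sq {f : α → F} (hf : MemLp f 2 μ) :
    ‖hf.toLp f‖ ^ 2 = ∫ x, ‖f x‖ ^ 2 ∂μ := by
  rw [← real_inner_self_eq_norm_sq, inner_toLp]
  simp only [real_inner_self_eq_norm_sq]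

theorem integrable_inner {f g : α → F} (hf : MemLp f 2 μ) (hg : MemLp g 2 μ) :
    Integrable (fun x => inner ℝ (f x) (g x)) μ := by
  refine (L2.integrable_inner (𝕜 := ℝ) (hf.toLp f) (hg.toLp g)).congr ?_
  filter_upwards [hf.coeFn_toLp, hg.coeFn_toLp] with x h1 h2
  rw [h1, h2]

theorem abs_integral_inner_le {f g : α → F} (hf : MemLp f 2 μ) (hg : MemLp g 2 μ) :
    |∫ x, inner ℝ (f x) (g x) ∂μ| ≤ √(∫ x, ‖f x‖ ^ 2 ∂μ) * √(∫ x, ‖g x‖ ^ 2 ∂μ) := by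
  rw [← inner_toLp hf hg, ← norm_toLp_sq hf, ← norm_toLp_sq hg, Real.sqrt_sq (norm_nonneg _),
    Real.sqrt_sq (norm_nonneg _)]
  exact abs_real_inner_le_norm _ _

theorem abs_integral_mul_le {f g : α → ℝ} (hf : MemLp f 2 μ) (hg : MemLp g 2 μ) :
    |∫ x, f x * g x ∂μ| ≤ √(∫ x, f x ^ 2 ∂μ) * √(∫ x, g x ^ 2 ∂μ) := by
  have h := abs_integral_inner_le hf hg
  simpa only [Real.norm_eq_abs, sq_abs, real_inner_eq_re_inner, RCLike.inner_apply,
    conj_trivial, RCLike.re_to_real, mul_comm] using h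

end L2

variable {d : ℕ}

theorem MemLp.comp_add_const {F : Type*} [NormedAddCommGroup F] {f : Space d → F}
    (hf : MemLp f 2) (h : Space d) : MemLp (fun x => f (x + h)) 2 :=
  hf.comp_measurePreserving (measurePreserving_add_right volume h)

/-! ### The mass of a boundary layer -/

section Layer

variable {Ω : Set (Space d)}

/-- The points of `Ω` at distance less than `ε` from the complement of `Ω`. -/
def boundaryLayer (Ω : Set (Space d)) (ε : ℝ) : Set (Space d) :=
  {x | x ∈ Ω ∧ ∃ y, y ∉ Ω ∧ ‖x - y‖ < ε}

theorem measurableSet_boundaryLayer (ho : IsOpen Ω) (ε : ℝ) :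
    MeasurableSet (boundaryLayer Ω ε) := by
  have : boundaryLayer Ω ε = Ω ∩ ⋃ y ∈ Ωᶜ, Metric.ball y ε := by
    ext x
    simp [boundaryLayer, dist_eq_norm]
  rw [this]
  exact (ho.inter (isOpen_biUnion fun _ _ => Metric.isOpen_ball)).measurableSet

theorem integral_boundaryLayer_le (hΩ : IsPolyhedralDomain Ω) {f : Space d → ℝ}
    (hf : MemLp f 2) {M A : ℝ} (hM : ∀ x, |f x| ≤ M) (hA : 0 ≤ A) (h0 : ∀ x, x ∉ Ω → f x = 0)
    (hT : ∀ h, ∫ x, (f (x + h) - f x) ^ 2 ≤ A * ‖h‖ ^ 2) :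
    ∃ C : ℝ, 0 ≤ C ∧ ∀ ε : ℝ, 0 < ε → ∫ x in boundaryLayer Ω ε, f x ^ 2 ≤ C * ε ^ 2 := by
  classical
  obtain ⟨H, hH, hsub⟩ := hΩ.exists_unit_normals
  obtain ⟨R, hR⟩ := hΩ.isBounded.subset_closedBall 0
  set P : (Space d × ℝ) × (Space d × ℝ) → ℝ → Set (Space d) := fun p ε =>
    {x | ‖x‖ ≤ R ∧ |inner ℝ p.1.1 x - p.1.2| < ε ∧ |inner ℝ p.2.1 x - p.2.2| < ε} with hP
  set Q := (H ×ˢ H).filter fun p => hyperplane p.1.1 p.1.2 ≠ hyperplane p.2.1 p.2.2 with hQ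
  have hvol : ∀ p, ∃ C : ℝ, 0 ≤ C ∧ (p ∈ Q → ∀ ε : ℝ, 0 < ε →
      volume (P p ε) ≤ ENNReal.ofReal (C * ε ^ 2)) := by
    intro p
    by_cases hp : p ∈ Q
    · rw [hQ, Finset.mem_filter, Finset.mem_product] at hp
      obtain ⟨C, hC, h⟩ := exists_volume_inter_hyperplanes_le (hH _ hp.1.1) (hH _ hp.1.2) hp.2 R
      exact ⟨C, hC, fun _ => h⟩
    · exact ⟨0, le_rfl, fun h => absurd h hp⟩
  choose C hC hCvol using hvol
  refine ⟨(∑ h ∈ H, (4 * A + 4 * A)) + ∑ p ∈ Q, M ^ 2 * (C p * 16), ?_, fun ε hε => ?_⟩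
  · refine add_nonneg (Finset.sum_nonneg fun _ _ => by positivity)
      (Finset.sum_nonneg fun p _ => ?_)
    have := hC p
    positivity
  have hPm : ∀ p, MeasurableSet (P p (4 * ε)) := fun p =>
    (isClosed_le continuous_norm continuous_const).measurableSet.inter
      ((isOpen_lt (f := fun x : Space d => |inner ℝ p.1.1 x - p.1.2|) (by fun_prop)
        continuous_const).measurableSet.inter
      (isOpen_lt (f := fun x : Space d => |inner ℝ p.2.1 x - p.2.2|) (by fun_prop)
        continuous_const).measurableSet)
  have hPfin : ∀ p, volume (P p (4 * ε)) ≠ ⊤ := fun p =>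
    ((Metric.isBounded_closedBall (x := (0 : Space d)) (r := R)).subset
      fun x hx => by simpa using hx.1).measure_lt_top.ne
  have hdiff : ∀ h, Integrable fun x => (f (x + h) - f x) ^ 2 := fun h =>
    ((MemLp.comp_add_const hf h).sub hf).integrable_sq
  have hpt : ∀ x, (boundaryLayer Ω ε).indicator (fun x => f x ^ 2) x ≤
      (∑ h ∈ H, ((f (x + (2 * ε) • h.1) - f x) ^ 2 + (f (x + (2 * ε) • -h.1) - f x) ^ 2)) +
        ∑ p ∈ Q, (P p (4 * ε)).indicator (fun _ => M ^ 2) x := by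
    intro x
    have n1 : ∀ h ∈ H, 0 ≤ (f (x + (2 * ε) • h.1) - f x) ^ 2 +
      (f (x + (2 * ε) • -h.1) - f x) ^ 2 := fun h _ => by positivity
    have n2 : ∀ p ∈ Q, 0 ≤ (P p (4 * ε)).indicator (fun _ => M ^ 2) x := fun p _ =>
      Set.indicator_nonneg (fun _ _ => sq_nonneg M) x
    have s1 := Finset.sum_nonneg n1
    have s2 := Finset.sum_nonneg n2
    by_cases hx : x ∈ boundaryLayer Ω ε
    · rw [Set.indicator_of_mem hx]
      obtain ⟨hxΩ, y, hy, hxy⟩ := hx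
      rcases near_boundary hΩ.isOpen hΩ.interior_closure hH hsub hxΩ hy hxy with
        ⟨h, hh, h1⟩ | ⟨h, hh, h', hh', hne, h1, h2⟩
      · have := Finset.single_le_sum n1 hh
        rcases h1 with h1 | h1
        · rw [h0 _ h1] at this
          nlinarith [sq_nonneg (f (x + (2 * ε) • -h.1) - f x)]
        · rw [h0 _ h1] at this
          nlinarith [sq_nonneg (f (x + (2 * ε) • h.1) - f x)]
      · have hp : (h, h') ∈ Q := by
          rw [hQ, Finset.mem_filter, Finset.mem_product]
          exact ⟨⟨hh, hh'⟩, hne⟩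
        have := Finset.single_le_sum n2 hp
        rw [Set.indicator_of_mem (show x ∈ P (h, h') (4 * ε) from
          ⟨by simpa using hR hxΩ, h1, h2⟩)] at this
        have hfx : f x ^ 2 ≤ M ^ 2 := sq_le_sq' (by linarith [(abs_le.1 (hM x)).1])
          (abs_le.1 (hM x)).2
        linarith
    · rw [Set.indicator_of_notMem hx]
      linarith
  have hi1 : ∀ h ∈ H, Integrable fun x => (f (x + (2 * ε) • h.1) - f x) ^ 2 +
      (f (x + (2 * ε) • -h.1) - f x) ^ 2 := fun h _ => (hdiff _).add (hdiff _)
  have hi2 : ∀ p ∈ Q, Integrable ((P p (4 * ε)).indicator fun _ => M ^ 2) := fun p _ =>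
    (integrable_indicator_iff (hPm p)).2 (integrableOn_const (hPfin p))
  rw [← integral_indicator (measurableSet_boundaryLayer hΩ.isOpen ε)]
  refine (integral_mono (hf.integrable_sq.indicator
    (measurableSet_boundaryLayer hΩ.isOpen ε)) ((integrable_finsetSum _ hi1).add
      (integrable_finsetSum _ hi2)) hpt).trans ?_
  simp only [Pi.add_apply]
  rw [integral_add (integrable_finsetSum _ hi1) (integrable_finsetSum _ hi2),
    integral_finsetSum _ hi1, integral_finsetSum _ hi2, add_mul, Finset.sum_mul, Finset.sum_mul]
  refine add_le_add (Finset.sum_le_sum fun h hh => ?_) (Finset.sum_le_sum fun p hp => ?_)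
  · rw [integral_add (hdiff _) (hdiff _)]
    have t1 := hT ((2 * ε) • h.1)
    have t2 := hT ((2 * ε) • -h.1)
    rw [norm_smul, Real.norm_eq_abs, abs_of_pos (by positivity)] at t1 t2
    rw [norm_neg] at t2
    rw [hH h hh] at t1 t2
    nlinarith
  · rw [integral_indicator (hPm p), setIntegral_const, smul_eq_mul]
    have : volume.real (P p (4 * ε)) ≤ C p * (4 * ε) ^ 2 :=
      ENNReal.toReal_le_of_le_ofReal (by have := hC p; positivity)
        (hCvol p hp (4 * ε) (by positivity))
    nlinarith [sq_nonneg M]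

end Layer

/-! ### Regularisation -/

section Mollify

/-- Approximate identities at scale `ε`. -/
theorem exists_mollifier (d : ℕ) : ∃ C : ℝ, 0 ≤ C ∧ ∀ ε : ℝ, 0 < ε → ∃ k : Space d → ℝ,
    ContDiff ℝ ∞ k ∧ HasCompactSupport k ∧ (∀ z, k z ≠ 0 → ‖z‖ < ε) ∧ ∫ z, k z = 1 ∧
      ∫ z, |k z| = 1 ∧ (∀ e, ∫ z, fderiv ℝ k z e = 0) ∧
      ∀ e, ‖e‖ = 1 → ∫ z, |fderiv ℝ k z e| ≤ C / ε := by
  let b : ContDiffBump (0 : Space d) := ⟨1 / 2, 1, by norm_num, by norm_num⟩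
  set ρ : Space d → ℝ := b.normed volume with hρ
  have hρs : ContDiff ℝ ∞ ρ := b.contDiff_normed
  have hρc : HasCompactSupport ρ := b.hasCompactSupport_normed
  have hρ' : Continuous (fderiv ℝ ρ) := hρs.continuous_fderiv (by simp)
  refine ⟨∫ z, ‖fderiv ℝ ρ z‖, integral_nonneg fun _ => norm_nonneg _, fun ε hε => ?_⟩
  have hε0 := hε.ne'
  set k : Space d → ℝ := fun z => (ε ^ d)⁻¹ * ρ (ε⁻¹ • z) with hk
  have hks : ContDiff ℝ ∞ k := by fun_prop
  have hksupp : ∀ z, k z ≠ 0 → ‖z‖ < ε := by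
    intro z hz
    have h1 : ρ (ε⁻¹ • z) ≠ 0 := right_ne_zero_of_mul hz
    have h2 : ε⁻¹ • z ∈ Function.support (b.normed volume) := h1
    rw [b.support_normed_eq, mem_ball_zero_iff, norm_smul, Real.norm_eq_abs,
      abs_of_pos (inv_pos.2 hε)] at h2
    have h3 : ε⁻¹ * ‖z‖ < 1 := h2
    rwa [inv_mul_lt_iff₀ hε, mul_one] at h3
  have hkc : HasCompactSupport k :=
    HasCompactSupport.of_support_subset_isCompact (isCompact_closedBall (0 : Space d) ε)
      fun z hz => by simpa using (hksupp z hz).le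
  have hscale : ∀ g : Space d → ℝ, ∫ z, (ε ^ d)⁻¹ * g (ε⁻¹ • z) = ∫ z, g z := by
    intro g
    rw [integral_const_mul, Measure.integral_comp_inv_smul_of_nonneg _ _ hε.le, smul_eq_mul,
      finrank_euclideanSpace_fin, inv_mul_cancel_left₀ (by positivity)]
  have hk1 : ∫ z, k z = 1 := by
    rw [hk, hscale ρ]
    exact b.integral_normed
  have hkn : ∀ z, 0 ≤ k z := fun z => mul_nonneg (by positivity) (b.nonneg_normed _)
  refine ⟨k, hks, hkc, hksupp, hk1, ?_, ?_, ?_⟩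
  · simp only [abs_of_nonneg (hkn _), hk1]
  · intro e
    obtain ⟨L, hL⟩ := hks.lipschitzWith_of_hasCompactSupport hkc (by simp)
    have h := (LipschitzWith.const (1 : ℝ)).integral_lineDeriv_mul_eq (μ := volume) hL hkc (-e)
    simp only [lineDeriv, deriv_const, zero_mul, integral_zero, neg_neg, mul_one] at h
    have h2 : ∀ z, deriv (fun t : ℝ => k (z + t • e)) 0 = fderiv ℝ k z e := fun z =>
      ((hks.differentiable (by simp)).differentiableAt (x := z)).lineDeriv_eq_fderiv (v := e)
    simp only [h2] at h
    exact h.symm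
  · intro e he
    have hder : ∀ z, fderiv ℝ k z e = (ε ^ d)⁻¹ * (ε⁻¹ * fderiv ℝ ρ (ε⁻¹ • z) e) := by
      intro z
      have h1 : HasFDerivAt (fun z : Space d => ε⁻¹ • z)
          (ε⁻¹ • ContinuousLinearMap.id ℝ (Space d)) z :=
        (hasFDerivAt_id z).const_smul ε⁻¹
      have h2 : HasFDerivAt ρ (fderiv ℝ ρ (ε⁻¹ • z)) (ε⁻¹ • z) :=
        (hρs.differentiable (by simp)).differentiableAt.hasFDerivAt
      have h3 := (h2.comp z h1).const_mul ((ε ^ d)⁻¹)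
      have h4 : fderiv ℝ k z = _ := h3.fderiv
      rw [h4]
      simp
    have h5 : ∀ z, |fderiv ℝ k z e| = (ε ^ d)⁻¹ * (fun y => ε⁻¹ * |fderiv ℝ ρ y e|) (ε⁻¹ • z) := by
      intro z
      rw [hder, abs_mul, abs_mul, abs_of_pos (inv_pos.2 hε),
        abs_of_pos (show 0 < (ε ^ d)⁻¹ by positivity)]
    simp only [h5]
    rw [hscale (fun y => ε⁻¹ * |fderiv ℝ ρ y e|), integral_const_mul, inv_mul_eq_div]
    gcongr
    · exact ((hρ'.clm_apply continuous_const).abs).integrable_of_hasCompactSupport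
        ((hρc.fderiv ℝ).mono fun z hz => by
          intro h0
          simp [h0] at hz)
    · exact hρ'.norm.integrable_of_hasCompactSupport (hρc.fderiv ℝ).norm
    · intro z
      simpa [he] using (fderiv ℝ ρ z).le_opNorm e

/-- Minkowski's inequality for the convolution of increments. -/
theorem integral_sq_increment_le {k g T : Space d → ℝ} (hk : Continuous k)
    (hkc : HasCompactSupport k) (hg : MemLp g 2) (hgi : Integrable g)
    (hT : ∀ x, T x = ∫ z, k z * (g (x - z) - g x)) {B : ℝ} (hTb : ∀ x, |T x| ≤ B)
    (hT2 : MemLp T 2) {A : ℝ} (hA : 0 ≤ A)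
    (hgA : ∀ z, k z ≠ 0 → ∫ x, (g (x - z) - g x) ^ 2 ≤ A ^ 2) :
    ∫ x, T x ^ 2 ≤ ((∫ z, |k z|) * A) ^ 2 := by
  set J := ∫ x, T x ^ 2 with hJ
  have hJ0 : 0 ≤ J := integral_nonneg fun _ => sq_nonneg _
  have hki : Integrable k := hk.integrable_of_hasCompactSupport hkc
  have hint : Integrable (Function.uncurry fun x z => k z * ((g (x - z) - g x) * T x))
      (volume.prod volume) := by
    have i1 := hki.convolution_integrand (ContinuousLinearMap.mul ℝ ℝ) hgi
    have i1' : Integrable (fun p : Space d × Space d => T p.1 * (k p.2 * g (p.1 - p.2)))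
        (volume.prod volume) :=
      i1.bdd_mul (c := B) hT2.aestronglyMeasurable.comp_fst (Eventually.of_forall fun p => hTb p.1)
    have i2 : Integrable (fun p : Space d × Space d => (g p.1 * T p.1) * k p.2)
        (volume.prod volume) :=
      Integrable.mul_prod (hg.integrable_mul hT2) hki
    refine (i1'.sub i2).congr (Eventually.of_forall fun p => ?_)
    simp only [Function.uncurry, Pi.sub_apply]
    ring
  have h1 : J = ∫ z, k z * ∫ x, (g (x - z) - g x) * T x := by
    have e1 : ∀ x, T x ^ 2 = ∫ z, k z * ((g (x - z) - g x) * T x) := by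
      intro x
      simp only [← mul_assoc]
      rw [integral_mul_const, ← hT, sq]
    simp only [hJ, e1]
    rw [integral_integral_swap hint]
    simp only [integral_const_mul]
  have h2 : ‖∫ z, k z * ∫ x, (g (x - z) - g x) * T x‖ ≤ ∫ z, |k z| * (A * √J) := by
    refine norm_integral_le_of_norm_le (hki.abs.mul_const _) (Eventually.of_forall fun z => ?_)
    rw [norm_mul, Real.norm_eq_abs, Real.norm_eq_abs]
    rcases eq_or_ne (k z) 0 with h0 | h0
    · simp [h0]
    · have hm : MemLp (fun x => g (x - z) - g x) 2 := by
        have e : (fun x => g (x - z) - g x) = (fun x => g (x + -z)) - g := by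
          ext x; simp [sub_eq_add_neg]
        rw [e]
        exact (MemLp.comp_add_const hg (-z)).sub hg
      have h3 := abs_integral_mul_le hm hT2
      have h4 : √(∫ x, (g (x - z) - g x) ^ 2) ≤ A := by
        rw [← Real.sqrt_sq hA]
        exact Real.sqrt_le_sqrt (hgA z h0)
      gcongr
      exact h3.trans (by gcongr)
  rw [← h1, integral_mul_const, Real.norm_eq_abs, abs_of_nonneg hJ0] at h2
  have hN : 0 ≤ ∫ z, |k z| := integral_nonneg fun _ => abs_nonneg _
  have hs : √J ≤ (∫ z, |k z|) * A := by
    by_contra hcon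
    push Not at hcon
    have hs0 : 0 < √J := lt_of_le_of_lt (by positivity) hcon
    have := Real.mul_self_sqrt hJ0
    nlinarith
  calc J = √J ^ 2 := (Real.sq_sqrt hJ0).symm
    _ ≤ _ := by gcongr

end Mollify

variable {Ω : Set (Space d)}

/-! ### Approximation of bounded functions by test functions -/

theorem norm_gradient_sq_eq_sum {φ : Space d → ℝ} (x : Space d) :
    ‖gradient φ x‖ ^ 2 = ∑ i, (fderiv ℝ φ x (EuclideanSpace.single i 1)) ^ 2 := by
  rw [EuclideanSpace.norm_sq_eq]
  refine Finset.sum_congr rfl fun i _ => ?_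
  rw [← inner_gradient_left, EuclideanSpace.inner_single_right, Real.norm_eq_abs, sq_abs]
  simp

theorem integral_increment_sq_le {f : Space d → ℝ} (hf : MemLp f 2) {r : Space d → ℝ}
    (hr : MemLp r 2) (z : Space d) :
    ∫ x, ((f (x - z) - r (x - z)) - (f x - r x)) ^ 2 ≤
      3 * (∫ x, (f (x + -z) - f x) ^ 2) + 6 * ∫ x, r x ^ 2 := by
  have i1 : Integrable fun x => (f (x + -z) - f x) ^ 2 :=
    ((MemLp.comp_add_const hf (-z)).sub hf).integrable_sq
  have i2 : Integrable fun x => r (x + -z) ^ 2 := (MemLp.comp_add_const hr (-z)).integrable_sq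
  have i3 := hr.integrable_sq
  have i4 : Integrable fun x => 3 * r (x + -z) ^ 2 + 3 * r x ^ 2 :=
    (i2.const_mul 3).add (i3.const_mul 3)
  have e : ∫ x, r (x + -z) ^ 2 = ∫ x, r x ^ 2 :=
    integral_add_right_eq_self (fun x => r x ^ 2) (-z)
  calc _ ≤ ∫ x, (3 * (f (x + -z) - f x) ^ 2 + (3 * r (x + -z) ^ 2 + 3 * r x ^ 2)) := by
        refine integral_mono_of_nonneg (Eventually.of_forall fun x => sq_nonneg _)
          ((i1.const_mul 3).add i4)
          (Eventually.of_forall fun x => ?_)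
        simp only [sub_eq_add_neg x z]
        nlinarith [sq_nonneg ((f (x + -z) - f x) + r (x + -z)), sq_nonneg (r (x + -z) + r x),
          sq_nonneg ((f (x + -z) - f x) - r x)]
    _ = _ := by
        rw [integral_add (i1.const_mul 3) i4,
          integral_add (i2.const_mul 3) (i3.const_mul 3), integral_const_mul, integral_const_mul,
          integral_const_mul, e]
        ring

theorem exists_testFunction_near (hΩ : IsPolyhedralDomain Ω) {f : Space d → ℝ}
    (hfm : Measurable f) {M A : ℝ} (hM : ∀ x, |f x| ≤ M) (hA : 0 ≤ A)
    (h0 : ∀ x, x ∉ Ω → f x = 0) (hT : ∀ h, ∫ x, (f (x + h) - f x) ^ 2 ≤ A * ‖h‖ ^ 2) :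
    ∃ C : ℝ, 0 ≤ C ∧ ∀ ε : ℝ, 0 < ε → ∃ w : Space d → ℝ, IsTestFunction Ω w ∧
      ∫ x, (w x - f x) ^ 2 ≤ C * ε ^ 2 ∧ ∫ x, ‖gradient w x‖ ^ 2 ≤ C := by
  have hM0 : 0 ≤ M := (abs_nonneg _).trans (hM 0)
  have hbdd : ∀ {p : ℝ≥0∞} {g : Space d → ℝ}, Measurable g → (∀ x, |g x| ≤ M) →
      (∀ x, x ∉ Ω → g x = 0) → MemLp g p := by
    intro p g hgm hgM hg0
    have e : g = Ω.indicator g := by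
      ext x
      by_cases hx : x ∈ Ω <;> simp [hx, hg0]
    rw [e, memLp_indicator_iff_restrict hΩ.isOpen.measurableSet]
    have : IsFiniteMeasure (volume.restrict Ω) := ⟨by simpa using hΩ.isBounded.measure_lt_top⟩
    exact MemLp.of_bound hgm.aestronglyMeasurable M (Eventually.of_forall hgM)
  have hf2 : MemLp f 2 := hbdd hfm hM h0
  obtain ⟨C₁, hC₁, hlayer⟩ := integral_boundaryLayer_le hΩ hf2 hM hA h0 hT
  obtain ⟨C₂, hC₂, hmoll⟩ := exists_mollifier d
  set S := 3 * A + 24 * C₁ with hS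
  have hS0 : 0 ≤ S := by positivity
  refine ⟨(2 * S + 8 * C₁) + d * (C₂ * √S) ^ 2, by positivity, fun ε hε => ?_⟩
  obtain ⟨k, hks, hkc, hksupp, hk1, hkabs, hkd0, hkd⟩ := hmoll ε hε
  have hLm := measurableSet_boundaryLayer hΩ.isOpen (2 * ε)
  set r : Space d → ℝ := (boundaryLayer Ω (2 * ε)).indicator f with hr
  have hrm : Measurable r := hfm.indicator hLm
  have hrM : ∀ x, |r x| ≤ M := fun x => by
    by_cases hx : x ∈ boundaryLayer Ω (2 * ε)
    · rw [hr, Set.indicator_of_mem hx]; exact hM x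
    · rw [hr, Set.indicator_of_notMem hx, abs_zero]; exact hM0
  have hr0 : ∀ x, x ∉ Ω → r x = 0 := fun x hx =>
    Set.indicator_of_notMem (fun h => hx h.1) _
  have hr2 : MemLp r 2 := hbdd hrm hrM hr0
  have hrint : ∫ x, r x ^ 2 ≤ 4 * C₁ * ε ^ 2 := by
    have h := hlayer (2 * ε) (by positivity)
    have e : ∀ x, r x ^ 2 = (boundaryLayer Ω (2 * ε)).indicator (fun x => f x ^ 2) x := by
      intro x
      by_cases hx : x ∈ boundaryLayer Ω (2 * ε) <;> simp [hr, hx]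
    simp only [e]
    rw [integral_indicator hLm]
    linarith
  set g : Space d → ℝ := fun x => f x - r x with hg
  have hgm : Measurable g := hfm.sub hrm
  have hgsupp : ∀ x, g x ≠ 0 → x ∈ Ω ∧ ∀ y, y ∉ Ω → 2 * ε ≤ ‖x - y‖ := by
    intro x hx
    have hxΩ : x ∈ Ω := by
      by_contra h
      exact hx (by simp [hg, h0 x h, hr0 x h])
    refine ⟨hxΩ, fun y hy => not_lt.1 fun hlt => hx ?_⟩
    have : x ∈ boundaryLayer Ω (2 * ε) := ⟨hxΩ, y, hy, hlt⟩
    simp [hg, hr, this]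
  have hgM : ∀ x, |g x| ≤ M := fun x => by
    by_cases hx : x ∈ boundaryLayer Ω (2 * ε)
    · simpa [hg, hr, hx] using hM0
    · simpa [hg, hr, hx] using hM x
  have hg0 : ∀ x, x ∉ Ω → g x = 0 := fun x hx => by simp [hg, h0 x hx, hr0 x hx]
  have hg2 : MemLp g 2 := hbdd hgm hgM hg0
  have hgi : Integrable g := memLp_one_iff_integrable.1 (hbdd hgm hgM hg0)
  have hgA : ∀ z, ‖z‖ ≤ ε → ∫ x, (g (x - z) - g x) ^ 2 ≤ (√S * ε) ^ 2 := by
    intro z hz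
    refine (integral_increment_sq_le hf2 hr2 z).trans ?_
    have h1 := hT (-z)
    rw [norm_neg] at h1
    have h2 : ‖z‖ ^ 2 ≤ ε ^ 2 := by gcongr
    rw [mul_pow, Real.sq_sqrt hS0, hS]
    nlinarith [mul_le_mul_of_nonneg_left h2 hA]
  have hAε : 0 ≤ √S * ε := by positivity
  set w : Space d → ℝ := convolution k g (ContinuousLinearMap.mul ℝ ℝ) volume with hw
  have hwx : ∀ x, w x = ∫ z, k z * g (x - z) := fun x => rfl
  have hws : ContDiff ℝ ∞ w :=
    hkc.contDiff_convolution_left _ hks hgi.locallyIntegrable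
  set Z : Set (Space d) := {x | ∀ y, y ∉ Ω → ε ≤ ‖x - y‖} with hZ
  have hZc : IsClosed Z := by
    simp only [hZ, Set.ofPred_forall]
    exact isClosed_iInter fun y => isClosed_iInter fun _ =>
      isClosed_le continuous_const (by fun_prop)
  have hZΩ : Z ⊆ Ω := by
    intro x hx
    by_contra hxΩ
    have := hx x hxΩ
    simp only [sub_self, norm_zero] at this
    linarith
  have hwsupp : Function.support w ⊆ Z := by
    intro x hx y hy
    have hex : ∃ z, k z * g (x - z) ≠ 0 := by
      by_contra hno
      push Not at hno
      exact hx (by rw [hwx]; simp [hno])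
    obtain ⟨z, hz⟩ := hex
    have h1 := hksupp z (left_ne_zero_of_mul hz)
    have h2 := (hgsupp _ (right_ne_zero_of_mul hz)).2 y hy
    have h3 : ‖x - z - y‖ ≤ ‖x - y‖ + ‖z‖ := by
      rw [sub_right_comm]; exact norm_sub_le _ _
    linarith
  have hwts : tsupport w ⊆ Z := closure_minimal hwsupp hZc
  have hZcomp : IsCompact Z := Metric.isCompact_of_isClosed_isBounded hZc (hΩ.isBounded.subset hZΩ)
  have hwc : HasCompactSupport w := HasCompactSupport.of_support_subset_isCompact hZcomp hwsupp
  refine ⟨w, ⟨hws, hwc, hwts.trans hZΩ⟩, ?_, ?_⟩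
  · have hexist := hkc.convolutionExists_left (ContinuousLinearMap.mul ℝ ℝ) hks.continuous
      hgi.locallyIntegrable
    have hTx : ∀ x, w x - g x = ∫ z, k z * (g (x - z) - g x) := by
      intro x
      have i1 : Integrable fun z => k z * g (x - z) := hexist x
      have i2 : Integrable fun z => k z * g x :=
        (hks.continuous.integrable_of_hasCompactSupport hkc).mul_const _
      simp only [mul_sub]
      rw [integral_sub i1 i2, integral_mul_const, hk1, one_mul, hwx]
    have hw2 : MemLp w 2 := hws.continuous.memLp_of_hasCompactSupport hwc
    obtain ⟨B, hB⟩ := hws.continuous.bounded_above_of_compact_support hwc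
    have key := integral_sq_increment_le (T := fun x => w x - g x) hks.continuous hkc hg2 hgi hTx
      (B := B + M) (fun x => (abs_sub _ _).trans (add_le_add (hB x) (hgM x))) (hw2.sub hg2)
      hAε
      fun z hz => hgA z (hksupp z hz).le
    rw [hkabs, one_mul, mul_pow, Real.sq_sqrt hS0] at key
    have i1 : Integrable fun x => 2 * (w x - g x) ^ 2 := (hw2.sub hg2).integrable_sq.const_mul 2
    have i2 := hr2.integrable_sq.const_mul 2
    have hnn : 0 ≤ d * (C₂ * √S) ^ 2 * ε ^ 2 := by positivity
    calc ∫ x, (w x - f x) ^ 2 ≤ ∫ x, (2 * (w x - g x) ^ 2 + 2 * r x ^ 2) := by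
          refine integral_mono_of_nonneg (Eventually.of_forall fun x => sq_nonneg _)
            (i1.add i2)
            (Eventually.of_forall fun x => ?_)
          have e : f x = g x + r x := by simp [hg]
          simp only [e]
          nlinarith [sq_nonneg ((w x - g x) + r x)]
      _ = (2 * ∫ x, (w x - g x) ^ 2) + 2 * ∫ x, r x ^ 2 := by
          rw [integral_add i1 i2, integral_const_mul, integral_const_mul]
      _ ≤ _ := by rw [add_mul]; linarith
  · have hdk : ∀ e : Space d, Continuous fun z => fderiv ℝ k z e := fun e =>
      (hks.continuous_fderiv (by simp)).clm_apply continuous_const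
    have hdkc : ∀ e : Space d, HasCompactSupport fun z => fderiv ℝ k z e := fun e =>
      (hkc.fderiv ℝ).mono fun z hz => by
        intro h
        simp [h] at hz
    have hdw : ∀ e : Space d, Continuous fun z => fderiv ℝ w z e := fun e =>
      (hws.continuous_fderiv (by simp)).clm_apply continuous_const
    have hdwc : ∀ e : Space d, HasCompactSupport fun z => fderiv ℝ w z e := fun e =>
      (hwc.fderiv ℝ).mono fun z hz => by
        intro h
        simp [h] at hz
    have hder : ∀ x e, fderiv ℝ w x e = ∫ z, fderiv ℝ k z e * (g (x - z) - g x) := by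
      intro x e
      have h1 := (hkc.hasFDerivAt_convolution_left (ContinuousLinearMap.mul ℝ ℝ)
        (hks.of_le (by simp)) hgi.locallyIntegrable x).fderiv
      have i0 := (hkc.fderiv ℝ).convolutionExists_left
        ((ContinuousLinearMap.mul ℝ ℝ).precompL (Space d)) (hks.continuous_fderiv (by simp))
        hgi.locallyIntegrable x
      have i1 : Integrable fun z => fderiv ℝ k z e * g (x - z) :=
        (hdkc e).convolutionExists_left (ContinuousLinearMap.mul ℝ ℝ) (hdk e)
          hgi.locallyIntegrable x
      have i2 : Integrable fun z => fderiv ℝ k z e * g x :=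
        ((hdk e).integrable_of_hasCompactSupport (hdkc e)).mul_const _
      rw [hw, h1, convolution, ContinuousLinearMap.integral_apply i0]
      simp only [mul_sub]
      rw [integral_sub i1 i2, integral_mul_const, hkd0, zero_mul, sub_zero]
      simp [ContinuousLinearMap.precompL_apply]
    have hcomp : ∀ e : Space d, ‖e‖ = 1 → ∫ x, (fderiv ℝ w x e) ^ 2 ≤ (C₂ * √S) ^ 2 := by
      intro e he
      obtain ⟨B, hB⟩ := (hdw e).bounded_above_of_compact_support (hdwc e)
      have key := integral_sq_increment_le (hdk e) (hdkc e) hg2 hgi (fun x => hder x e) hB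
        ((hdw e).memLp_of_hasCompactSupport (hdwc e)) hAε fun z hz => by
          have hkz : z ∈ tsupport k := by
            by_contra hno
            refine hz ?_
            have : fderiv ℝ k z = 0 := by
              by_contra h'
              exact hno (support_fderiv_subset ℝ h')
            simp [this]
          have hz' : ‖z‖ ≤ ε := by
            have : tsupport k ⊆ Metric.closedBall 0 ε :=
              closure_minimal (fun y hy => by simpa using (hksupp y hy).le)
                Metric.isClosed_closedBall
            simpa using this hkz
          exact hgA z hz'
      refine key.trans ?_
      have h1 := hkd e he
      have h2 : 0 ≤ ∫ z, |fderiv ℝ k z e| := integral_nonneg fun _ => abs_nonneg _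
      have h3 : (∫ z, |fderiv ℝ k z e|) * (√S * ε) ≤ C₂ * √S := by
        calc _ ≤ C₂ / ε * (√S * ε) := by gcongr
          _ = _ := by field_simp
      exact pow_le_pow_left₀ (by positivity) h3 2
    simp only [norm_gradient_sq_eq_sum]
    rw [integral_finsetSum _ fun i _ =>
      ((hdw _).memLp_of_hasCompactSupport (hdwc _)).integrable_sq]
    calc _ ≤ ∑ i : Fin d, (C₂ * √S) ^ 2 :=
          Finset.sum_le_sum fun i _ => hcomp _ (by simp)
      _ = d * (C₂ * √S) ^ 2 := by simp
      _ ≤ _ := le_add_of_nonneg_left (by positivity)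

/-! ### Functions with zero trace -/

/-- The extension by zero of `u` to `ℝ^d` has a weak gradient, the extension by zero of `G`. -/
def HasZeroTraceGradient (Ω : Set (Space d)) (u : Space d → ℝ) (G : Space d → Space d) : Prop :=
  MemL2 Ω u ∧ MemL2 Ω G ∧ ∀ φ : Space d → ℝ, ContDiff ℝ ∞ φ → HasCompactSupport φ →
    ∀ e : Space d, ∫ x in Ω, inner ℝ (G x) (φ x • e) = -∫ x in Ω, u x * inner ℝ (gradient φ x) e

theorem integral_sq_le_of_forall_abs_integral_mul_le {g : Space d → ℝ} (hg : MemLp g 2) {B : ℝ}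
    (h : ∀ φ : Space d → ℝ, ContDiff ℝ ∞ φ → HasCompactSupport φ →
      |∫ x, g x * φ x| ≤ B * √(∫ x, φ x ^ 2)) : ∫ x, g x ^ 2 ≤ B ^ 2 := by
  have hd := Lp.dense_hasCompactSupport_contDiff (E := Space d) (F := ℝ) (μ := volume)
    (p := 2) (by simp)
  have hc : IsClosed {f : Lp ℝ 2 (volume : Measure (Space d)) |
      inner ℝ (hg.toLp g) f ≤ B * ‖f‖} := isClosed_le (by fun_prop) (by fun_prop)
  have hall : ∀ f : Lp ℝ 2 (volume : Measure (Space d)), inner ℝ (hg.toLp g) f ≤ B * ‖f‖ := by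
    intro f
    refine hc.closure_subset_iff.2 ?_ (hd f)
    rintro f ⟨φ, hfφ, hφc, hφ⟩
    have hφ2 : MemLp φ 2 := hφ.continuous.memLp_of_hasCompactSupport hφc
    have e : f = hφ2.toLp φ := Lp.ext (hfφ.trans hφ2.coeFn_toLp.symm)
    have h1 := norm_toLp_sq hφ2
    simp only [Real.norm_eq_abs, sq_abs] at h1
    change inner ℝ _ _ ≤ _
    rw [e, inner_toLp, ← Real.sqrt_sq (norm_nonneg _), h1]
    refine (le_abs_self _).trans ?_
    simpa only [real_inner_eq_re_inner, RCLike.inner_apply, conj_trivial, RCLike.re_to_real,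
      mul_comm] using h φ hφ hφc
  have h1 := hall (hg.toLp g)
  rw [real_inner_self_eq_norm_sq] at h1
  have h2 := norm_toLp_sq hg
  simp only [Real.norm_eq_abs, sq_abs] at h2
  rw [← h2]
  rcases (norm_nonneg (hg.toLp g)).eq_or_lt with h0 | h0
  · rw [← h0]; nlinarith [sq_nonneg B]
  · have : ‖hg.toLp g‖ ≤ B := by nlinarith
    gcongr

theorem gradient_comp_sub_const (φ : Space d → ℝ) (a x : Space d) :
    gradient (fun y => φ (y - a)) x = gradient φ (x - a) := by
  rw [gradient, gradient, fderiv_comp_sub]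

theorem HasZeroTraceGradient.integral_increment_sq_le {u : Space d → ℝ} {G : Space d → Space d}
    (hu : HasZeroTraceGradient Ω u G) (hΩ : MeasurableSet Ω) (hΩb : Bornology.IsBounded Ω)
    (h0 : ∀ x, x ∉ Ω → u x = 0) (h : Space d) :
    ∫ x, (u (x + h) - u x) ^ 2 ≤ (∫ x in Ω, ‖G x‖ ^ 2) * ‖h‖ ^ 2 := by
  obtain ⟨hu2, hG, hibp⟩ := hu
  have hfin : IsFiniteMeasure (volume.restrict Ω) := ⟨by simpa using hΩb.measure_lt_top⟩
  have hind : Ω.indicator u = u := by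
    ext x
    by_cases hx : x ∈ Ω <;> simp [hx, h0]
  have hu2' : MemLp u 2 := by
    rw [← hind, memLp_indicator_iff_restrict hΩ]; exact hu2
  have hui : Integrable u := by
    rw [← hind, integrable_indicator_iff hΩ]
    exact (hu2.mono_exponent (by norm_num) : MemLp u 1 _).integrable le_rfl
  have hset : ∀ k : Space d → ℝ, ∫ x in Ω, u x * k x = ∫ x, u x * k x := by
    intro k
    refine setIntegral_eq_integral_of_forall_compl_eq_zero fun x hx => ?_
    rw [h0 x hx, zero_mul]
  set S := ∫ x in Ω, ‖G x‖ ^ 2 with hS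
  have hS0 : 0 ≤ S := integral_nonneg fun _ => by positivity
  have hB : (S * ‖h‖ ^ 2) = (√S * ‖h‖) ^ 2 := by rw [mul_pow, Real.sq_sqrt hS0]
  rw [hB]
  have huh : MemLp (fun x => u (x + h)) 2 := MemLp.comp_add_const hu2' h
  refine integral_sq_le_of_forall_abs_integral_mul_le (huh.sub hu2') ?_
  intro φ hφ hφc
  have hφ2 : MemLp φ 2 := hφ.continuous.memLp_of_hasCompactSupport hφc
  have hgc : Continuous (gradient φ) :=
    (InnerProductSpace.toDual ℝ (Space d)).symm.continuous.comp
      (hφ.continuous_fderiv (by simp))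
  obtain ⟨L, hL⟩ := (hφ.continuous_fderiv (by simp)).bounded_above_of_compact_support
    (hφc.fderiv ℝ)
  obtain ⟨N, hN⟩ := hφ.continuous.bounded_above_of_compact_support hφc
  set F : ℝ → ℝ := fun t => ∫ x, u x * φ (x - t • h) with hF
  set F' : ℝ → ℝ := fun t => ∫ x, u x * inner ℝ (gradient φ (x - t • h)) (-h) with hF'
  have hbu : Integrable fun x => |u x| * (L * ‖h‖) := hui.abs.mul_const _
  have hder : ∀ t, HasDerivAt F (F' t) t := by
    intro t
    refine (hasDerivAt_integral_of_dominated_loc_of_deriv_le (s := Set.univ) (x₀ := t)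
      (F := fun t x => u x * φ (x - t • h))
      (F' := fun t x => u x * inner ℝ (gradient φ (x - t • h)) (-h))
      (bound := fun x => |u x| * (L * ‖h‖)) univ_mem ?_ ?_ ?_ ?_ hbu ?_).2
    · exact Eventually.of_forall fun s => hui.aestronglyMeasurable.mul
        (hφ.continuous.comp (by fun_prop)).aestronglyMeasurable
    · exact hui.mul_bdd (c := N) (hφ.continuous.comp
        (continuous_sub_right (t • h))).aestronglyMeasurable
        (Eventually.of_forall fun x => hN _)
    · exact hui.aestronglyMeasurable.mul
        (Continuous.inner (hgc.comp (by fun_prop)) continuous_const).aestronglyMeasurable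
    · refine Eventually.of_forall fun x s _ => ?_
      rw [norm_mul, Real.norm_eq_abs]
      gcongr
      rw [inner_gradient_left, ← norm_neg h]
      exact (ContinuousLinearMap.le_opNorm _ _).trans (by gcongr; exact hL _)
    · refine Eventually.of_forall fun x s _ => ?_
      refine HasDerivAt.const_mul _ ?_
      have h1 := (hφ.differentiable (by simp) (x - s • h)).hasFDerivAt
      have h2 : HasDerivAt (fun s : ℝ => x - s • h) (-h) s := by
        simpa using ((hasDerivAt_id s).smul_const h).const_sub x
      rw [inner_gradient_left]
      exact h1.comp_hasDerivAt s h2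
  have hbd : ∀ t, ‖F' t‖ ≤ √S * ‖h‖ * √(∫ x, φ x ^ 2) := by
    intro t
    have hφt : ContDiff ℝ ∞ fun x => φ (x - t • h) := hφ.comp (by fun_prop)
    have hφtc : HasCompactSupport fun x => φ (x - t • h) :=
      hφc.comp_homeomorph (Homeomorph.subRight (t • h))
    have h1 := hibp _ hφt hφtc (-h)
    simp only [gradient_comp_sub_const, hset] at h1
    have hφt2 : MemLp (fun x => φ (x - t • h) • (-h)) 2 (volume.restrict Ω) :=
      ((hφt.smul contDiff_const).continuous.memLp_of_hasCompactSupport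
        (hφtc.smul_right (f' := fun _ => -h))).restrict Ω
    have h2 := abs_integral_inner_le hG hφt2
    rw [h1, abs_neg] at h2
    refine h2.trans ?_
    rw [← hS, mul_assoc]
    gcongr
    have e : ‖h‖ * √(∫ x, φ x ^ 2) = √(‖h‖ ^ 2 * ∫ x, φ x ^ 2) := by
      rw [Real.sqrt_mul (by positivity), Real.sqrt_sq (norm_nonneg _)]
    rw [e]
    gcongr
    have hi : Integrable fun x => ‖h‖ ^ 2 * φ (x - t • h) ^ 2 :=
      (hφt.continuous.memLp_of_hasCompactSupport hφtc (p := 2)).integrable_sq.const_mul _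
    calc ∫ x in Ω, ‖φ (x - t • h) • -h‖ ^ 2 = ∫ x in Ω, ‖h‖ ^ 2 * φ (x - t • h) ^ 2 := by
          refine integral_congr_ae (Eventually.of_forall fun x => ?_)
          simp only [norm_smul, norm_neg, mul_pow, Real.norm_eq_abs, sq_abs]
          ring
      _ ≤ ∫ x, ‖h‖ ^ 2 * φ (x - t • h) ^ 2 :=
          setIntegral_le_integral hi (Eventually.of_forall fun x => by positivity)
      _ = _ := by
          rw [integral_const_mul, integral_sub_right_eq_self (fun x => φ x ^ 2)]
  have key := norm_image_sub_le_of_norm_deriv_le_segment_01'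
    (fun t _ => (hder t).hasDerivWithinAt) (fun t _ => hbd t)
  rw [Real.norm_eq_abs] at key
  have e : ∫ x, (u (x + h) - u x) * φ x = F 1 - F 0 := by
    have e1 : F 1 = ∫ x, u (x + h) * φ x := by
      have := integral_add_right_eq_self (μ := volume) (fun x => u x * φ (x - (1 : ℝ) • h)) h
      rw [hF]
      simpa using this.symm
    rw [e1, hF]
    simp only [zero_smul, sub_zero, sub_mul]
    exact integral_sub (huh.integrable_mul hφ2) (hu2'.integrable_mul hφ2)
  simp only [Pi.sub_apply]
  rw [e]
  exact key

/-! ### Weak convergence in Hilbert spaces -/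

section Hilbert

variable {H : Type*} [NormedAddCommGroup H] [InnerProductSpace ℝ H]

theorem tendsto_inner_of_dense {ι : Type*} {l : Filter ι} {F : ι → H} {C : ℝ}
    (hF : ∀ i, ‖F i‖ ≤ C) {S : Set H} (hS : Dense S) {G : H}
    (h : ∀ s ∈ S, Tendsto (fun i => inner ℝ (F i) s) l (𝓝 (inner ℝ G s))) (g : H) :
    Tendsto (fun i => inner ℝ (F i) g) l (𝓝 (inner ℝ G g)) := by
  rw [Metric.tendsto_nhds]
  intro ε hε
  set B := |C| + ‖G‖ + 1 with hB
  have hB0 : 0 < B := by positivity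
  obtain ⟨s, hs, hsg⟩ := hS.exists_dist_lt g (ε := ε / (2 * B)) (by positivity)
  filter_upwards [(Metric.tendsto_nhds.1 (h s hs)) (ε / 2) (by positivity)] with i hi
  rw [Real.dist_eq] at hi ⊢
  rw [dist_eq_norm] at hsg
  have e : inner ℝ (F i) g - inner ℝ G g =
      (inner ℝ (F i) s - inner ℝ G s) + inner ℝ (F i - G) (g - s) := by
    simp only [inner_sub_left, inner_sub_right]; ring
  have h1 : |inner ℝ (F i - G) (g - s)| ≤ B * (ε / (2 * B)) := by
    refine (abs_real_inner_le_norm _ _).trans ?_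
    gcongr
    refine (norm_sub_le _ _).trans ?_
    have := (hF i).trans (le_abs_self C)
    linarith
  have h2 : B * (ε / (2 * B)) = ε / 2 := by field_simp
  rw [e]
  refine (abs_add_le _ _).trans_lt ?_
  linarith

theorem exists_weak_limit [CompleteSpace H] {ι : Type*} {l : Filter ι} [l.NeBot] {F : ι → H}
    {C : ℝ} (hF : ∀ i, ‖F i‖ ≤ C) {S : Set H} (hS : Dense S)
    (h : ∀ s ∈ S, ∃ a, Tendsto (fun i => inner ℝ (F i) s) l (𝓝 a)) :
    ∃ G : H, ‖G‖ ≤ C ∧ ∀ g, Tendsto (fun i => inner ℝ (F i) g) l (𝓝 (inner ℝ G g)) := by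
  set T : ι → WeakDual ℝ H := fun i => StrongDual.toWeakDual (InnerProductSpace.toDual ℝ H (F i))
  have hK := WeakDual.isCompact_closedBall (0 : StrongDual ℝ H) C
  set U := Ultrafilter.of l
  have hT : ∀ i, T i ∈ WeakDual.toStrongDual ⁻¹' Metric.closedBall (0 : StrongDual ℝ H) C := by
    intro i
    have : ‖InnerProductSpace.toDual ℝ H (F i)‖ ≤ C := by simpa using hF i
    simpa [T] using this
  obtain ⟨x, hx, hUx⟩ := isCompact_iff_ultrafilter_le_nhds.1 hK (U.map T)
    (le_principal_iff.2 (Filter.mem_map.2 (univ_mem' hT)))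
  set G : H := (InnerProductSpace.toDual ℝ H).symm (WeakDual.toStrongDual x) with hG
  have hlim : ∀ g, Tendsto (fun i => inner ℝ (F i) g) U (𝓝 (inner ℝ G g)) := by
    intro g
    have h1 : Tendsto (fun i => T i g) U (𝓝 (x g)) :=
      ((WeakDual.eval_continuous g).tendsto x).comp hUx
    have h2 : inner ℝ G g = x g := by
      rw [hG, InnerProductSpace.toDual_symm_apply]; rfl
    rw [h2]
    exact h1
  refine ⟨G, ?_, ?_⟩
  · rw [hG, LinearIsometryEquiv.norm_map]
    simpa using hx
  · refine tendsto_inner_of_dense hF hS fun s hs => ?_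
    obtain ⟨a, ha⟩ := h s hs
    have := tendsto_nhds_unique (hlim s) (ha.mono_left (Ultrafilter.of_le l))
    rw [this]
    exact ha

theorem mem_topologicalClosure_of_weak_limit {H' : Type*} [NormedAddCommGroup H']
    [InnerProductSpace ℝ H'] [CompleteSpace H] [CompleteSpace H']
    (V : Submodule ℝ (WithLp 2 (H × H'))) {ι : Type*} {l : Filter ι} [l.NeBot] {w : ι → H}
    {F : ι → H'} (hV : ∀ i, WithLp.toLp 2 (w i, F i) ∈ V.topologicalClosure) {u : H}
    (hw : Tendsto w l (𝓝 u)) {C : ℝ} (hF : ∀ i, ‖F i‖ ≤ C) {S : Set H'} (hS : Dense S) {G : H'}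
    (h : ∀ s ∈ S, Tendsto (fun i => inner ℝ (F i) s) l (𝓝 (inner ℝ G s))) :
    WithLp.toLp 2 (u, G) ∈ V.topologicalClosure := by
  rw [← Submodule.orthogonal_orthogonal_eq_closure] at hV ⊢
  rw [Submodule.mem_orthogonal']
  intro z hz
  have h0 : ∀ i, inner ℝ (w i) z.fst + inner ℝ (F i) z.snd = 0 := by
    intro i
    have := (Submodule.mem_orthogonal' _ _).1 (hV i) z hz
    rwa [WithLp.prod_inner_apply] at this
  rw [WithLp.prod_inner_apply]
  have h1 : Tendsto (fun i => inner ℝ (w i) z.fst) l (𝓝 (inner ℝ u z.fst)) :=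
    hw.inner tendsto_const_nhds
  have h2 := h1.add (tendsto_inner_of_dense hF hS h z.snd)
  simp only [h0] at h2
  exact tendsto_nhds_unique h2 tendsto_const_nhds

end Hilbert

/-! ### Weak limits of gradients -/

/-- The class in `L²(Ω)` of a square integrable function. -/
def MemL2.toL2 {F : Type*} [NormedAddCommGroup F] {f : Space d → F} (hf : MemL2 Ω f) :
    Lp F 2 (volume.restrict Ω) := MemLp.toLp f hf

theorem MemL2.coeFn_toL2 {F : Type*} [NormedAddCommGroup F] {f : Space d → F} (hf : MemL2 Ω f) :
    hf.toL2 =ᵐ[volume.restrict Ω] f := MemLp.coeFn_toLp hf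

theorem MemL2.inner_toL2 {F : Type*} [NormedAddCommGroup F] [InnerProductSpace ℝ F]
    {f g : Space d → F} (hf : MemL2 Ω f) (hg : MemL2 Ω g) :
    inner ℝ hf.toL2 hg.toL2 = ∫ x in Ω, inner ℝ (f x) (g x) := inner_toLp hf hg

theorem MemL2.norm_toL2_sq {F : Type*} [NormedAddCommGroup F] [InnerProductSpace ℝ F]
    {f : Space d → F} (hf : MemL2 Ω f) : ‖hf.toL2‖ ^ 2 = ∫ x in Ω, ‖f x‖ ^ 2 := norm_toLp_sq hf

theorem MemL2.eq_toL2 {F : Type*} [NormedAddCommGroup F] {f : Space d → F} (hf : MemL2 Ω f)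
    {g : Lp F 2 (volume.restrict Ω)} (h : g =ᵐ[volume.restrict Ω] f) : g = hf.toL2 :=
  Lp.ext (h.trans hf.coeFn_toL2.symm)

theorem dense_smooth (Ω : Set (Space d)) :
    Dense {f : Lp (Space d) 2 (volume.restrict Ω) | ∃ ψ : Space d → Space d,
      f =ᵐ[volume.restrict Ω] ψ ∧ HasCompactSupport ψ ∧ ContDiff ℝ ∞ ψ} :=
  Lp.dense_hasCompactSupport_contDiff (by simp)

theorem memL2_of_continuous {F : Type*} [NormedAddCommGroup F] {f : Space d → F}
    (hf : Continuous f) (hfc : HasCompactSupport f) : MemL2 Ω f :=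
  (hf.memLp_of_hasCompactSupport hfc).restrict Ω

theorem continuous_gradient {φ : Space d → ℝ} (hφ : ContDiff ℝ ∞ φ) : Continuous (gradient φ) :=
  (InnerProductSpace.toDual ℝ (Space d)).symm.continuous.comp (hφ.continuous_fderiv (by simp))

theorem hasCompactSupport_gradient {φ : Space d → ℝ} (hφ : HasCompactSupport φ) :
    HasCompactSupport (gradient φ) :=
  (hφ.fderiv ℝ).comp_left (map_zero (InnerProductSpace.toDual ℝ (Space d)).symm)

theorem memL2_gradient {φ : Space d → ℝ} (hφ : ContDiff ℝ ∞ φ) (hφc : HasCompactSupport φ) :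
    MemL2 Ω (gradient φ) :=
  memL2_of_continuous (continuous_gradient hφ) (hasCompactSupport_gradient hφc)

theorem memL2_inner_gradient {φ : Space d → ℝ} (hφ : ContDiff ℝ ∞ φ) (hφc : HasCompactSupport φ)
    (e : Space d) : MemL2 Ω fun x => inner ℝ (gradient φ x) e :=
  memL2_of_continuous ((continuous_gradient hφ).inner continuous_const)
    ((hasCompactSupport_gradient hφc).comp_left (g := fun y => inner ℝ y e) (inner_zero_left _))

theorem memL2_smul_const {φ : Space d → ℝ} (hφ : Continuous φ) (hφc : HasCompactSupport φ)
    (e : Space d) : MemL2 Ω fun x => φ x • e :=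
  memL2_of_continuous (hφ.smul continuous_const) (hφc.smul_right (f' := fun _ => e))

theorem integral_inner_eq_sum {G ψ : Space d → Space d} (hG : MemL2 Ω G) (hψ : Continuous ψ)
    (hψc : HasCompactSupport ψ) : ∫ x in Ω, inner ℝ (G x) (ψ x) =
      ∑ j, ∫ x in Ω, inner ℝ (G x) (ψ x j • EuclideanSpace.single j (1 : ℝ)) := by
  rw [← integral_finsetSum]
  · refine integral_congr_ae (Eventually.of_forall fun x => ?_)
    simp only
    rw [← inner_sum]
    congr 1
    have := (EuclideanSpace.basisFun (Fin d) ℝ).sum_repr (ψ x)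
    simpa using this.symm
  · intro j _
    refine integrable_inner hG (memL2_smul_const (φ := fun x => ψ x j) (by fun_prop) ?_ _)
    exact hψc.comp_left (g := fun y : Space d => y j) rfl

/-- Weak convergence against smooth compactly supported vector fields can be tested on the fields
with a constant direction. -/
theorem tendsto_integral_inner_smooth {ι : Type*} {l : Filter ι} {F : ι → Space d → Space d}
    (hF : ∀ i, MemL2 Ω (F i)) {a : (Space d → ℝ) → Space d → ℝ}
    (h : ∀ φ : Space d → ℝ, ContDiff ℝ ∞ φ → HasCompactSupport φ → ∀ e : Space d,
      Tendsto (fun i => ∫ x in Ω, inner ℝ (F i x) (φ x • e)) l (𝓝 (a φ e)))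
    {ψ : Space d → Space d} (hψ : ContDiff ℝ ∞ ψ) (hψc : HasCompactSupport ψ) :
    Tendsto (fun i => ∫ x in Ω, inner ℝ (F i x) (ψ x)) l
      (𝓝 (∑ j, a (fun x => ψ x j) (EuclideanSpace.single j 1))) := by
  simp only [integral_inner_eq_sum (hF _) hψ.continuous hψc]
  refine tendsto_finsetSum _ fun j _ => h _ (by fun_prop) ?_ _
  exact hψc.comp_left (g := fun y : Space d => y j) rfl

theorem tendsto_toL2 {F : Type*} [NormedAddCommGroup F] {ι : Type*} {l : Filter ι}
    {w : ι → Space d → F} {u : Space d → F}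
    (hw : ∀ i, MemL2 Ω (w i)) (hu : MemL2 Ω u)
    (hlim : Tendsto (fun i => normL2 Ω fun x => w i x - u x) l (𝓝 0)) :
    Tendsto (fun i => (hw i).toL2) l (𝓝 hu.toL2) :=
  (Lp.tendsto_Lp_iff_tendsto_eLpNorm'' w hw u hu).2 hlim

theorem tendsto_integral_mul {ι : Type*} {l : Filter ι}
    {w : ι → Space d → ℝ} {u k : Space d → ℝ} (hw : ∀ i, MemL2 Ω (w i)) (hu : MemL2 Ω u)
    (hlim : Tendsto (fun i => normL2 Ω fun x => w i x - u x) l (𝓝 0)) (hk : MemL2 Ω k) :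
    Tendsto (fun i => ∫ x in Ω, w i x * k x) l (𝓝 (∫ x in Ω, u x * k x)) := by
  have e : ∀ {f : Space d → ℝ} (hf : MemL2 Ω f),
      ∫ x in Ω, f x * k x = inner ℝ hk.toL2 hf.toL2 := fun hf => by
    rw [MemL2.inner_toL2]
    simp [mul_comm]
  simp only [e (hw _), e hu]
  exact tendsto_const_nhds.inner (tendsto_toL2 hw hu hlim)

/-- A bounded family of vector fields that are asymptotically the gradients of a convergent family
of functions has a weak limit, which is the gradient of the limit. -/
theorem exists_hasZeroTraceGradient {ι : Type*} {l : Filter ι} [l.NeBot] {w : ι → Space d → ℝ}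
    {F : ι → Space d → Space d} {u : Space d → ℝ} (hw : ∀ i, MemL2 Ω (w i))
    (hF : ∀ i, MemL2 Ω (F i)) (hu : MemL2 Ω u) {C : ℝ} (hC : 0 ≤ C)
    (hFC : ∀ i, ∫ x in Ω, ‖F i x‖ ^ 2 ≤ C ^ 2)
    (hlim : Tendsto (fun i => normL2 Ω fun x => w i x - u x) l (𝓝 0))
    (hdual : ∀ φ : Space d → ℝ, ContDiff ℝ ∞ φ → HasCompactSupport φ → ∀ e : Space d,
      Tendsto (fun i => (∫ x in Ω, inner ℝ (F i x) (φ x • e)) +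
        ∫ x in Ω, w i x * inner ℝ (gradient φ x) e) l (𝓝 0)) :
    ∃ G, HasZeroTraceGradient Ω u G ∧ ∫ x in Ω, ‖G x‖ ^ 2 ≤ C ^ 2 ∧
      WeaklyTendstoL2 Ω F l G := by
  have hφ : ∀ φ : Space d → ℝ, ContDiff ℝ ∞ φ → HasCompactSupport φ → ∀ e : Space d,
      Tendsto (fun i => ∫ x in Ω, inner ℝ (F i x) (φ x • e)) l
        (𝓝 (-∫ x in Ω, u x * inner ℝ (gradient φ x) e)) := by
    intro φ hφ hφc e
    have := (hdual φ hφ hφc e).sub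
      (tendsto_integral_mul hw hu hlim (memL2_inner_gradient hφ hφc e))
    simpa using this
  have hnorm : ∀ i, ‖(hF i).toL2‖ ≤ C := fun i => by
    refine le_of_sq_le_sq ?_ hC
    rw [MemL2.norm_toL2_sq]
    exact hFC i
  obtain ⟨G, hGC, hG⟩ := exists_weak_limit (l := l) hnorm (dense_smooth Ω) (by
    rintro f ⟨ψ, hfψ, hψc, hψ⟩
    have hψ2 : MemL2 Ω ψ := memL2_of_continuous hψ.continuous hψc
    have e : f = hψ2.toL2 := hψ2.eq_toL2 hfψ
    simp only [e, MemL2.inner_toL2]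
    exact ⟨_, tendsto_integral_inner_smooth hF hφ hψ hψc⟩)
  have hG2 : MemL2 Ω G := Lp.memLp G
  have eG : hG2.toL2 = G := Lp.toLp_coeFn G hG2
  have hweak : WeaklyTendstoL2 Ω F l G := by
    refine ⟨hF, hG2, fun g hg => ?_⟩
    have := hG hg.toL2
    rw [← eG] at this
    simpa only [MemL2.inner_toL2] using this
  refine ⟨G, ⟨hu, hG2, fun φ hφ' hφc e => ?_⟩, ?_, hweak⟩
  · exact tendsto_nhds_unique
      (hweak.2.2 _ (memL2_smul_const hφ'.continuous hφc e)) (hφ φ hφ' hφc e)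
  · rw [← hG2.norm_toL2_sq, eG]
    gcongr

theorem exists_taylor_bounds {φ : Space d → ℝ} (hφ : ContDiff ℝ ∞ φ) (hφc : HasCompactSupport φ) :
    ∃ L₁ L₂ : ℝ, 0 ≤ L₁ ∧ 0 ≤ L₂ ∧ (∀ x y, |φ x - φ y| ≤ L₁ * ‖x - y‖) ∧
      (∀ x y, |φ y - φ x - inner ℝ (gradient φ x) (y - x)| ≤ L₂ * ‖y - x‖ ^ 2) ∧
      ∀ x y, ‖gradient φ x - gradient φ y‖ ≤ L₂ * ‖x - y‖ := by
  obtain ⟨L₁, hL₁⟩ := ContDiff.lipschitzWith_of_hasCompactSupport (𝕂 := ℝ) (n := ∞) hφc hφ (by simp)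
  obtain ⟨L₂, hL₂⟩ := ContDiff.lipschitzWith_of_hasCompactSupport (𝕂 := ℝ) (n := ∞)
    (hφc.fderiv ℝ) (hφ.fderiv_right (by simp)) (by simp)
  refine ⟨L₁, L₂, L₁.2, L₂.2, fun x y => ?_, fun x y => ?_, fun x y => ?_⟩
  · simpa [dist_eq_norm] using hL₁.dist_le_mul x y
  · have h := (convex_closedBall x ‖y - x‖).norm_image_sub_le_of_norm_fderiv_le' (f := φ)
      (φ := fderiv ℝ φ x) (C := L₂ * ‖y - x‖) (𝕜 := ℝ) (x := x) (y := y)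
      (fun z _ => hφ.differentiable (by simp) z) (fun z hz => ?_) (by simp)
      (by simp [dist_eq_norm])
    · rw [inner_gradient_left, sq, ← mul_assoc]
      exact h
    · have h1 := hL₂.dist_le_mul z x
      rw [dist_eq_norm] at h1
      refine h1.trans ?_
      gcongr
      exact hz
  · rw [gradient, gradient, ← map_sub, LinearIsometryEquiv.norm_map]
    simpa [dist_eq_norm] using hL₂.dist_le_mul x y

theorem integral_abs_le {f : Space d → ℝ} (hΩ : Bornology.IsBounded Ω) (hf : MemL2 Ω f) :
    ∫ x in Ω, |f x| ≤ ‖hf.toL2‖ * √(volume.real Ω) := by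
  have : IsFiniteMeasure (volume.restrict Ω) := ⟨by simpa using hΩ.measure_lt_top⟩
  have h := abs_integral_mul_le (μ := volume.restrict Ω) hf.norm (memLp_const (1 : ℝ))
  have h1 := hf.norm_toL2_sq
  simp only [Real.norm_eq_abs, sq_abs, mul_one, one_pow, integral_const, smul_eq_mul,
    measureReal_restrict_apply_univ] at h h1
  rw [← h1, Real.sqrt_sq (norm_nonneg _)] at h
  exact (le_abs_self _).trans h

theorem tendsto_size {ι : Type*} (D : ι → Discretisation Ω) :
    Tendsto (fun i => (D i).size) (sizeToZero D) (𝓝 0) := tendsto_comap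

theorem tendsto_duality (hd : 0 < d) (hΩ : Bornology.IsBounded Ω) {ι : Type*}
    {D : ι → Discretisation Ω} {θ : ℝ} (hθ : ∀ i, (D i).regularity ≤ θ) {v : ∀ i, (D i).X}
    (hv : ∀ i, v i ∈ (D i).X0) {C : ℝ} (hC : ∀ i, (D i).seminormX (v i) ≤ C)
    {u : Space d → ℝ} (hu : MemL2 Ω u)
    (hlim : Tendsto (fun i => normL2 Ω fun x => (D i).reconstruction (v i) x - u x)
      (sizeToZero D) (𝓝 0)) {φ : Space d → ℝ} (hφ : ContDiff ℝ ∞ φ) (hφc : HasCompactSupport φ)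
    (e : Space d) :
    Tendsto (fun i => (∫ x in Ω, inner ℝ ((D i).discreteGradient (v i) x) (φ x • e)) +
      ∫ x in Ω, (D i).reconstruction (v i) x * inner ℝ (gradient φ x) e) (sizeToZero D) (𝓝 0) := by
  obtain ⟨L₁, L₂, hL₁, hL₂, h₁, h₂, h₃⟩ := exists_taylor_bounds hφ hφc
  set B : ℝ := ‖e‖ * L₁ * (volume.real Ω + ((2 + 4 * d * θ ^ 2) * d + 4) * C ^ 2) +
        ‖e‖ * L₁ * (d * volume.real Ω + C ^ 2) +
        ‖e‖ * L₂ * (|θ| * d + 1) * ((‖hu.toL2‖ + 1) * √(volume.real Ω)) with hB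
  have hN := (tendsto_toL2 (fun i => (D i).memL2_reconstruction hΩ (v i)) hu hlim).norm
  have hsz := (tendsto_size D).mul_const B
  rw [zero_mul] at hsz
  refine squeeze_zero_norm' ?_ hsz
  filter_upwards [hN.eventually (gt_mem_nhds (lt_add_one _))] with i hi
  rw [Real.norm_eq_abs]
  refine ((D i).abs_integral_duality_le hd hΩ (hθ i) (v i) (hv i) hφ.continuous
    (continuous_gradient hφ) hL₁ h₁ hL₂ h₂ h₃ e).trans ?_
  have hs0 : 0 ≤ (D i).seminormX (v i) := Real.sqrt_nonneg _
  have hs : (D i).seminormX (v i) ^ 2 ≤ C ^ 2 := by gcongr; exact hC i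
  refine mul_le_mul_of_nonneg_left ?_ (D i).size_nonneg
  rw [hB]
  have hI := integral_abs_le hΩ ((D i).memL2_reconstruction hΩ (v i))
  have hI0 : 0 ≤ ∫ x in Ω, |(D i).reconstruction (v i) x| :=
    integral_nonneg fun _ => abs_nonneg _
  gcongr
  · exact le_abs_self θ
  · exact hI.trans (by gcongr)

theorem neBot_sizeToZero {ι : Type*} {D : ι → Discretisation Ω}
    (hsize : ∀ δ : ℝ, 0 < δ → ∃ i, (D i).size < δ) : (sizeToZero D).NeBot := by
  refine comap_neBot fun t ht => ?_
  obtain ⟨δ, hδ, h⟩ := Metric.mem_nhds_iff.1 ht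
  obtain ⟨i, hi⟩ := hsize δ hδ
  refine ⟨i, h ?_⟩
  rw [Metric.mem_ball, Real.dist_eq, sub_zero, abs_of_nonneg (D i).size_nonneg]
  exact hi

/-- The weak limit of the discrete gradients. -/
theorem exists_weakLimit_discreteGradient (hd : 0 < d) (hΩ : Bornology.IsBounded Ω) {ι : Type*}
    {D : ι → Discretisation Ω} (hsize : ∀ δ : ℝ, 0 < δ → ∃ i, (D i).size < δ) {θ : ℝ}
    (hθ : ∀ i, (D i).regularity ≤ θ) {v : ∀ i, (D i).X}
    (hv : ∀ i, v i ∈ (D i).X0) {C : ℝ} (hC : ∀ i, (D i).seminormX (v i) ≤ C)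
    {u : Space d → ℝ} (hu : MemL2 Ω u)
    (hlim : Tendsto (fun i => normL2 Ω fun x => (D i).reconstruction (v i) x - u x)
      (sizeToZero D) (𝓝 0)) :
    ∃ G, HasZeroTraceGradient Ω u G ∧
      ∫ x in Ω, ‖G x‖ ^ 2 ≤ (√((2 + 4 * d * θ ^ 2) * d + 4) * C) ^ 2 ∧
      WeaklyTendstoL2 Ω (fun i => (D i).discreteGradient (v i)) (sizeToZero D) G := by
  have := neBot_sizeToZero hsize
  obtain ⟨i, -⟩ := hsize 1 one_pos
  have hC0 : 0 ≤ C := (Real.sqrt_nonneg _).trans (hC i)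
  refine exists_hasZeroTraceGradient (fun i => (D i).memL2_reconstruction hΩ (v i))
    (fun i => (D i).memL2_discreteGradient hΩ (v i)) hu (by positivity) (fun i => ?_) hlim
    fun φ hφ hφc e => tendsto_duality hd hΩ hθ hv hC hu hlim hφ hφc e
  refine ((D i).integral_norm_discreteGradient_sq_le hd hΩ (hθ i) (v i)).trans ?_
  have hs0 : 0 ≤ (D i).seminormX (v i) := Real.sqrt_nonneg _
  rw [mul_pow, Real.sq_sqrt (by positivity)]
  gcongr
  exact hC i

/-! ### The closure of the test functions in `H¹` -/

theorem gradient_add {φ ψ : Space d → ℝ} (hφ : Differentiable ℝ φ) (hψ : Differentiable ℝ ψ)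
    (x : Space d) : gradient (fun y => φ y + ψ y) x = gradient φ x + gradient ψ x := by
  rw [gradient, gradient, gradient, ← map_add]
  exact congrArg _ (fderiv_add (hφ x) (hψ x))

theorem gradient_const_mul {φ : Space d → ℝ} (hφ : Differentiable ℝ φ) (c : ℝ) (x : Space d) :
    gradient (fun y => c * φ y) x = c • gradient φ x := by
  rw [gradient, gradient, fderiv_const_mul (hφ x), map_smulₛₗ]
  rfl

theorem IsTestFunction.differentiable {φ : Space d → ℝ} (hφ : IsTestFunction Ω φ) :
    Differentiable ℝ φ := hφ.1.differentiable (by simp)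

theorem IsTestFunction.add {φ ψ : Space d → ℝ} (hφ : IsTestFunction Ω φ)
    (hψ : IsTestFunction Ω ψ) : IsTestFunction Ω fun x => φ x + ψ x :=
  ⟨hφ.1.add hψ.1, hφ.2.1.add hψ.2.1,
    (tsupport_add φ ψ).trans (Set.union_subset hφ.2.2 hψ.2.2)⟩

theorem IsTestFunction.const_mul {φ : Space d → ℝ} (hφ : IsTestFunction Ω φ) (c : ℝ) :
    IsTestFunction Ω fun x => c * φ x :=
  ⟨contDiff_const.mul hφ.1, hφ.2.1.mul_left (f := fun _ => c),
    (tsupport_mul_subset_right (f := fun _ => c)).trans hφ.2.2⟩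

/-- The pairs `(φ, ∇φ)` for `φ ∈ C_c^∞(Ω)`. -/
def testPairs (Ω : Set (Space d)) :
    Submodule ℝ (WithLp 2 (Lp ℝ 2 (volume.restrict Ω) × Lp (Space d) 2 (volume.restrict Ω))) where
  carrier := {p | ∃ φ, IsTestFunction Ω φ ∧ p.fst =ᵐ[volume.restrict Ω] φ ∧
    p.snd =ᵐ[volume.restrict Ω] gradient φ}
  add_mem' := by
    rintro p q ⟨φ, hφ, h1, h2⟩ ⟨ψ, hψ, h3, h4⟩
    refine ⟨_, hφ.add hψ, ?_, ?_⟩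
    · exact (Lp.coeFn_add _ _).trans (h1.add h3)
    · refine (Lp.coeFn_add _ _).trans ((h2.add h4).trans (Eventually.of_forall fun x => ?_))
      exact (gradient_add hφ.differentiable hψ.differentiable x).symm
  zero_mem' := by
    refine ⟨fun _ => 0, ⟨contDiff_const, HasCompactSupport.zero, by simp [tsupport]⟩, ?_, ?_⟩
    · exact Lp.coeFn_zero _ _ _
    · refine (Lp.coeFn_zero _ _ _).trans (Eventually.of_forall fun x => ?_)
      simp [gradient]
  smul_mem' := by
    rintro c p ⟨φ, hφ, h1, h2⟩
    refine ⟨_, hφ.const_mul c, ?_, ?_⟩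
    · exact (Lp.coeFn_smul _ _).trans (h1.const_smul c)
    · refine (Lp.coeFn_smul _ _).trans ((h2.const_smul c).trans (Eventually.of_forall fun x => ?_))
      exact (gradient_const_mul hφ.differentiable c x).symm

/-- The pair `(u, G)` is a limit, in `L²`, of pairs `(φ, ∇φ)` with `φ ∈ C_c^∞(Ω)`. -/
def IsTestLimit (Ω : Set (Space d)) (u : Space d → ℝ) (G : Space d → Space d) : Prop :=
  ∃ (hu : MemL2 Ω u) (hG : MemL2 Ω G),
    WithLp.toLp 2 (hu.toL2, hG.toL2) ∈ (testPairs Ω).topologicalClosure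

theorem IsTestFunction.memL2 {φ : Space d → ℝ} (hφ : IsTestFunction Ω φ) : MemL2 Ω φ :=
  memL2_of_continuous hφ.1.continuous hφ.2.1

theorem IsTestFunction.memL2_gradient {φ : Space d → ℝ} (hφ : IsTestFunction Ω φ) :
    MemL2 Ω (gradient φ) := HybridFV.memL2_gradient hφ.1 hφ.2.1

theorem IsTestFunction.isTestLimit {φ : Space d → ℝ} (hφ : IsTestFunction Ω φ) :
    IsTestLimit Ω φ (gradient φ) :=
  ⟨hφ.memL2, hφ.memL2_gradient, (testPairs Ω).le_topologicalClosure
    ⟨φ, hφ, hφ.memL2.coeFn_toL2, hφ.memL2_gradient.coeFn_toL2⟩⟩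

theorem IsTestFunction.eq_zero {φ : Space d → ℝ} (hφ : IsTestFunction Ω φ) {x : Space d}
    (hx : x ∉ Ω) : φ x = 0 := image_eq_zero_of_notMem_tsupport fun h => hx (hφ.2.2 h)

theorem IsTestFunction.gradient_eq_zero {φ : Space d → ℝ} (hφ : IsTestFunction Ω φ) {x : Space d}
    (hx : x ∉ Ω) : gradient φ x = 0 := by
  have : fderiv ℝ φ x = 0 := by
    by_contra h
    exact hx (hφ.2.2 (support_fderiv_subset ℝ h))
  rw [gradient, this, map_zero]

theorem IsTestFunction.hasZeroTraceGradient {φ : Space d → ℝ} (hφ : IsTestFunction Ω φ) :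
    HasZeroTraceGradient Ω φ (gradient φ) := by
  refine ⟨hφ.memL2, hφ.memL2_gradient, fun ψ hψ hψc e => ?_⟩
  have h1 : ∫ x in Ω, inner ℝ (gradient φ x) (ψ x • e) = ∫ x, inner ℝ (gradient φ x) (ψ x • e) :=
    setIntegral_eq_integral_of_forall_compl_eq_zero fun x hx => by
      rw [hφ.gradient_eq_zero hx, inner_zero_left]
  have h2 : ∫ x in Ω, φ x * inner ℝ (gradient ψ x) e = ∫ x, φ x * inner ℝ (gradient ψ x) e :=
    setIntegral_eq_integral_of_forall_compl_eq_zero fun x hx => by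
      rw [hφ.eq_zero hx, zero_mul]
  have hφ' : Continuous fun x => fderiv ℝ φ x e :=
    (hφ.1.continuous_fderiv (by simp)).clm_apply continuous_const
  have hψ' : Continuous fun x => fderiv ℝ ψ x e :=
    (hψ.continuous_fderiv (by simp)).clm_apply continuous_const
  rw [h1, h2]
  simp only [inner_smul_right, inner_gradient_left]
  rw [integral_mul_fderiv_eq_neg_fderiv_mul_of_integrable]
  · simp only [mul_comm]
  · exact (hψ'.mul hφ.1.continuous).integrable_of_hasCompactSupport
      (HasCompactSupport.mul_left hφ.2.1)
  · exact (hψ.continuous.mul hφ').integrable_of_hasCompactSupport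
      (HasCompactSupport.mul_right hψc)
  · exact (hψ.continuous.mul hφ.1.continuous).integrable_of_hasCompactSupport
      (HasCompactSupport.mul_right hψc)
  · exact fun x _ => hψ.differentiable (by simp) x
  · exact fun x _ => hφ.differentiable x

theorem isTestLimit_of_tendsto {w : ℕ → Space d → ℝ} {F : ℕ → Space d → Space d}
    (hw : ∀ n, HasZeroTraceGradient Ω (w n) (F n)) (hT : ∀ n, IsTestLimit Ω (w n) (F n))
    {u : Space d → ℝ} {G : Space d → Space d} (hu : HasZeroTraceGradient Ω u G)
    (hlim : Tendsto (fun n => normL2 Ω fun x => w n x - u x) atTop (𝓝 0)) {C : ℝ}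
    (hC : 0 ≤ C) (hFC : ∀ n, ∫ x in Ω, ‖F n x‖ ^ 2 ≤ C ^ 2) : IsTestLimit Ω u G := by
  refine ⟨hu.1, hu.2.1, ?_⟩
  refine mem_topologicalClosure_of_weak_limit _ (l := atTop) (w := fun n => (hw n).1.toL2)
    (F := fun n => (hw n).2.1.toL2) (fun n => ?_) (tendsto_toL2 (fun n => (hw n).1) hu.1 hlim)
    (C := C) (fun n => ?_) (dense_smooth Ω) ?_
  · exact (hT n).2.2
  · refine le_of_sq_le_sq ?_ hC
    rw [MemL2.norm_toL2_sq]
    exact hFC n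
  · rintro f ⟨ψ, hfψ, hψc, hψ⟩
    have hψ2 : MemL2 Ω ψ := memL2_of_continuous hψ.continuous hψc
    simp only [hψ2.eq_toL2 hfψ, MemL2.inner_toL2]
    rw [integral_inner_eq_sum hu.2.1 hψ.continuous hψc]
    refine tendsto_integral_inner_smooth (fun n => (hw n).2.1)
      (a := fun φ e => ∫ x in Ω, inner ℝ (G x) (φ x • e)) (fun φ hφ hφc e => ?_) hψ hψc
    simp only [(hw _).2.2 φ hφ hφc e, hu.2.2 φ hφ hφc e]
    exact (tendsto_integral_mul (fun n => (hw n).1) hu.1 hlim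
      (memL2_inner_gradient hφ hφc e)).neg

theorem normL2_eq_ofReal {F : Type*} [NormedAddCommGroup F] {f : Space d → F} (hf : MemL2 Ω f) :
    normL2 Ω f = ENNReal.ofReal ‖hf.toL2‖ := by
  exact (ENNReal.ofReal_toReal (MemLp.eLpNorm_ne_top hf)).symm.trans
    (congrArg _ (Lp.norm_toLp f hf).symm)

theorem tendsto_normL2_of_tendsto_integral_sq {f : ℕ → Space d → ℝ} (hf : ∀ n, MemL2 Ω (f n))
    (h : Tendsto (fun n => ∫ x in Ω, f n x ^ 2) atTop (𝓝 0)) :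
    Tendsto (fun n => normL2 Ω (f n)) atTop (𝓝 0) := by
  have e : ∀ n, normL2 Ω (f n) = ENNReal.ofReal √(∫ x in Ω, f n x ^ 2) := by
    intro n
    have h1 := (hf n).norm_toL2_sq
    simp only [Real.norm_eq_abs, sq_abs] at h1
    rw [normL2_eq_ofReal (hf n), ← h1, Real.sqrt_sq (norm_nonneg _)]
  simp only [e]
  have := ENNReal.tendsto_ofReal ((Real.continuous_sqrt.tendsto 0).comp h)
  simpa using this

theorem HasZeroTraceGradient.hasWeakGradient {u : Space d → ℝ} {G : Space d → Space d}
    (h : HasZeroTraceGradient Ω u G) : HasWeakGradient Ω u G := by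
  refine ⟨h.1, h.2.1, fun φ hφ => ?_⟩
  refine ext_inner_right ℝ fun e => ?_
  have i1 : Integrable (fun x => u x • gradient φ x) (volume.restrict Ω) :=
    memLp_one_iff_integrable.1 (MemLp.smul hφ.memL2_gradient h.1)
  have i2 : Integrable (fun x => φ x • G x) (volume.restrict Ω) :=
    memLp_one_iff_integrable.1 (MemLp.smul h.2.1 hφ.memL2)
  have h1 := h.2.2 φ hφ.1 hφ.2.1 e
  rw [inner_neg_left, real_inner_comm, ← integral_inner i1, real_inner_comm, ← integral_inner i2]
  simp only [inner_smul_right] at h1 ⊢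
  simp only [real_inner_comm _ e] at h1 ⊢
  linarith

theorem IsTestLimit.memH10 {u : Space d → ℝ} {G : Space d → Space d} (h : IsTestLimit Ω u G)
    (hw : HasWeakGradient Ω u G) : MemH10 Ω u := by
  obtain ⟨hu, hG, hcl⟩ := h
  obtain ⟨p, hp, hlim⟩ := mem_closure_iff_seq_limit.1 hcl
  choose φ hφ h1 h2 using hp
  refine ⟨G, hw, φ, hφ, ?_, ?_⟩
  · have := ((WithLp.continuous_fst _ _ _).tendsto _).comp hlim
    refine (Lp.tendsto_Lp_iff_tendsto_eLpNorm'' φ (fun n => (hφ n).memL2) u hu).1 ?_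
    convert! this using 2 with n
    exact ((hφ n).memL2.eq_toL2 (h1 n)).symm
  · have := ((WithLp.continuous_snd _ _ _).tendsto _).comp hlim
    refine (Lp.tendsto_Lp_iff_tendsto_eLpNorm'' (fun n => gradient (φ n))
      (fun n => (hφ n).memL2_gradient) G hG).1 ?_
    convert! this using 2 with n
    exact ((hφ n).memL2_gradient.eq_toL2 (h2 n)).symm

/-- A bounded function whose extension by zero has a square integrable gradient is in
`H¹_0(Ω)`. -/
theorem HasZeroTraceGradient.isTestLimit_of_bounded (hΩ : IsPolyhedralDomain Ω)
    {u : Space d → ℝ} {G : Space d → Space d} (h : HasZeroTraceGradient Ω u G)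
    (hum : Measurable u) {M : ℝ} (hM : ∀ x, |u x| ≤ M) (h0 : ∀ x, x ∉ Ω → u x = 0) :
    IsTestLimit Ω u G := by
  have hΩm := hΩ.isOpen.measurableSet
  obtain ⟨C, hC, hap⟩ := exists_testFunction_near hΩ hum hM
    (integral_nonneg fun x => by positivity) h0
    (h.integral_increment_sq_le hΩm hΩ.isBounded h0)
  choose! w hw h1 h2 using hap
  have hpos : ∀ n : ℕ, 0 < 1 / ((n : ℝ) + 1) := fun n => by positivity
  have hw' := fun n : ℕ => hw _ (hpos n)
  refine isTestLimit_of_tendsto (w := fun n => w (1 / ((n : ℝ) + 1)))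
    (fun n => (hw' n).hasZeroTraceGradient) (fun n => (hw' n).isTestLimit) h ?_
    (C := √C) (Real.sqrt_nonneg C) fun n => ?_
  · refine tendsto_normL2_of_tendsto_integral_sq (fun n => (hw' n).memL2.sub h.1) ?_
    have hz : Tendsto (fun n : ℕ => C * (1 / ((n : ℝ) + 1)) ^ 2) atTop (𝓝 0) := by
      have := (tendsto_one_div_add_atTop_nhds_zero_nat (𝕜 := ℝ)).pow 2 |>.const_mul C
      simpa using this
    refine squeeze_zero (fun n => integral_nonneg fun x => sq_nonneg _) (fun n => ?_) hz
    refine le_trans (le_of_eq ?_) (h1 _ (hpos n))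
    exact setIntegral_eq_integral_of_forall_compl_eq_zero fun x hx => by
      rw [(hw' n).eq_zero hx, h0 x hx, sub_zero, zero_pow two_ne_zero]
  · rw [Real.sq_sqrt hC]
    refine le_trans (le_of_eq ?_) (h2 _ (hpos n))
    exact setIntegral_eq_integral_of_forall_compl_eq_zero fun x hx => by
      rw [(hw' n).gradient_eq_zero hx, norm_zero, zero_pow two_ne_zero]

/-! ### Truncation -/

/-- The truncation of `t` at the levels `± M`. -/
def clamp (M t : ℝ) : ℝ := max (-M) (min M t)

theorem abs_clamp_sub_clamp_le (M s t : ℝ) : |clamp M s - clamp M t| ≤ |s - t| := by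
  have h1 := abs_max_sub_max_le_max (-M) (min M s) (-M) (min M t)
  have h2 := abs_min_sub_min_le_max M s M t
  rw [sub_self, abs_zero] at h1 h2
  exact (h1.trans (max_le (abs_nonneg _) le_rfl)).trans (h2.trans (max_le (abs_nonneg _) le_rfl))

theorem clamp_zero {M : ℝ} (hM : 0 ≤ M) : clamp M 0 = 0 := by
  simp [clamp, hM]

theorem abs_clamp_le {M : ℝ} (hM : 0 ≤ M) (t : ℝ) : |clamp M t| ≤ M :=
  abs_le.2 ⟨le_max_left _ _, max_le (by linarith) (min_le_left _ _)⟩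

theorem clamp_of_abs_le {M t : ℝ} (h : |t| ≤ M) : clamp M t = t := by
  rw [clamp, min_eq_right (abs_le.1 h).2, max_eq_right (abs_le.1 h).1]

theorem continuous_clamp (M : ℝ) : Continuous (clamp M) := by
  unfold clamp; fun_prop

theorem abs_clamp_sub_self_le {M : ℝ} (hM : 0 ≤ M) (t : ℝ) : |clamp M t - t| ≤ |t| := by
  rcases le_or_gt |t| M with h | h
  · simp [clamp_of_abs_le h]
  · rcases abs_cases t with ⟨h1, h2⟩ | ⟨h1, h2⟩ <;> rw [h1] at h ⊢ <;> unfold clamp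
    · rw [min_eq_left h.le, max_eq_right (by linarith), abs_le]
      constructor <;> linarith
    · rw [min_eq_right (by linarith), max_eq_left (by linarith), abs_le]
      constructor <;> linarith

namespace Discretisation

variable (D : Discretisation Ω)

/-- The truncation of a discrete function. -/
def truncate (M : ℝ) (v : D.X) : D.X := (fun K => clamp M (v.1 K), fun σ => clamp M (v.2 σ))

theorem truncate_mem {M : ℝ} (hM : 0 ≤ M) {v : D.X} (hv : v ∈ D.X0) : D.truncate M v ∈ D.X0 :=
  fun σ hσ => by simp only [truncate, hv σ hσ, clamp_zero hM]

theorem seminormX_truncate_le (M : ℝ) (v : D.X) : D.seminormX (D.truncate M v) ≤ D.seminormX v := by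
  refine Real.sqrt_le_sqrt (Finset.sum_le_sum fun K _ => Finset.sum_le_sum fun σ hσ => ?_)
  refine mul_le_mul_of_nonneg_left (sq_le_sq.2 (abs_clamp_sub_clamp_le M _ _)) ?_
  exact div_nonneg measureReal_nonneg Metric.infDist_nonneg

theorem reconstruction_truncate {M : ℝ} (hM : 0 ≤ M) (v : D.X) (x : Space d) :
    D.reconstruction (D.truncate M v) x = clamp M (D.reconstruction v x) := by
  rw [D.comp_reconstruction v (clamp M) (clamp_zero hM)]
  rfl

end Discretisation

theorem tendsto_normL2_clamp_sub {u : Space d → ℝ} (hu : MemL2 Ω u) (hum : Measurable u) :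
    Tendsto (fun n : ℕ => normL2 Ω fun x => clamp n (u x) - u x) atTop (𝓝 0) := by
  have hm : ∀ n : ℕ, Measurable fun x => clamp n (u x) - u x := fun n =>
    ((continuous_clamp n).measurable.comp hum).sub hum
  refine tendsto_normL2_of_tendsto_integral_sq (fun n => ?_) ?_
  · exact hu.mono (hm n).aestronglyMeasurable
      (Eventually.of_forall fun x => abs_clamp_sub_self_le n.cast_nonneg _)
  · have h0 : ∫ x in Ω, (0 : Space d → ℝ) x = 0 := by simp
    rw [← h0]
    refine tendsto_integral_of_dominated_convergence (fun x => u x ^ 2)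
      (fun n => ((hm n).pow_const 2).aestronglyMeasurable) (MemLp.integrable_sq hu)
      (fun n => Eventually.of_forall fun x => ?_) (Eventually.of_forall fun x => ?_)
    · rw [Real.norm_eq_abs, abs_pow, sq_abs]
      exact sq_le_sq.2 (abs_clamp_sub_self_le n.cast_nonneg _)
    · refine tendsto_const_nhds.congr' ?_
      obtain ⟨N, hN⟩ := exists_nat_ge |u x|
      filter_upwards [eventually_ge_atTop N] with n hn
      have : (N : ℝ) ≤ n := by exact_mod_cast hn
      simp [clamp_of_abs_le (hN.trans this)]

end HybridFV

end

theorem lemma4p2 {d : ℕ} (hd : 0 < d) (Ω : Set (HybridFV.Space d))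
    (hΩ : HybridFV.IsPolyhedralDomain Ω) {ι : Type*} (D : ι → HybridFV.Discretisation Ω)
    (hsize : ∀ δ : ℝ, 0 < δ → ∃ i, (D i).size < δ)
    (hreg : ∃ θ : ℝ, 0 < θ ∧ ∀ i, (D i).regularity ≤ θ)
    (v : ∀ i, (D i).X) (hv : ∀ i, v i ∈ (D i).X0)
    (hbound : ∃ C : ℝ, 0 < C ∧ ∀ i, (D i).seminormX (v i) ≤ C)
    (u : HybridFV.Space d → ℝ) (hu : HybridFV.MemL2 Ω u)
    (hlim : Tendsto
      (fun i => HybridFV.normL2 Ω fun x => (D i).reconstruction (v i) x - u x)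
      (HybridFV.sizeToZero D) (𝓝 0)) :
    HybridFV.MemH10 Ω u ∧ ∃ G : HybridFV.Space d → HybridFV.Space d,
      HybridFV.HasWeakGradient Ω u G ∧
      HybridFV.WeaklyTendstoL2 Ω (fun i => (D i).discreteGradient (v i))
        (HybridFV.sizeToZero D) G := by
  obtain ⟨θ, -, hθ⟩ := hreg
  obtain ⟨C, hC0, hC⟩ := hbound
  obtain ⟨G, hG, hGC, hweak⟩ :=
    HybridFV.exists_weakLimit_discreteGradient hd hΩ.isBounded hsize hθ hv hC hu hlim
  refine ⟨?_, G, hG.hasWeakGradient, hweak⟩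
  suffices h : HybridFV.IsTestLimit Ω u G from h.memH10 hG.hasWeakGradient
  obtain ⟨u', hu'm, hu'0, hu'⟩ : ∃ u' : HybridFV.Space d → ℝ, Measurable u' ∧
      (∀ x, x ∉ Ω → u' x = 0) ∧ u =ᵐ[volume.restrict Ω] u' := by
    have hm := hu.1
    refine ⟨Ω.indicator (hm.mk u), hm.stronglyMeasurable_mk.measurable.indicator
      hΩ.isOpen.measurableSet, fun x hx => Set.indicator_of_notMem hx _, ?_⟩
    filter_upwards [hm.ae_eq_mk, ae_restrict_mem hΩ.isOpen.measurableSet] with x h1 h2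
    rw [h1, Set.indicator_of_mem h2]
  have hu'2 : HybridFV.MemL2 Ω u' := MemLp.ae_eq hu' hu
  have hclamp2 : ∀ n : ℕ, HybridFV.MemL2 Ω fun x => HybridFV.clamp n (u' x) := fun n =>
    MemLp.mono hu'2 ((HybridFV.continuous_clamp n).measurable.comp hu'm).aestronglyMeasurable
      (Eventually.of_forall fun x => by
        simpa [HybridFV.clamp_zero n.cast_nonneg] using
          HybridFV.abs_clamp_sub_clamp_le n (u' x) 0)
  have hn : ∀ n : ℕ, ∃ H, HybridFV.HasZeroTraceGradient Ω (fun x => HybridFV.clamp n (u' x)) H ∧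
      ∫ x in Ω, ‖H x‖ ^ 2 ≤ (√((2 + 4 * d * θ ^ 2) * d + 4) * C) ^ 2 := by
    intro n
    obtain ⟨H, h1, h2, -⟩ := HybridFV.exists_weakLimit_discreteGradient hd hΩ.isBounded hsize hθ
      (fun i => (D i).truncate_mem n.cast_nonneg (hv i))
      (fun i => ((D i).seminormX_truncate_le n (v i)).trans (hC i)) (hclamp2 n) (by
        refine tendsto_of_tendsto_of_tendsto_of_le_of_le tendsto_const_nhds hlim
          (fun i => zero_le) fun i => ?_
        refine eLpNorm_mono_ae ?_
        filter_upwards [hu'] with x hx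
        rw [(D i).reconstruction_truncate n.cast_nonneg, hx]
        exact HybridFV.abs_clamp_sub_clamp_le n _ _)
    exact ⟨H, h1, h2⟩
  choose H hH hHC using hn
  refine HybridFV.isTestLimit_of_tendsto hH (fun n => ?_) hG ?_ (by positivity) hHC
  · exact (hH n).isTestLimit_of_bounded hΩ ((HybridFV.continuous_clamp n).measurable.comp hu'm)
      (fun x => HybridFV.abs_clamp_le n.cast_nonneg _)
      fun x hx => by rw [hu'0 x hx, HybridFV.clamp_zero n.cast_nonneg]
  · refine (HybridFV.tendsto_normL2_clamp_sub hu'2 hu'm).congr fun n => eLpNorm_congr_ae ?_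
    filter_upwards [hu'] with x hx
    rw [hx]
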